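/- Let $A=S^1\times[-1,1]$ be the annulus, let $V=S^1\times D^2\cong A\times[-1,1]$ be the solid torus that thickens it, and regard $S^1\times S^2$ as the double of $V$. Fix an embedding of the annulus, that is, an identification (a self-diffeomorphism of $S^1\times S^2$ applied to the standard pair $(V,A)$) of $A$ with a properly embedded annulus in a solid torus whose double is $S^1\times S^2$. A link diagram $D\subset A$ (a generic smooth immersion of finitely many circles in the interior of $A$, with over/under information at its transverse double points) then represents a link in $S^1\times S^2$, up to isotopy. (1) Let $D$ and $D'$ be two link diagrams in $A$ that differ only in a part of $A$ diffeomorphic to $(-1,1)\times[-1,1]$, the second factor running from boundary to boundary of $A$. Suppose that in this part $D$ consists of three parallel strands $(-1,1)\times\{-\tfrac12\}$, $(-1,1)\times\{0\}$, $(-1,1)\times\{\tfrac12\}$, and $D'$ is the standard alternating four-crossing diagram of the $3$-braid $\sigma_1^2\sigma_2^{-2}$ (the first two strands make a full turn about each other, then the last two strands make a full turn about each other in the opposite sense). Then $D$ and $D'$ represent the same link in $S^1\times S^2$. (2) Consequently the Tait statement fails for $\mathbb Z_2$-homologically non-trivial links: there are a knot $K\subset S^1\times S^2$ with $0\ne[K]\in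 H_1(S^1\times S^2;\mathbb Z_2)$ and two diagrams $D,D'\subset A$ that both represent $K$ with the fixed embedding of the annulus, are both alternating and simple, and have different numbers of crossings, $n(D)<n(D')$. In particular the alternating simple diagram $D'$ has more crossings than the crossing number of $K$ (the least number of crossings of a diagram that represents $K$ via some embedding of the annulus). Here a diagram is *alternating* if every component meets overpasses and underpasses alternately. It is *simple* if (a) there is no embedded closed disk in $A$ whose boundary meets the diagram exactly in one crossing, passing there through two opposite quadrants, and (b) no crossing is adjacent to two different external regions, where the external regions are the connected components of $A\setminus D$ that touch $\partial A$. -/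

import Mathlib

open scoped Manifold ContDiff

noncomputable section

/-! ### The manifold `S¹ × S²` and its standard annulus -/

/-- The unit sphere `S²` in `ℝ³`. -/
abbrev S2 : Type := Metric.sphere (0 : EuclideanSpace ℝ (Fin 3)) 1

/-- The closed 3-manifold `S¹ × S²`. -/
abbrev S1S2 : Type := Circle × S2

/-- The model with corners of the smooth manifold `S¹ × S²`. -/
abbrev modelS1S2 := (𝓡 1).prod (𝓡 2)

/-- The surface `S¹ × ℝ`, which contains the annulus `S¹ × [-1,1]`. -/
abbrev Cyl : Type := Circle × ℝ

/-- `S¹ × ℝ` inside `ℂ × ℝ`; smoothness in `S¹ × ℝ` is tested after this inclusion. -/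
def Cyl.coe (z : Cyl) : ℂ × ℝ := ((z.1 : ℂ), z.2)

/-- The annulus `S¹ × [-1,1]`. -/
def annulus : Set Cyl := {z | |z.2| ≤ 1}

/-- The point of the lower hemisphere of `S²` that lies under the point `(x,y)` of the unit disk. -/
def hemi (x y : ℝ) (h : x ^ 2 + y ^ 2 ≤ 1) : S2 :=
  ⟨!₂[x, y, -√(1 - x ^ 2 - y ^ 2)], by
    have h' : 0 ≤ 1 - x ^ 2 - y ^ 2 := by linarith
    rw [mem_sphere_zero_iff_norm, EuclideanSpace.norm_eq, Real.sqrt_eq_one]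
    simp [Fin.sum_univ_three, Real.sq_sqrt h']⟩

/-- An H-decomposition of `S¹ × S²` (a presentation as the double of the solid torus
`V = S¹ × D²`) together with a proper embedding of the annulus `S¹ × [-1,1]` in `V`
and an identification of `V` with its thickening.
In the standard one `V = S¹ × (lower hemisphere)`, the complementary solid torus is
`S¹ × (upper hemisphere)`, the annulus is `(θ, x) ↦ (θ, hemi x 0)`, and the thickening direction is
the second coordinate of the disk. All others are the images of the standard one under the
diffeomorphisms of `S¹ × S²` (twisting the annulus, moving `V`, ...). -/
abbrev AnnulusEmbedding : Type := S1S2 ≃ₘ^∞⟮modelS1S2, modelS1S2⟯ S1S2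

/-! ### Links in `S¹ × S²` -/

/-- Parameters `t` on the `k`-th circle and `u` on the `l`-th circle of `n` copies of `ℝ / ℤ`
that denote the same point. -/
def SameParam {n : ℕ} (k : Fin n) (t : ℝ) (l : Fin n) (u : ℝ) : Prop :=
  k = l ∧ ∃ m : ℤ, u = t + m

/-- `f` is a smooth embedding of `n` disjoint circles `ℝ / ℤ` in `S¹ × S²`. -/
structure IsSmoothLink {n : ℕ} (f : Fin n → ℝ → S1S2) : Prop where
  smooth : ∀ k, ContMDiff 𝓘(ℝ, ℝ) modelS1S2 ∞ (f k)
  periodic : ∀ k, Function.Periodic (f k) 1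
  immersion : ∀ k t, Function.Injective (mfderiv 𝓘(ℝ, ℝ) modelS1S2 (f k) t)
  injective : ∀ k t l u, f k t = f l u → SameParam k t l u

/-- A link in `S¹ × S²`, with a smooth parametrization of its components. -/
structure SmoothLink where
  n : ℕ
  toFun : Fin n → ℝ → S1S2
  isSmoothLink : IsSmoothLink toFun

/-- A knot is a link with one component. -/
def SmoothLink.IsKnot (K : SmoothLink) : Prop := K.n = 1

/-- A change of parametrization of `n` circles: relabelling the circles by `e` and
applying on each of them the diffeomorphism of `ℝ / ℤ` (which may reverse the orientation)
that lifts to `ψ`. -/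
def IsReparam {n m : ℕ} (_e : Fin n ≃ Fin m) (ψ : Fin n → ℝ → ℝ) : Prop :=
  ∀ k, ContDiff ℝ ∞ (ψ k) ∧ (∀ t, deriv (ψ k) t ≠ 0) ∧
    ((∀ t, ψ k (t + 1) = ψ k t + 1) ∨ (∀ t, ψ k (t + 1) = ψ k t - 1))

/-- `f` and `g` parametrize the same (unoriented, unordered) link up to isotopy: there is a smooth
isotopy through smooth links from `f` to a reparametrization of `g`. -/
def SameLink {n m : ℕ} (f : Fin n → ℝ → S1S2) (g : Fin m → ℝ → S1S2) : Prop :=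
  ∃ (F : Fin n → ℝ × ℝ → S1S2) (e : Fin n ≃ Fin m) (ψ : Fin n → ℝ → ℝ),
    (∀ k, ContMDiff 𝓘(ℝ, ℝ × ℝ) modelS1S2 ∞ (F k)) ∧
    (∀ τ ∈ Set.Icc (0 : ℝ) 1, IsSmoothLink fun k t => F k (τ, t)) ∧
    IsReparam e ψ ∧
    (∀ k t, F k (0, t) = f k t) ∧
    (∀ k t, F k (1, t) = g (e k) (ψ k t))

/-! ### The `ℤ/2`-homology class of a link -/

/-- Singular `k`-chains of `S¹ × S²` with coefficients in `ℤ/2`. -/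
abbrev SingChain (k : ℕ) : Type := C(stdSimplex ℝ (Fin (k + 1)), S1S2) →₀ ZMod 2

/-- The inclusion of the `i`-th face of the standard simplex. -/
def faceIncl (k : ℕ) (i : Fin (k + 2)) :
    C(stdSimplex ℝ (Fin (k + 1)), stdSimplex ℝ (Fin (k + 2))) :=
  ⟨stdSimplex.map i.succAbove, stdSimplex.continuous_map _⟩

/-- The singular boundary operator. -/
def singBoundary (k : ℕ) : SingChain (k + 1) →ₗ[ZMod 2] SingChain k :=
  Finsupp.linearCombination (ZMod 2) fun σ : C(stdSimplex ℝ (Fin (k + 2)), S1S2) =>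
    ∑ i : Fin (k + 2), Finsupp.single (σ.comp (faceIncl k i)) ((-1 : ZMod 2) ^ (i : ℕ))

/-- The `k`-th component of a link, run through once, as a singular 1-simplex. -/
def SmoothLink.loop (K : SmoothLink) (k : Fin K.n) : C(stdSimplex ℝ (Fin 2), S1S2) :=
  ⟨fun x => K.toFun k (x.1 1),
    (K.isSmoothLink.smooth k).continuous.comp ((continuous_apply 1).comp continuous_subtype_val)⟩

/-- The class of `K` in `H₁(S¹ × S²; ℤ/2)` is zero: its fundamental cycle is a boundary. -/
def SmoothLink.IsZ2Trivial (K : SmoothLink) : Prop :=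
  ∃ c : SingChain 2, singBoundary 1 c = ∑ k : Fin K.n, Finsupp.single (K.loop k) (1 : ZMod 2)

/-! ### Link diagrams in the annulus -/

/-- `t` on the `k`-th circle and `u` on the `l`-th circle are two different points of the circles
with the same image. -/
def IsDoublePair {n : ℕ} (γ : Fin n → ℝ → Cyl) (k : Fin n) (t : ℝ) (l : Fin n) (u : ℝ) : Prop :=
  γ k t = γ l u ∧ ¬ SameParam k t l u

/-- A link diagram in the annulus: a generic smooth immersion of finitely many circles `ℝ / ℤ`
in the interior of `S¹ × [-1,1]` (finitely many transverse double points, no triple points), with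
the information, at each double point, which of the two branches is the overpass.
Only the values of `isOver` at parameters of double points have a meaning. -/
structure AnnularDiagram where
  n : ℕ
  curve : Fin n → ℝ → Cyl
  isOver : Fin n → ℝ → Prop
  smooth : ∀ k, ContDiff ℝ ∞ fun t => (curve k t).coe
  periodic : ∀ k, Function.Periodic (curve k) 1
  mem_interior : ∀ k t, |(curve k t).2| < 1
  immersion : ∀ k t, deriv (fun s => (curve k s).coe) t ≠ 0
  transverse : ∀ k t l u, IsDoublePair curve k t l u →
    LinearIndependent ℝ ![deriv (fun s => (curve k s).coe) t, deriv (fun s => (curve l s).coe) u]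
  no_triple : ∀ k t l u j v, IsDoublePair curve k t l u → IsDoublePair curve l u j v →
    ¬ IsDoublePair curve k t j v
  finite_double : {z | ∃ k t l u, IsDoublePair curve k t l u ∧ curve k t = z}.Finite
  over_periodic : ∀ k t, isOver k (t + 1) ↔ isOver k t
  over_iff : ∀ k t l u, IsDoublePair curve k t l u → (isOver k t ↔ ¬ isOver l u)

namespace AnnularDiagram

variable (D : AnnularDiagram)

/-- The underlying 4-valent graph, as a subset of the annulus. -/
def image : Set Cyl := {z | ∃ k t, D.curve k t = z}

/-- The set of crossings. -/
def crossings : Set Cyl := {z | ∃ k t l u, IsDoublePair D.curve k t l u ∧ D.curve k t = z}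

/-- The number of crossings. -/
def numCrossings : ℕ := D.crossings.ncard

/-- `t` is a parameter at which the `k`-th component runs through a crossing. -/
def IsCrossingParam (k : Fin D.n) (t : ℝ) : Prop := ∃ l u, IsDoublePair D.curve k t l u

/-- The components meet overpasses and underpasses alternately. -/
def IsAlternating : Prop :=
  ∀ k t u, t < u → D.IsCrossingParam k t → D.IsCrossingParam k u →
    (∀ v ∈ Set.Ioo t u, ¬ D.IsCrossingParam k v) → (D.isOver k t ↔ ¬ D.isOver k u)

/-- The external region (connected component of the complement of the diagram in the annulus)
that contains the boundary circle `S¹ × {ε}`, for `ε = 1` or `ε = -1`. -/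
def externalRegion (ε : ℝ) : Set Cyl :=
  connectedComponentIn (annulus \ D.image) ((1 : Circle), ε)

/-- There is an embedded closed disk in the annulus whose boundary meets the diagram exactly in the
crossing `c`, and passes through opposite quadrants there (near `c` the diagram has points both
inside and outside the disk). -/
def IsCutByDisk (c : Cyl) : Prop :=
  ∃ E : Set Cyl, E ⊆ annulus ∧ Nonempty (E ≃ₜ Metric.closedBall (0 : ℂ) 1) ∧
    frontier E ∩ D.image = {c} ∧ c ∈ closure (interior E ∩ D.image) ∧ c ∈ closure (D.image \ E)

/-- The crossing `c` is adjacent to two different external regions. -/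
def IsAdjacentToBothEnds (c : Cyl) : Prop :=
  D.externalRegion 1 ≠ D.externalRegion (-1) ∧
    c ∈ closure (D.externalRegion 1) ∧ c ∈ closure (D.externalRegion (-1))

/-- A diagram is simple if no crossing is cut by a disk and
no crossing is adjacent to two external regions. -/
def IsSimple : Prop :=
  ∀ c ∈ D.crossings, ¬ D.IsCutByDisk c ∧ ¬ D.IsAdjacentToBothEnds c

/-- Height functions on the components that realize the crossing information and keep the
lifted curves in the open solid torus `S¹ × int D²`. -/
structure Height where
  h : Fin D.n → ℝ → ℝ
  smooth : ∀ k, ContDiff ℝ ∞ (h k)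
  periodic : ∀ k, Function.Periodic (h k) 1
  mem_disk : ∀ k t, (D.curve k t).2 ^ 2 + h k t ^ 2 < 1
  over_iff : ∀ k t l u, IsDoublePair D.curve k t l u → (D.isOver k t ↔ h l u < h k t)

/-- The curves in the standard solid torus `S¹ × (lower hemisphere)` that lie over the diagram at
the given heights. -/
def lift (H : D.Height) (k : Fin D.n) (t : ℝ) : S1S2 :=
  ((D.curve k t).1, hemi (D.curve k t).2 (H.h k t) (H.mem_disk k t).le)

/-- The diagram represents the link `K` via the embedding `ι` of the annulus. -/
def Represents (ι : AnnulusEmbedding) (K : SmoothLink) : Prop :=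
  ∃ H : D.Height, SameLink (fun k t => ι (D.lift H k t)) K.toFun

end AnnularDiagram

/-- Via the embedding `ι` of the annulus, the two diagrams represent the same link. -/
def RepresentSameLink (ι : AnnulusEmbedding) (D D' : AnnularDiagram) : Prop :=
  (∃ K, D.Represents ι K) ∧ ∀ K, D.Represents ι K ↔ D'.Represents ι K

/-- The crossing number of a link: the minimal number of crossings of a diagram that represents it
via some embedding of the annulus. -/
def crossingNumber (K : SmoothLink) : ℕ :=
  sInf {c | ∃ (ι : AnnulusEmbedding) (D : AnnularDiagram), D.Represents ι K ∧ D.numCrossings = c}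

/-! ### The local replacement -/

/-- The strip `(-1,1) × [-1,1]`. -/
def strip : Set (ℝ × ℝ) := Set.Ioo (-1) 1 ×ˢ Set.Icc (-1) 1

/-- `φ` is a diffeomorphism of `(-1,1) × [-1,1]` (smooth up to the boundary) onto a part of the
annulus `S¹ × [-1,1]`, boundary going to boundary. -/
structure IsBand (φ : ℝ × ℝ → Cyl) : Prop where
  smooth : ContDiffOn ℝ ∞ (fun p => (φ p).coe) strip
  immersion : ∀ p ∈ strip, Function.Injective (fderivWithin ℝ (fun q => (φ q).coe) strip p)
  injOn : Set.InjOn φ strip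
  mapsTo : Set.MapsTo φ strip annulus
  boundary : ∀ p ∈ strip, |(φ p).2| = 1 ↔ |p.2| = 1

/-- Three parallel strands `(s, -1/2)`, `(s, 0)`, `(s, 1/2)` in the strip. -/
def parallelStrand (i : Fin 3) (_s : ℝ) : ℝ := ![-1 / 2, 0, 1 / 2] i

/-- Angle of the first twist: it grows from `0` to `2π` for `-2/3 ≤ s ≤ -1/3`. -/
def twistAngle₁ (s : ℝ) : ℝ := 2 * Real.pi * Real.smoothTransition (3 * s + 2)

/-- Angle of the second twist: it grows from `0` to `2π` for `1/3 ≤ s ≤ 2/3`. -/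
def twistAngle₂ (s : ℝ) : ℝ := 2 * Real.pi * Real.smoothTransition (3 * s - 1)

/-- The strands of the 3-braid `σ₁² σ₂⁻²`, drawn in the strip as `(s, twistedStrand i s)`:
first the strands 0 and 1 make a full turn about each other (two crossings), then the strands 1 and
2 make a full turn about each other in the opposite sense (two crossings). Strand 1 is
over, under, over, under at its four crossings: this part of the diagram is alternating. -/
def twistedStrand (i : Fin 3) (s : ℝ) : ℝ :=
  ![-1 / 4 - Real.cos (twistAngle₁ s) / 4,
    (Real.cos (twistAngle₁ s) - Real.cos (twistAngle₂ s)) / 4,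
    1 / 4 + Real.cos (twistAngle₂ s) / 4] i

/-- The heights of the strands of the 3-braid `σ₁² σ₂⁻²`; at a crossing the higher strand is the
overpass. -/
def twistedHeight (i : Fin 3) (s : ℝ) : ℝ :=
  ![-Real.sin (twistAngle₁ s) / 4,
    (Real.sin (twistAngle₁ s) + Real.sin (twistAngle₂ s)) / 4,
    -Real.sin (twistAngle₂ s) / 4] i

/-- The diagrams `D` and `D'` differ only in a part of the annulus diffeomorphic to
`(-1,1) × [-1,1]`, where `D` consists of three parallel strands and `D'` is the alternating diagram
of the 3-braid `σ₁² σ₂⁻²`. (The braid is pure, so that the circles of `D` and of `D'` correspond to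
each other: up to a change of parametrization, corresponding parameters give the same point
outside the band, and the same strand at the same `s` inside.) -/
def DifferByBandMove (D D' : AnnularDiagram) : Prop :=
  ∃ (φ : ℝ × ℝ → Cyl) (e : Fin D.n ≃ Fin D'.n) (ψ : Fin D.n → ℝ → ℝ),
    IsBand φ ∧ IsReparam e ψ ∧
    (∀ k t,
      (D.curve k t ∉ φ '' strip ∧ D'.curve (e k) (ψ k t) = D.curve k t) ∨
      ∃ i, ∃ s ∈ Set.Ioo (-1 : ℝ) 1, D.curve k t = φ (s, parallelStrand i s) ∧
        D'.curve (e k) (ψ k t) = φ (s, twistedStrand i s)) ∧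
    (∀ i, ∀ s ∈ Set.Ioo (-1 : ℝ) 1, ∃ k t, D.curve k t = φ (s, parallelStrand i s)) ∧
    (∀ k t, D.curve k t ∉ φ '' strip → D.IsCrossingParam k t →
      (D'.isOver (e k) (ψ k t) ↔ D.isOver k t)) ∧
    (∀ k t l u i j, ∀ s ∈ Set.Ioo (-1 : ℝ) 1, i ≠ j →
      D.curve k t = φ (s, parallelStrand i s) → D.curve l u = φ (s, parallelStrand j s) →
      twistedStrand i s = twistedStrand j s →
      (D'.isOver (e k) (ψ k t) ↔ twistedHeight j s < twistedHeight i s))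

end

/-!
A diagram with three parallel strands in a band and the diagram with `σ₁² σ₂⁻²` in their place
represent the same link because the double of the band is `(-1,1) × S²`, where the braid `σ₁² σ₂⁻²`
is trivial: it is a double turn of the sphere, and `π₁(SO(3))` has order two.

The lifts of a diagram at any two height functions are isotopic (`AnnularDiagram.sameLink_lift`, by
linear interpolation), so it suffices to find heights at which the lifts of the two diagrams are
isotopic, and the embedding of the annulus plays no role. The part of `S¹ × S²` over the
band is parametrized by `bandDouble`: the vertical circle over `(s, x)` goes to the one over
`φ (s, x)` by a dilation. Its factor is `√k`, where `1 - X² = k (1 - x²)` for the second coordinate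
`X` of `φ`. Both sides vanish to first order on the boundary of the band, so by Hadamard's lemma `k`
(`IsBand.ratioSq`) extends to a smooth positive function. Hence a homotopy through braids in
`(-1,1) × S²`, constant near the ends, gives an isotopy of links
(`MeetsBandInStrands.sameLink_glue`). The strands start at three points of a great circle of `S²`,
which spans a plane through the first coordinate axis, and there are three homotopies:
* In `σ₁² σ₂⁻²` the middle strand turns around the left one and then, in the opposite sense, around
  the right one. On the sphere both are turns about the first axis in the same sense, so the middle
  strand makes a double turn about this axis (`sameLink_glue_twisted_spin`).
* The outer strands can join this double turn, since a strand to the left or to the right of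
  the middle one keeps its first coordinate (`sameLink_glue_spin_rotX`).
* A double turn of all of `S²` is undone by the belt trick (`sameLink_glue_rotX_lift`).

For the second assertion, consider curves that run three times around the annulus without turning
back (`ClosedBraid`). Their diagrams are always simple: an arc from a crossing back to it winds
around the annulus, so it is not contained in a disk, and a point adjacent to both external regions
would be a common point of all three strands (`ClosedBraid.isSimple_toDiagram`). The closure of
`σ₁ σ₂⁻¹` (`baseBraid`) is such a curve with two crossings. Inserting `σ₁² σ₂⁻²` gives a curve
with six crossings (`insertedBraid`). The numbering of its crossing parameters in their order
shows that it is alternating: the overpasses are the odd ones. The two diagrams differ by the band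
move (`differByBandMove_base_inserted`). The knot that they represent has degree three over
`S¹`, hence is not zero in homology modulo 2: the number of turns of a path in the circle, with a
correction at its ends, is a singular cocycle (`turns_face`, `SmoothLink.not_isZ2Trivial`).
-/

noncomputable section

/-! ### Smoothness and immersions in `S¹ × S²` -/

theorem contMDiff_coe_circle {m : WithTop ℕ∞} :
    ContMDiff (𝓡 1) 𝓘(ℝ, ℂ) m (fun z : Circle => (z : ℂ)) := by
  have : Fact (Module.finrank ℝ ℂ = 1 + 1) := finrank_real_complex_fact'
  exact (contMDiff_coe_sphere (E := ℂ) (n := 1) :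
    ContMDiff (𝓡 1) 𝓘(ℝ, ℂ) m (fun z : Metric.sphere (0 : ℂ) 1 => (z : ℂ)))

theorem contMDiff_coe_S2 {m : WithTop ℕ∞} :
    ContMDiff (𝓡 2) 𝓘(ℝ, EuclideanSpace ℝ (Fin 3)) m
      (fun p : S2 => (p : EuclideanSpace ℝ (Fin 3))) :=
  have := Fact.mk (@finrank_euclideanSpace_fin ℝ _ (2 + 1))
  contMDiff_coe_sphere

/-- Smoothness of a map to `S¹ × S²` is tested in `ℂ × ℝ³`. -/
theorem contMDiff_S1S2_iff {E : Type*} [NormedAddCommGroup E] [NormedSpace ℝ E] {f : E → S1S2} :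
    ContMDiff 𝓘(ℝ, E) modelS1S2 ∞ f ↔
      ContDiff ℝ ∞ (fun x => ((f x).1 : ℂ)) ∧
      ContDiff ℝ ∞ (fun x => ((f x).2 : EuclideanSpace ℝ (Fin 3))) := by
  constructor
  · intro h
    exact ⟨(contMDiff_coe_circle.comp (contMDiff_fst.comp h)).contDiff,
      (contMDiff_coe_S2.comp (contMDiff_snd.comp h)).contDiff⟩
  · rintro ⟨h1, h2⟩
    have a : ContMDiff 𝓘(ℝ, E) (𝓡 1) ∞ (fun x => (f x).1) := by
      have : Fact (Module.finrank ℝ ℂ = 1 + 1) := finrank_real_complex_fact'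
      exact ContMDiff.codRestrict_sphere (E := ℂ) h1.contMDiff
        (fun x => mem_sphere_zero_iff_norm.2 (Circle.norm_coe (f x).1))
    have b : ContMDiff 𝓘(ℝ, E) (𝓡 2) ∞ (fun x => (f x).2) := by
      have := Fact.mk (@finrank_euclideanSpace_fin ℝ _ (2 + 1))
      exact ContMDiff.codRestrict_sphere h2.contMDiff (fun x => (f x).2.2)
    exact a.prodMk b

/-- The projection `S¹ × S² → S¹ × [-1,1]`, whose restriction to the solid torus
`S¹ × (lower hemisphere)` is the projection to the annulus. -/
def toCyl (p : S1S2) : Cyl := (p.1, (p.2 : EuclideanSpace ℝ (Fin 3)) 0)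

theorem contMDiff_coe_toCyl :
    ContMDiff modelS1S2 𝓘(ℝ, ℂ × ℝ) ∞ (fun p : S1S2 => (toCyl p).coe) := by
  have h1 : ContMDiff modelS1S2 𝓘(ℝ, ℂ) ∞ (fun p : S1S2 => (p.1 : ℂ)) :=
    contMDiff_coe_circle.comp contMDiff_fst
  have h2 : ContMDiff modelS1S2 𝓘(ℝ, ℝ) ∞
      (fun p : S1S2 => (p.2 : EuclideanSpace ℝ (Fin 3)) 0) := by
    have h3 : ContDiff ℝ ∞ (fun v : EuclideanSpace ℝ (Fin 3) => v 0) := by fun_prop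
    exact h3.contMDiff.comp (contMDiff_coe_S2.comp contMDiff_snd)
  exact h1.prodMk_space h2

/-- A curve in `S¹ × S²` is immersed wherever its projection to `S¹ × [-1,1]` is. -/
theorem injective_mfderiv_of_toCyl {f : ℝ → S1S2} (hf : ContMDiff 𝓘(ℝ, ℝ) modelS1S2 ∞ f) {t : ℝ}
    (h : deriv (fun s => (toCyl (f s)).coe) t ≠ 0) :
    Function.Injective (mfderiv 𝓘(ℝ, ℝ) modelS1S2 f t) := by
  have hfd : MDifferentiableAt 𝓘(ℝ, ℝ) modelS1S2 f t := (hf t).mdifferentiableAt (by simp)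
  have hgd : MDifferentiableAt modelS1S2 𝓘(ℝ, ℂ × ℝ) (fun p : S1S2 => (toCyl p).coe) (f t) :=
    (contMDiff_coe_toCyl (f t)).mdifferentiableAt (by simp)
  have key : mfderiv 𝓘(ℝ, ℝ) 𝓘(ℝ, ℂ × ℝ) (fun s => (toCyl (f s)).coe) t = _ :=
    mfderiv_comp t hgd hfd
  rw [mfderiv_eq_fderiv] at key
  refine (injective_iff_map_eq_zero (mfderiv 𝓘(ℝ, ℝ) modelS1S2 f t)).2 fun v hv => ?_
  have h0 : (fderiv ℝ (fun s => (toCyl (f s)).coe) t) v = 0 := by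
    rw [key]
    change (mfderiv modelS1S2 𝓘(ℝ, ℂ × ℝ) (fun p : S1S2 => (toCyl p).coe) (f t))
      (mfderiv 𝓘(ℝ, ℝ) modelS1S2 f t v) = 0
    rw [hv, map_zero]
  have h1 : (fderiv ℝ (fun s => (toCyl (f s)).coe) t) v =
      (show ℝ from v) • deriv (fun s => (toCyl (f s)).coe) t := by
    rw [← fderiv_apply_one_eq_deriv, ← map_smul]
    congr 1
    exact (mul_one (show ℝ from v)).symm
  rw [h1] at h0
  exact (smul_eq_zero.1 h0).resolve_right h

theorem contDiff_E3 {E : Type*} [NormedAddCommGroup E] [NormedSpace ℝ E] {n : WithTop ℕ∞}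
    {f g h : E → ℝ}
    (hf : ContDiff ℝ n f) (hg : ContDiff ℝ n g) (hh : ContDiff ℝ n h) :
    ContDiff ℝ n (fun x => (!₂[f x, g x, h x] : EuclideanSpace ℝ (Fin 3))) := by
  rw [contDiff_euclidean]
  intro i
  fin_cases i <;> simpa

theorem contDiffAt_E3 {E : Type*} [NormedAddCommGroup E] [NormedSpace ℝ E] {n : WithTop ℕ∞}
    {f g h : E → ℝ} {x : E}
    (hf : ContDiffAt ℝ n f x) (hg : ContDiffAt ℝ n g x) (hh : ContDiffAt ℝ n h x) :
    ContDiffAt ℝ n (fun x => (!₂[f x, g x, h x] : EuclideanSpace ℝ (Fin 3))) x := by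
  rw [contDiffAt_euclidean]
  intro i
  fin_cases i <;> simpa

theorem S2_sum_sq (p : S2) : p.1 0 ^ 2 + p.1 1 ^ 2 + p.1 2 ^ 2 = 1 := by
  have h := p.2
  rw [mem_sphere_zero_iff_norm, EuclideanSpace.norm_eq, Real.sqrt_eq_one] at h
  simpa [Fin.sum_univ_three] using h

theorem S2_ext {p q : S2} (h0 : p.1 0 = q.1 0) (h1 : p.1 1 = q.1 1) (h2 : p.1 2 = q.1 2) :
    p = q := by
  apply Subtype.ext
  ext i
  fin_cases i
  exacts [h0, h1, h2]

theorem mem_S2_of_sum_sq {x y z : ℝ} (h : x ^ 2 + y ^ 2 + z ^ 2 = 1) :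
    (!₂[x, y, z] : EuclideanSpace ℝ (Fin 3)) ∈ Metric.sphere (0 : EuclideanSpace ℝ (Fin 3)) 1 := by
  rw [mem_sphere_zero_iff_norm, EuclideanSpace.norm_eq, Real.sqrt_eq_one]
  simpa [Fin.sum_univ_three] using h

/-- A point of the open lower hemisphere is determined by its first two coordinates. -/
theorem eq_hemi_of_neg (p : S2) (hz : p.1 2 < 0) (h : p.1 0 ^ 2 + p.1 1 ^ 2 ≤ 1) :
    p = hemi (p.1 0) (p.1 1) h := by
  refine S2_ext rfl rfl ?_
  have h1 := S2_sum_sq p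
  have h2 : 1 - p.1 0 ^ 2 - p.1 1 ^ 2 = (-p.1 2) ^ 2 := by linarith
  simp only [hemi, h2]
  rw [Real.sqrt_sq (by linarith)]
  simp

/-! ### Reparametrizations and the equivalence of links -/

theorem SameParam.symm {n : ℕ} {k l : Fin n} {t u : ℝ} (h : SameParam k t l u) :
    SameParam l u k t := by
  obtain ⟨rfl, m, rfl⟩ := h
  exact ⟨rfl, -m, by push_cast; ring⟩

theorem SameParam.trans {n : ℕ} {k l j : Fin n} {t u v : ℝ} (h : SameParam k t l u)
    (h' : SameParam l u j v) : SameParam k t j v := by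
  obtain ⟨rfl, m, rfl⟩ := h
  obtain ⟨rfl, m', rfl⟩ := h'
  exact ⟨rfl, m + m', by push_cast; ring⟩

namespace IsReparam
variable {n m : ℕ} {e : Fin n ≃ Fin m} {ψ : Fin n → ℝ → ℝ}

theorem refl : IsReparam (Equiv.refl (Fin n)) (fun _ t => t) := fun _ =>
  ⟨contDiff_id, fun t => by simp, Or.inl fun _ => rfl⟩

theorem map_add_int (h : IsReparam e ψ) (k : Fin n) :
    (∀ t (j : ℤ), ψ k (t + j) = ψ k t + j) ∨ (∀ t (j : ℤ), ψ k (t + j) = ψ k t - j) := by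
  refine (h k).2.2.imp (fun h1 t j => ?_) (fun h1 t j => ?_)
  · have hp : Function.Periodic (fun t => ψ k t - t) 1 := fun t => by
      simp only [h1]; ring
    have := hp.int_mul j t
    simp only [mul_one] at this
    linarith
  · have hp : Function.Periodic (fun t => ψ k t + t) 1 := fun t => by
      simp only [h1]; ring
    have := hp.int_mul j t
    simp only [mul_one] at this
    linarith

theorem strictMono_or_strictAnti (h : IsReparam e ψ) (k : Fin n) :
    StrictMono (ψ k) ∨ StrictAnti (ψ k) := by
  have hd : ContDiff ℝ 1 (ψ k) := (h k).1.of_le (by exact_mod_cast le_top)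
  have hc : Continuous (deriv (ψ k)) := hd.continuous_deriv le_rfl
  have key : (∀ t, 0 < deriv (ψ k) t) ∨ (∀ t, deriv (ψ k) t < 0) := by
    by_contra! hcon
    obtain ⟨⟨a, ha⟩, b, hb⟩ := hcon
    obtain ⟨c, hc0⟩ := mem_range_of_exists_le_of_exists_ge hc ⟨a, ha⟩ ⟨b, hb⟩
    exact (h k).2.1 c hc0
  exact key.imp strictMono_of_deriv_pos strictAnti_of_deriv_neg

theorem bijective (h : IsReparam e ψ) (k : Fin n) : Function.Bijective (ψ k) := by
  refine ⟨(h.strictMono_or_strictAnti k).elim (·.injective) (·.injective), fun y => ?_⟩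
  have hcont : Continuous (ψ k) := (h k).1.continuous
  obtain ⟨j, hj⟩ := exists_nat_ge (|y - ψ k 0|)
  have hj' := abs_le.1 hj
  rcases h.map_add_int k with h1 | h1
  · have a := h1 0 j
    have b := h1 0 (-j)
    push_cast at a b
    exact mem_range_of_exists_le_of_exists_ge hcont ⟨_, b.le.trans (by linarith)⟩
      ⟨_, le_trans (by linarith) a.ge⟩
  · have a := h1 0 j
    have b := h1 0 (-j)
    push_cast at a b
    exact mem_range_of_exists_le_of_exists_ge hcont ⟨_, a.le.trans (by linarith)⟩
      ⟨_, le_trans (by linarith) b.ge⟩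

theorem sameParam_iff (h : IsReparam e ψ) {k l : Fin n} {t u : ℝ} :
    SameParam (e k) (ψ k t) (e l) (ψ l u) ↔ SameParam k t l u := by
  constructor
  · rintro ⟨hkl, j, hj⟩
    obtain rfl := e.injective hkl
    refine ⟨rfl, ?_⟩
    rcases h.map_add_int k with h1 | h1
    · exact ⟨j, (h.bijective k).1 (by rw [hj, h1])⟩
    · exact ⟨-j, (h.bijective k).1 (by rw [hj, h1]; push_cast; ring)⟩
  · rintro ⟨rfl, j, rfl⟩
    refine ⟨rfl, ?_⟩
    rcases h.map_add_int k with h1 | h1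
    · exact ⟨j, h1 t j⟩
    · exact ⟨-j, by rw [h1 t j]; push_cast; ring⟩

theorem comp {p : ℕ} {e' : Fin m ≃ Fin p} {ψ' : Fin m → ℝ → ℝ} (h : IsReparam e ψ)
    (h' : IsReparam e' ψ') :
    IsReparam (e.trans e') (fun k t => ψ' (e k) (ψ k t)) := by
  intro k
  refine ⟨(h' (e k)).1.comp (h k).1, fun t => ?_, ?_⟩
  · have h1 : DifferentiableAt ℝ (ψ' (e k)) (ψ k t) := (h' (e k)).1.differentiable (by simp) _
    have h2 : DifferentiableAt ℝ (ψ k) t := (h k).1.differentiable (by simp) _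
    have : deriv (ψ' (e k) ∘ ψ k) t = _ := deriv_comp t h1 h2
    change deriv (ψ' (e k) ∘ ψ k) t ≠ 0
    rw [this]
    exact mul_ne_zero ((h' (e k)).2.1 _) ((h k).2.1 t)
  · rcases (h k).2.2 with h1 | h1 <;> rcases h'.map_add_int (e k) with h2 | h2
    · left; intro t; dsimp only; have := h2 (ψ k t) 1; push_cast at this; rw [h1, this]
    · right; intro t; dsimp only; have := h2 (ψ k t) 1; push_cast at this; rw [h1, this]
    · right; intro t; dsimp only; have := h2 (ψ k t) (-1); push_cast at this; rw [h1, sub_eq_add_neg, this]; ring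
    · left; intro t; dsimp only; have := h2 (ψ k t) (-1); push_cast at this; rw [h1, sub_eq_add_neg, this]; ring

/-- The inverse reparametrization on the circle `l` of the target. -/
def inv (h : IsReparam e ψ) (l : Fin m) : ℝ → ℝ :=
  (Equiv.ofBijective (ψ (e.symm l)) (h.bijective _)).symm

theorem apply_inv (h : IsReparam e ψ) (l : Fin m) (u : ℝ) : ψ (e.symm l) (h.inv l u) = u :=
  (Equiv.ofBijective (ψ (e.symm l)) (h.bijective _)).apply_symm_apply u

theorem inv_apply (h : IsReparam e ψ) (k : Fin n) (t : ℝ) : h.inv (e k) (ψ k t) = t := by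
  have := h.apply_inv (e k) (ψ k t)
  have h2 : ψ (e.symm (e k)) = ψ k := by simp
  rw [h2] at this
  exact (h.bijective k).1 this

theorem isReparam_inv (h : IsReparam e ψ) : IsReparam e.symm h.inv := by
  intro l
  set k := e.symm l with hk
  have happ : ∀ u, ψ k (h.inv l u) = u := h.apply_inv l
  have hsm : ContDiff ℝ ∞ (ψ k) := (h k).1
  have hcont : Continuous (h.inv l) := by
    rcases h.strictMono_or_strictAnti k with hm | hm
    · have : h.inv l = (hm.orderIsoOfSurjective _ (h.bijective k).2).symm := by
        funext u
        apply hm.injective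
        rw [happ]
        exact ((hm.orderIsoOfSurjective _ (h.bijective k).2).apply_symm_apply u).symm
      rw [this]
      exact OrderIso.continuous _
    · have hm' : StrictMono (fun t => -ψ k t) := fun a b hab => neg_lt_neg (hm hab)
      have hsurj : Function.Surjective (fun t => -ψ k t) := fun y => by
        obtain ⟨x, hx⟩ := (h.bijective k).2 (-y)
        exact ⟨x, by simp [hx]⟩
      have : h.inv l = fun u => (hm'.orderIsoOfSurjective _ hsurj).symm (-u) := by
        funext u
        apply hm'.injective
        simp only [happ]
        exact ((hm'.orderIsoOfSurjective _ hsurj).apply_symm_apply (-u)).symm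
      rw [this]
      exact (OrderIso.continuous _).comp continuous_neg
  have hder : ∀ u, HasDerivAt (h.inv l) (deriv (ψ k) (h.inv l u))⁻¹ u := fun u =>
    HasDerivAt.of_local_left_inverse hcont.continuousAt
      (hsm.differentiable (by simp) _).hasDerivAt ((h k).2.1 _) (Filter.Eventually.of_forall happ)
  refine ⟨?_, fun u => ?_, ?_⟩
  · have hd : ∀ N : ℕ, ContDiff ℝ N (h.inv l) := by
      intro N
      induction N with
      | zero => exact contDiff_zero.2 hcont
      | succ N ih =>
        rw [show ((N + 1 : ℕ) : WithTop ℕ∞) = (N : WithTop ℕ∞) + 1 by push_cast; rfl,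
          contDiff_succ_iff_deriv]
        refine ⟨fun u => (hder u).differentiableAt, by simp, ?_⟩
        have : deriv (h.inv l) = fun u => (deriv (ψ k) (h.inv l u))⁻¹ :=
          funext fun u => (hder u).deriv
        rw [this]
        have hdψ : ContDiff ℝ N (deriv (ψ k)) :=
          ((contDiff_infty_iff_deriv.1 hsm).2).of_le (by exact_mod_cast le_top)
        exact (hdψ.comp ih).inv fun u => (h k).2.1 _
    exact contDiff_infty.2 hd
  · rw [(hder u).deriv]
    exact inv_ne_zero ((h k).2.1 _)
  · refine (h k).2.2.imp (fun h1 u => ?_) (fun h1 u => ?_)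
    · apply (h.bijective k).1
      rw [happ, h1, happ]
    · apply (h.bijective k).1
      have := h1 (h.inv l u - 1)
      rw [sub_add_cancel, happ] at this
      rw [happ]
      linarith

end IsReparam

namespace IsSmoothLink

theorem reparam {n m : ℕ} {g : Fin m → ℝ → S1S2} {e : Fin n ≃ Fin m} {ψ : Fin n → ℝ → ℝ}
    (hg : IsSmoothLink g) (h : IsReparam e ψ) : IsSmoothLink (fun k t => g (e k) (ψ k t)) where
  smooth k := (hg.smooth (e k)).comp (h k).1.contMDiff
  periodic k t := by
    rcases (h k).2.2 with h1 | h1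
    · simp only [h1]; exact hg.periodic _ _
    · simp only [h1]; exact (hg.periodic _).sub_eq _
  immersion k t := by
    have h1 : MDifferentiableAt 𝓘(ℝ, ℝ) modelS1S2 (g (e k)) (ψ k t) :=
      (hg.smooth (e k) _).mdifferentiableAt (by simp)
    have h2 : DifferentiableAt ℝ (ψ k) t := (h k).1.differentiable (by simp) t
    have key : mfderiv 𝓘(ℝ, ℝ) modelS1S2 (fun t => g (e k) (ψ k t)) t = _ :=
      mfderiv_comp t h1 h2.mdifferentiableAt
    rw [key]
    refine (hg.immersion (e k) (ψ k t)).comp ?_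
    refine (injective_iff_map_eq_zero (mfderiv 𝓘(ℝ, ℝ) 𝓘(ℝ, ℝ) (ψ k) t)).2 fun v hv => ?_
    rw [mfderiv_eq_fderiv] at hv
    have hv' : (show ℝ from v) * deriv (ψ k) t = 0 := by
      rw [← fderiv_apply_one_eq_deriv, ← smul_eq_mul, ← map_smul, smul_eq_mul, mul_one]
      exact hv
    exact (mul_eq_zero.1 hv').resolve_right ((h k).2.1 t)
  injective k t l u hkl := h.sameParam_iff.1 (hg.injective _ _ _ _ hkl)

theorem diffeo {n : ℕ} {f : Fin n → ℝ → S1S2} (hf : IsSmoothLink f) (ι : AnnulusEmbedding) :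
    IsSmoothLink (fun k t => ι (f k t)) where
  smooth k := ι.contMDiff.comp (hf.smooth k)
  periodic k t := by simp only [hf.periodic k t]
  immersion k t := by
    have h1 : MDifferentiableAt modelS1S2 modelS1S2 ι (f k t) :=
      (ι.contMDiff _).mdifferentiableAt (by simp)
    have h2 : MDifferentiableAt 𝓘(ℝ, ℝ) modelS1S2 (f k) t :=
      (hf.smooth k _).mdifferentiableAt (by simp)
    have key : mfderiv 𝓘(ℝ, ℝ) modelS1S2 (fun t => ι (f k t)) t = _ := mfderiv_comp t h1 h2
    rw [key]
    have h3 : Function.Injective (mfderiv modelS1S2 modelS1S2 ι (f k t)) :=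
      (ι.mfderivToContinuousLinearEquiv (by simp) (f k t)).injective
    exact h3.comp (hf.immersion k t)
  injective k t l u hkl := hf.injective _ _ _ _ (ι.injective hkl)

end IsSmoothLink

namespace SameLink

theorem left {n m : ℕ} {f : Fin n → ℝ → S1S2} {g : Fin m → ℝ → S1S2} (h : SameLink f g) :
    IsSmoothLink f := by
  obtain ⟨F, e, ψ, -, hF, -, h0, -⟩ := h
  have := hF 0 (by simp)
  simp only [h0] at this
  exact this

/-- A reparametrization of a link is the same link. -/
theorem of_reparam {n m : ℕ} {g : Fin m → ℝ → S1S2} {e : Fin n ≃ Fin m} {ψ : Fin n → ℝ → ℝ}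
    (hg : IsSmoothLink g) (h : IsReparam e ψ) : SameLink (fun k t => g (e k) (ψ k t)) g :=
  ⟨fun k p => g (e k) (ψ k p.2), e, ψ,
    fun k => (hg.smooth (e k)).comp (((h k).1.comp contDiff_snd).contMDiff),
    fun _ _ => hg.reparam h, h, fun _ _ => rfl, fun _ _ => rfl⟩

theorem refl {n : ℕ} {g : Fin n → ℝ → S1S2} (hg : IsSmoothLink g) : SameLink g g :=
  of_reparam hg IsReparam.refl

theorem symm {n m : ℕ} {f : Fin n → ℝ → S1S2} {g : Fin m → ℝ → S1S2} (h : SameLink f g) :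
    SameLink g f := by
  obtain ⟨F, e, ψ, hs, hF, hψ, h0, h1⟩ := h
  have hi := hψ.isReparam_inv
  refine ⟨fun l p => F (e.symm l) (1 - p.1, hψ.inv l p.2), e.symm, hψ.inv, fun l => ?_,
    fun τ hτ => ?_, hi, fun l u => ?_, fun l u => ?_⟩
  · refine (hs (e.symm l)).comp ?_
    have : ContDiff ℝ ∞ (fun p : ℝ × ℝ => (1 - p.1, hψ.inv l p.2)) :=
      (contDiff_const.sub contDiff_fst).prodMk ((hi l).1.comp contDiff_snd)
    exact this.contMDiff
  · exact (hF (1 - τ) ⟨by linarith [hτ.2], by linarith [hτ.1]⟩).reparam hi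
  · simp only [sub_zero, h1, hψ.apply_inv, Equiv.apply_symm_apply]
  · simp only [sub_self, h0]

/-- Two isotopies are run one after the other, each slowed down to a stop at its ends. -/
theorem trans {n m p : ℕ} {f : Fin n → ℝ → S1S2} {g : Fin m → ℝ → S1S2} {h : Fin p → ℝ → S1S2}
    (hfg : SameLink f g) (hgh : SameLink g h) : SameLink f h := by
  obtain ⟨F, e, ψ, hs, hF, hψ, h0, h1⟩ := hfg
  obtain ⟨F', e', ψ', hs', hF', hψ', h0', h1'⟩ := hgh
  let σ := Real.smoothTransition
  have hσ : ContDiff ℝ ∞ σ := Real.smoothTransition.contDiff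
  have hσmem : ∀ x, σ x ∈ Set.Icc (0 : ℝ) 1 := fun x =>
    ⟨Real.smoothTransition.nonneg x, Real.smoothTransition.le_one x⟩
  let A : Fin n → ℝ × ℝ → S1S2 := fun k q => F k (σ (3 * q.1), q.2)
  let B : Fin n → ℝ × ℝ → S1S2 := fun k q => F' (e k) (σ (3 * q.1 - 2), ψ k q.2)
  have hA : ∀ k, ContMDiff 𝓘(ℝ, ℝ × ℝ) modelS1S2 ∞ (A k) := fun k => by
    refine (hs k).comp ?_
    have : ContDiff ℝ ∞ (fun q : ℝ × ℝ => (σ (3 * q.1), q.2)) :=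
      (hσ.comp (contDiff_const.mul contDiff_fst)).prodMk contDiff_snd
    exact this.contMDiff
  have hB : ∀ k, ContMDiff 𝓘(ℝ, ℝ × ℝ) modelS1S2 ∞ (B k) := fun k => by
    refine (hs' (e k)).comp ?_
    have : ContDiff ℝ ∞ (fun q : ℝ × ℝ => (σ (3 * q.1 - 2), ψ k q.2)) :=
      (hσ.comp ((contDiff_const.mul contDiff_fst).sub contDiff_const)).prodMk
        ((hψ k).1.comp contDiff_snd)
    exact this.contMDiff
  -- both isotopies stand still for `1/3 < τ < 2/3`, and agree there
  have hAB : ∀ k (q : ℝ × ℝ), 1 / 3 < q.1 → q.1 < 2 / 3 → A k q = B k q := by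
    intro k q hq hq'
    have e1 : σ (3 * q.1) = 1 := Real.smoothTransition.one_of_one_le (by linarith)
    have e2 : σ (3 * q.1 - 2) = 0 := Real.smoothTransition.zero_of_nonpos (by linarith)
    simp only [A, B, e1, e2, h1, h0']
  refine ⟨fun k q => if q.1 < 1 / 2 then A k q else B k q, e.trans e',
    fun k t => ψ' (e k) (ψ k t), fun k => ?_, fun τ _ => ?_, hψ.comp hψ', fun k t => ?_,
    fun k t => ?_⟩
  · intro q
    rcases lt_or_ge q.1 (2 / 3) with hq | hq
    · refine (hA k q).congr_of_eventuallyEq ?_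
      filter_upwards [continuous_fst.continuousAt.eventually_lt_const hq] with x hx
      split_ifs with h
      · rfl
      · exact (hAB k x (by linarith) hx).symm
    · refine (hB k q).congr_of_eventuallyEq ?_
      filter_upwards [continuous_fst.continuousAt.eventually_const_lt
        (show (1 / 3 : ℝ) < q.1 by linarith)] with x hx
      split_ifs with h
      · exact hAB k x hx (by linarith)
      · rfl
  · by_cases hτ : τ < 1 / 2
    · simp only [hτ, if_true]
      exact hF (σ (3 * τ)) (hσmem _)
    · simp only [hτ, if_false]
      exact (hF' (σ (3 * τ - 2)) (hσmem _)).reparam hψ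
  · have : σ (3 * 0) = 0 := Real.smoothTransition.zero_of_nonpos (by norm_num)
    simp only [A, this, h0]
    norm_num
  · have : σ (3 * 1 - 2) = 1 := Real.smoothTransition.one_of_one_le (by norm_num)
    simp only [B, this, h1', if_neg (show ¬(1 : ℝ) < 1 / 2 by norm_num), Equiv.trans_apply]

theorem diffeo {n m : ℕ} {f : Fin n → ℝ → S1S2} {g : Fin m → ℝ → S1S2} (h : SameLink f g)
    (ι : AnnulusEmbedding) : SameLink (fun k t => ι (f k t)) (fun k t => ι (g k t)) := by
  obtain ⟨F, e, ψ, hs, hF, hψ, h0, h1⟩ := h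
  exact ⟨fun k q => ι (F k q), e, ψ, fun k => ι.contMDiff.comp (hs k),
    fun τ hτ => (hF τ hτ).diffeo ι, hψ, fun k t => by simp only [h0], fun k t => by simp only [h1]⟩

end SameLink

/-! ### Lifts of diagrams -/

theorem Cyl.coe_injective : Function.Injective Cyl.coe := fun _ _ h =>
  Prod.ext (Subtype.ext (congrArg (fun p : ℂ × ℝ => p.1) h)) (congrArg (fun p : ℂ × ℝ => p.2) h)

theorem Cyl.isEmbedding_coe : Topology.IsEmbedding Cyl.coe :=
  Topology.IsEmbedding.prodMap (f := fun z : Circle => (z : ℂ)) (g := id)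
    Topology.IsEmbedding.subtypeVal .id

/-- Smooth Urysohn lemma on the circle `ℝ / ℤ`, in terms of `1`-periodic sets and functions. -/
theorem exists_periodic_smooth_zero_one {A B : Set ℝ} (hA : ∀ t, t + 1 ∈ A ↔ t ∈ A)
    (hB : ∀ t, t + 1 ∈ B ↔ t ∈ B) (hcA : IsCompact (A ∩ Set.Icc 0 1))
    (hcB : IsCompact (B ∩ Set.Icc 0 1)) (hAB : Disjoint A B) :
    ∃ χ : ℝ → ℝ, ContDiff ℝ ∞ χ ∧ Function.Periodic χ 1 ∧ (∀ t, χ t ∈ Set.Icc 0 1) ∧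
      (∀ t ∈ A, χ t = 0) ∧ ∀ t ∈ B, χ t = 1 := by
  let E : ℝ → Circle := fun t => Circle.exp (2 * Real.pi * t)
  have hE : ContMDiff 𝓘(ℝ, ℝ) (𝓡 1) ∞ E :=
    contMDiff_circleExp.comp (contDiff_const.mul contDiff_id).contMDiff
  have hEper : ∀ t (m : ℤ), E (t + m) = E t := fun t m => by
    have : 2 * Real.pi * (t + m) = 2 * Real.pi * t + m * (2 * Real.pi) := by ring
    simp only [E, this]
    exact Circle.periodic_exp.int_mul m _
  have hEinj : ∀ t u, E t = E u → ∃ m : ℤ, u = t + m := fun t u h => by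
    obtain ⟨m, hm⟩ := Circle.exp_eq_exp.1 h
    refine ⟨-m, ?_⟩
    have : 2 * Real.pi * (u - (t + (-m : ℤ))) = 0 := by push_cast; linarith
    have := (mul_eq_zero.1 this).resolve_left (by positivity)
    linarith
  have hint : ∀ {S : Set ℝ}, (∀ t, t + 1 ∈ S ↔ t ∈ S) → ∀ (t : ℝ) (m : ℤ), t + m ∈ S ↔ t ∈ S := by
    intro S hS t m
    have hp : Function.Periodic (fun t => t ∈ S) 1 := fun t => propext (hS t)
    have := hp.int_mul m t
    simp only [mul_one] at this
    exact this.to_iff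
  have himg : ∀ {S : Set ℝ}, (∀ t, t + 1 ∈ S ↔ t ∈ S) → ∀ t ∈ S,
      E t ∈ E '' (S ∩ Set.Icc 0 1) := by
    intro S hS t ht
    have h1 : t + (-⌊t⌋ : ℤ) = Int.fract t := by push_cast; rw [← sub_eq_add_neg]; rfl
    refine ⟨Int.fract t, ⟨?_, (Int.fract_nonneg t), (Int.fract_lt_one t).le⟩, ?_⟩
    · rw [← h1]; exact (hint hS t _).2 ht
    · rw [← h1, hEper]
  have hdis : Disjoint (E '' (A ∩ Set.Icc 0 1)) (E '' (B ∩ Set.Icc 0 1)) := by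
    rw [Set.disjoint_left]
    rintro _ ⟨t, ht, rfl⟩ ⟨u, hu, h⟩
    obtain ⟨m, rfl⟩ := hEinj _ _ h
    exact Set.disjoint_left.1 hAB ht.1 ((hint hB u m).2 hu.1)
  obtain ⟨f, hf0, hf1, hf⟩ := exists_contMDiffMap_zero_one_of_isClosed (n := ⊤) (𝓡 1)
    (hcA.image hE.continuous).isClosed (hcB.image hE.continuous).isClosed hdis
  refine ⟨fun t => f (E t), (f.contMDiff.comp hE).contDiff, fun t => ?_, fun t => hf _,
    fun t ht => hf0 (himg hA t ht), fun t ht => hf1 (himg hB t ht)⟩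
  have := hEper t 1
  push_cast at this
  simp only [this]

theorem IsDoublePair.symm {n : ℕ} {γ : Fin n → ℝ → Cyl} {k l : Fin n} {t u : ℝ}
    (h : IsDoublePair γ k t l u) : IsDoublePair γ l u k t :=
  ⟨h.1.symm, fun h' => h.2 h'.symm⟩

namespace AnnularDiagram
variable (D : AnnularDiagram)

theorem contDiff_fst (k : Fin D.n) : ContDiff ℝ ∞ (fun t => ((D.curve k t).1 : ℂ)) :=
  (D.smooth k).fst

theorem contDiff_snd (k : Fin D.n) : ContDiff ℝ ∞ (fun t => (D.curve k t).2) :=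
  (D.smooth k).snd

theorem continuous_curve (k : Fin D.n) : Continuous (D.curve k) :=
  Cyl.isEmbedding_coe.continuous_iff.2 (D.smooth k).continuous

theorem isCrossingParam_add_one (k : Fin D.n) (t : ℝ) :
    D.IsCrossingParam k (t + 1) ↔ D.IsCrossingParam k t := by
  have h1 : SameParam k t k (t + 1) := ⟨rfl, 1, by push_cast; rfl⟩
  constructor <;> rintro ⟨l, u, h, h'⟩
  · exact ⟨l, u, (D.periodic k t).symm.trans h, fun hs => h' (h1.symm.trans hs)⟩
  · exact ⟨l, u, (D.periodic k t).trans h, fun hs => h' (h1.trans hs)⟩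

/-- There are finitely many crossing parameters on each circle `ℝ / ℤ`. -/
theorem finite_isCrossingParam (k : Fin D.n) :
    ({t | D.IsCrossingParam k t} ∩ Set.Icc 0 1).Finite := by
  have hne : ∀ t ∈ Set.Ico (0 : ℝ) 1, ∀ u ∈ Set.Ico (0 : ℝ) 1, SameParam k t k u → t = u := by
    rintro t ht u hu ⟨-, m, rfl⟩
    have h1 : (m : ℝ) < 1 := by linarith [ht.1, hu.2]
    have h2 : (-1 : ℝ) < m := by linarith [ht.2, hu.1]
    have : m = 0 := by
      have a : m < 1 := by exact_mod_cast h1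
      have b : -1 < m := by exact_mod_cast h2
      omega
    simp [this]
  have hfib : ∀ z, {t | t ∈ Set.Ico (0 : ℝ) 1 ∧ D.curve k t = z}.Finite := by
    intro z
    by_cases h0 : ∃ t ∈ Set.Ico (0 : ℝ) 1, ∃ u ∈ Set.Ico (0 : ℝ) 1, t ≠ u ∧ D.curve k t = z ∧
        D.curve k u = z
    · obtain ⟨t, ht, u, hu, htu, htz, huz⟩ := h0
      refine (Set.toFinite {t, u}).subset ?_
      rintro v ⟨hv, hvz⟩
      by_contra hcon
      simp only [Set.mem_insert_iff, Set.mem_singleton_iff, not_or] at hcon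
      exact D.no_triple k t k u k v ⟨htz.trans huz.symm, fun h => htu (hne _ ht _ hu h)⟩
        ⟨huz.trans hvz.symm, fun h => hcon.2 (hne _ hu _ hv h).symm⟩
        ⟨htz.trans hvz.symm, fun h => hcon.1 (hne _ ht _ hv h).symm⟩
    · refine Set.Subsingleton.finite ?_
      rintro t ⟨ht, htz⟩ u ⟨hu, huz⟩
      by_contra hcon
      exact h0 ⟨t, ht, u, hu, hcon, htz, huz⟩
  refine ((D.finite_double.biUnion fun z _ => hfib z).union (Set.finite_singleton 1)).subset ?_
  rintro t ⟨⟨l, u, hd⟩, ht⟩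
  rcases ht.2.lt_or_eq with h1 | h1
  · exact Or.inl (Set.mem_biUnion (show D.curve k t ∈ _ from ⟨k, t, l, u, hd, rfl⟩)
      ⟨⟨ht.1, h1⟩, rfl⟩)
  · exact Or.inr h1

variable {D}

theorem exists_pos_sq_add_sq_lt_one (k : Fin D.n) :
    ∃ δ > 0, ∀ t, (D.curve k t).2 ^ 2 + δ ^ 2 < 1 := by
  have hc : Continuous fun t => |(D.curve k t).2| := (D.contDiff_snd k).continuous.abs
  obtain ⟨t₀, -, ht₀⟩ := (isCompact_Icc (a := (0 : ℝ)) (b := 1)).exists_isMaxOn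
    ⟨0, by simp⟩ hc.continuousOn
  set M := |(D.curve k t₀).2| with hM
  have hM1 : M < 1 := D.mem_interior k t₀
  have hM0 : 0 ≤ M := abs_nonneg _
  refine ⟨(1 - M) / 2, by linarith, fun t => ?_⟩
  have h1 : |(D.curve k t).2| ≤ M := by
    have h2 : D.curve k (Int.fract t) = D.curve k t := by
      have := (D.periodic k).sub_int_mul_eq ⌊t⌋ (x := t)
      rw [mul_one] at this
      exact this
    rw [← h2]
    exact ht₀ ⟨Int.fract_nonneg t, (Int.fract_lt_one t).le⟩
  have h2 : (D.curve k t).2 ^ 2 ≤ M ^ 2 := by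
    rw [← sq_abs]
    exact pow_le_pow_left₀ (abs_nonneg _) h1 2
  nlinarith

/-- A diagram has a height function, which can be chosen to vanish on any periodic closed set of
parameters that contains no crossing parameter. -/
theorem exists_height {Z : Fin D.n → Set ℝ} (hZ : ∀ k t, t + 1 ∈ Z k ↔ t ∈ Z k)
    (hZc : ∀ k, IsClosed (Z k)) (hZd : ∀ k, ∀ t ∈ Z k, ¬ D.IsCrossingParam k t) :
    ∃ H : D.Height, ∀ k, ∀ t ∈ Z k, H.h k t = 0 := by
  let O : Fin D.n → Set ℝ := fun k => {t | D.IsCrossingParam k t ∧ D.isOver k t}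
  let U : Fin D.n → Set ℝ := fun k => {t | D.IsCrossingParam k t ∧ ¬ D.isOver k t}
  have hO : ∀ k t, t + 1 ∈ O k ↔ t ∈ O k := fun k t => by
    simp only [O, Set.mem_ofPred_eq, D.isCrossingParam_add_one, D.over_periodic]
  have hU : ∀ k t, t + 1 ∈ U k ↔ t ∈ U k := fun k t => by
    simp only [U, Set.mem_ofPred_eq, D.isCrossingParam_add_one, D.over_periodic]
  have hOc : ∀ k, IsCompact (O k ∩ Set.Icc 0 1) := fun k =>
    ((D.finite_isCrossingParam k).subset fun t ht => ⟨ht.1.1, ht.2⟩).isCompact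
  have hUc : ∀ k, IsCompact (U k ∩ Set.Icc 0 1) := fun k =>
    ((D.finite_isCrossingParam k).subset fun t ht => ⟨ht.1.1, ht.2⟩).isCompact
  have hZc' : ∀ k, IsCompact (Z k ∩ Set.Icc 0 1) := fun k => isCompact_Icc.inter_left (hZc k)
  have hOU : ∀ k, Disjoint (U k) (O k) := fun k =>
    Set.disjoint_left.2 fun t h h' => h.2 h'.2
  have hZO : ∀ k, Disjoint (Z k) (O k) := fun k =>
    Set.disjoint_left.2 fun t h h' => hZd k t h h'.1
  have hZU : ∀ k, Disjoint (Z k) (U k) := fun k =>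
    Set.disjoint_left.2 fun t h h' => hZd k t h h'.1
  have h1 := fun k => exists_periodic_smooth_zero_one (A := U k ∪ Z k) (B := O k)
    (fun t => or_congr (hU k t) (hZ k t)) (hO k)
    (by rw [Set.union_inter_distrib_right]; exact (hUc k).union (hZc' k)) (hOc k)
    (Set.disjoint_union_left.2 ⟨hOU k, hZO k⟩)
  have h2 := fun k => exists_periodic_smooth_zero_one (A := O k ∪ Z k) (B := U k)
    (fun t => or_congr (hO k t) (hZ k t)) (hU k)
    (by rw [Set.union_inter_distrib_right]; exact (hOc k).union (hZc' k)) (hUc k)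
    (Set.disjoint_union_left.2 ⟨(hOU k).symm, hZU k⟩)
  choose χ hχs hχp hχm hχ0 hχ1 using h1
  choose ξ hξs hξp hξm hξ0 hξ1 using h2
  choose δ hδ hδX using exists_pos_sq_add_sq_lt_one (D := D)
  have hover : ∀ k t, D.IsCrossingParam k t → D.isOver k t →
      δ k * (χ k t - ξ k t) = δ k := fun k t hc ho => by
    rw [hχ1 k t ⟨hc, ho⟩, hξ0 k t (Or.inl ⟨hc, ho⟩)]; ring
  have hunder : ∀ k t, D.IsCrossingParam k t → ¬ D.isOver k t →
      δ k * (χ k t - ξ k t) = -δ k := fun k t hc ho => by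
    rw [hχ0 k t (Or.inl ⟨hc, ho⟩), hξ1 k t ⟨hc, ho⟩]; ring
  refine ⟨⟨fun k t => δ k * (χ k t - ξ k t), fun k => contDiff_const.mul ((hχs k).sub (hξs k)),
    fun k t => by simp only [hχp k t, hξp k t], fun k t => ?_, fun k t l u hd => ?_⟩,
    fun k t ht => ?_⟩
  · refine lt_of_le_of_lt ?_ (hδX k t)
    have a := hχm k t
    have b := hξm k t
    have h3 : (χ k t - ξ k t) ^ 2 ≤ 1 := by
      rw [sq_le_one_iff_abs_le_one, abs_le]
      constructor <;> linarith [a.1, a.2, b.1, b.2]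
    nlinarith [sq_nonneg (δ k)]
  · have hck : D.IsCrossingParam k t := ⟨l, u, hd⟩
    have hcl : D.IsCrossingParam l u := ⟨k, t, hd.symm⟩
    have hiff := D.over_iff k t l u hd
    by_cases ho : D.isOver k t
    · have hu := hiff.1 ho
      simp only [hover k t hck ho, hunder l u hcl hu, ho, true_iff]
      linarith [hδ k, hδ l]
    · have hu : D.isOver l u := by
        by_contra hcon
        exact ho (hiff.2 hcon)
      simp only [hunder k t hck ho, hover l u hcl hu, ho, false_iff]
      linarith [hδ k, hδ l]
  · show δ k * (χ k t - ξ k t) = 0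
    rw [hχ0 k t (Or.inr ht), hξ0 k t (Or.inr ht)]
    ring

theorem toCyl_lift (H : D.Height) (k : Fin D.n) (t : ℝ) : toCyl (D.lift H k t) = D.curve k t := rfl

theorem lift_injective (H : D.Height) (k : Fin D.n) (t : ℝ) (l : Fin D.n) (u : ℝ)
    (h : D.lift H k t = D.lift H l u) : SameParam k t l u := by
  by_contra hcon
  have h1 : D.curve k t = D.curve l u := congrArg toCyl h
  have h2 : H.h k t = H.h l u := congrArg (fun p : S1S2 => p.2.1 1) h
  have hd : IsDoublePair D.curve k t l u := ⟨h1, hcon⟩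
  have a := D.over_iff k t l u hd
  rw [H.over_iff k t l u hd, H.over_iff l u k t hd.symm, h2] at a
  simp at a

/-- Lifts of a diagram at heights that depend smoothly on a parameter. -/
theorem contMDiff_lift {E : Type*} [NormedAddCommGroup E] [NormedSpace ℝ E] (H : E → D.Height)
    {u : E → ℝ} (hu : ContDiff ℝ ∞ u) (k : Fin D.n)
    (hH : ContDiff ℝ ∞ fun x => (H x).h k (u x)) :
    ContMDiff 𝓘(ℝ, E) modelS1S2 ∞ (fun x => D.lift (H x) k (u x)) := by
  refine contMDiff_S1S2_iff.2 ⟨(D.contDiff_fst k).comp hu, ?_⟩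
  have hX := (D.contDiff_snd k).comp hu
  refine contDiff_E3 hX hH (ContDiff.neg (ContDiff.sqrt ?_ fun x => ?_))
  · exact (contDiff_const.sub (hX.pow 2)).sub (hH.pow 2)
  · have := (H x).mem_disk k (u x)
    exact ne_of_gt (show 0 < 1 - (D.curve k (u x)).2 ^ 2 - (H x).h k (u x) ^ 2 by linarith)

theorem isSmoothLink_lift (H : D.Height) : IsSmoothLink (D.lift H) where
  smooth k := contMDiff_lift (fun _ => H) contDiff_id k (H.smooth k)
  periodic k t := by simp only [lift, D.periodic k t, H.periodic k t]
  immersion k t := injective_mfderiv_of_toCyl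
    (contMDiff_lift (fun _ => H) contDiff_id k (H.smooth k)) (D.immersion k t)
  injective := lift_injective H

/-- The height functions of a diagram form a convex set. -/
def Height.interp (H H' : D.Height) (c : ℝ) (hc : c ∈ Set.Icc (0 : ℝ) 1) : D.Height where
  h k t := (1 - c) * H.h k t + c * H'.h k t
  smooth k := (contDiff_const.mul (H.smooth k)).add (contDiff_const.mul (H'.smooth k))
  periodic k t := by simp only [H.periodic k t, H'.periodic k t]
  mem_disk k t := by
    have a := H.mem_disk k t
    have b := H'.mem_disk k t
    have h1 : (1 - c) * ((D.curve k t).2 ^ 2 + H.h k t ^ 2) +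
        c * ((D.curve k t).2 ^ 2 + H'.h k t ^ 2) < 1 := by
      rcases hc.1.eq_or_lt with h0 | h0
      · rw [← h0]; linarith
      · nlinarith [hc.2]
    nlinarith [mul_nonneg hc.1 (sub_nonneg.2 hc.2), sq_nonneg (H.h k t - H'.h k t),
      mul_nonneg (mul_nonneg hc.1 (sub_nonneg.2 hc.2)) (sq_nonneg (H.h k t - H'.h k t))]
  over_iff k t l u hd := by
    have hiff := D.over_iff k t l u hd
    have a := H.over_iff k t l u hd
    have a' := H.over_iff l u k t hd.symm
    have b := H'.over_iff k t l u hd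
    have b' := H'.over_iff l u k t hd.symm
    have hc1 := hc.2
    by_cases ho : D.isOver k t
    · have h1 := a.1 ho
      have h2 := b.1 ho
      simp only [ho, true_iff]
      rcases hc.1.eq_or_lt with h0 | h0
      · rw [← h0]; linarith
      · nlinarith
    · have hl : D.isOver l u := by
        by_contra hcon
        exact ho (hiff.2 hcon)
      have h1 := a'.1 hl
      have h2 := b'.1 hl
      simp only [ho, false_iff, not_lt]
      nlinarith [hc.1]

/-- All lifts of a diagram are isotopic. -/
theorem sameLink_lift (H H' : D.Height) : SameLink (D.lift H) (D.lift H') := by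
  let σ := Real.smoothTransition
  have hσ : ∀ x, σ x ∈ Set.Icc (0 : ℝ) 1 := fun x =>
    ⟨Real.smoothTransition.nonneg x, Real.smoothTransition.le_one x⟩
  have hσs : ContDiff ℝ ∞ σ := Real.smoothTransition.contDiff
  have h0 : σ 0 = 0 := Real.smoothTransition.zero
  have h1 : σ 1 = 1 := Real.smoothTransition.one
  refine ⟨fun k p => D.lift (H.interp H' (σ p.1) (hσ _)) k p.2, Equiv.refl _, fun _ t => t,
    fun k => ?_, fun τ _ => isSmoothLink_lift (H.interp H' (σ τ) (hσ τ)), IsReparam.refl,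
    fun k t => ?_, fun k t => ?_⟩
  · refine contMDiff_lift (fun p : ℝ × ℝ => H.interp H' (σ p.1) (hσ _)) _root_.contDiff_snd k ?_
    exact ((contDiff_const.sub (hσs.comp _root_.contDiff_fst)).mul
      ((H.smooth k).comp _root_.contDiff_snd)).add
      ((hσs.comp _root_.contDiff_fst).mul ((H'.smooth k).comp _root_.contDiff_snd))
  · simp only [lift, Height.interp, h0]
    congr 2
    ring
  · simp only [lift, Height.interp, h1]
    rw [Equiv.refl_apply]
    congr 2
    ring

end AnnularDiagram

/-! ### The double of a band -/

open MeasureTheory in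
/-- A parametric integral of a smooth function is smooth: the integral is a convolution with the
indicator function of the interval. -/
theorem contDiffOn_intervalIntegral {P : Type*} [NormedAddCommGroup P] [NormedSpace ℝ P]
    {f : P × ℝ → ℝ} {S : Set P} (hS : IsOpen S) (hf : ContDiffOn ℝ ∞ f (S ×ˢ Set.univ))
    {a b : ℝ} (hab : a ≤ b) : ContDiffOn ℝ ∞ (fun p => ∫ v in a..b, f (p, v)) S := by
  set R := max |a| |b| + 1 with hR
  have hR0 : 0 < R := by positivity
  let χ : ContDiffBump (0 : ℝ) := ⟨R, R + 1, hR0, by linarith⟩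
  have h := contDiffOn_convolution_right_with_param_comp (n := ⊤) (μ := volume)
    (ContinuousLinearMap.mul ℝ ℝ) (s := S) (v := fun _ => (0 : ℝ)) contDiffOn_const
    (f := (Set.Ioc a b).indicator fun _ => (1 : ℝ)) (g := fun p v => f (p, -v) * χ v)
    (k := Metric.closedBall 0 (R + 1)) hS (isCompact_closedBall _ _) ?_ ?_ ?_
  · refine h.congr fun p _ => ?_
    rw [intervalIntegral.integral_of_le hab, ← integral_indicator measurableSet_Ioc, convolution_def]
    congr 1
    funext v
    simp only [Set.indicator, ContinuousLinearMap.mul_apply', zero_sub, neg_neg]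
    split_ifs with hv
    · have : χ (-v) = 1 := by
        refine χ.one_of_mem_closedBall ?_
        rw [mem_closedBall_zero_iff, norm_neg, Real.norm_eq_abs, abs_le]
        have := le_max_left |a| |b|
        have := le_max_right |a| |b|
        have := neg_abs_le a
        have := le_abs_self b
        change -R ≤ v ∧ v ≤ R
        constructor <;> linarith [hv.1, hv.2]
      rw [this]; ring
    · ring
  · intro p v _ hv
    have : χ v = 0 := by
      by_contra hne
      have h1 : v ∈ Function.support χ := hne
      rw [χ.support_eq] at h1
      exact hv (Metric.ball_subset_closedBall h1)
    simp [this]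
  · exact ((integrable_indicator_iff measurableSet_Ioc).2 (by simp)).locallyIntegrable
  · have h1 : ContDiffOn ℝ ∞ (fun q : P × ℝ => f (q.1, -q.2)) (S ×ˢ Set.univ) :=
      hf.comp (contDiff_fst.prodMk contDiff_snd.neg).contDiffOn (fun q hq => ⟨hq.1, trivial⟩)
    exact h1.mul (χ.contDiff.comp contDiff_snd).contDiffOn

theorem uniqueDiffOn_strip : UniqueDiffOn ℝ strip :=
  (uniqueDiffOn_Ioo _ _).prod (uniqueDiffOn_Icc (by norm_num))

/-- The partial derivative of `u` in the second variable. -/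
def partialSnd (u : ℝ × ℝ → ℝ) (p : ℝ × ℝ) : ℝ := fderivWithin ℝ u strip p (0, 1)

theorem contDiffOn_partialSnd {u : ℝ × ℝ → ℝ} (hu : ContDiffOn ℝ ∞ u strip) :
    ContDiffOn ℝ ∞ (partialSnd u) strip :=
  (hu.fderivWithin uniqueDiffOn_strip (by simp)).clm_apply contDiffOn_const

/-- The quotient of `u` by `1 - x` for a function `u` on the strip that vanishes at `x = 1`, by
Hadamard's integral formula. The segment from `1` to `x` is run through as
`1 - sin² v (1 - x)`, which stays in `[-1,1]` for all real `v`, so that the integrand is smooth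
for `v` in an open set. -/
def hadamardQuot (u : ℝ × ℝ → ℝ) (p : ℝ × ℝ) : ℝ :=
  -∫ v in (0 : ℝ)..(Real.pi / 2),
    partialSnd u (p.1, 1 - Real.sin v ^ 2 * (1 - p.2)) * (2 * Real.sin v * Real.cos v)

theorem sub_sin_sq_mul_mem {x : ℝ} (hx : x ∈ Set.Icc (-1 : ℝ) 1) (v : ℝ) :
    1 - Real.sin v ^ 2 * (1 - x) ∈ Set.Icc (-1 : ℝ) 1 := by
  have h1 := Real.sin_sq_le_one v
  have h2 := sq_nonneg (Real.sin v)
  constructor <;> nlinarith [hx.1, hx.2]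

theorem contDiffOn_hadamardQuot_comp {u : ℝ × ℝ → ℝ} (hu : ContDiffOn ℝ ∞ u strip)
    {E : Type*} [NormedAddCommGroup E] [NormedSpace ℝ E] {S : Set E} (hS : IsOpen S) {g : E → ℝ × ℝ}
    (hg : ContDiffOn ℝ ∞ g S) (hgm : Set.MapsTo g S strip) :
    ContDiffOn ℝ ∞ (fun x => hadamardQuot u (g x)) S := by
  refine (contDiffOn_intervalIntegral (f := fun q : E × ℝ =>
    partialSnd u ((g q.1).1, 1 - Real.sin q.2 ^ 2 * (1 - (g q.1).2)) *
      (2 * Real.sin q.2 * Real.cos q.2)) hS ?_ (by positivity)).neg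
  have hg' : ContDiffOn ℝ ∞ (fun q : E × ℝ => g q.1) (S ×ˢ Set.univ) :=
    hg.comp contDiff_fst.contDiffOn (fun q hq => hq.1)
  have hsin : ContDiffOn ℝ ∞ (fun q : E × ℝ => Real.sin q.2) (S ×ˢ Set.univ) :=
    (Real.contDiff_sin.comp contDiff_snd).contDiffOn
  have hcos : ContDiffOn ℝ ∞ (fun q : E × ℝ => Real.cos q.2) (S ×ˢ Set.univ) :=
    (Real.contDiff_cos.comp contDiff_snd).contDiffOn
  refine ContDiffOn.mul ?_ ((contDiffOn_const.mul hsin).mul hcos)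
  refine (contDiffOn_partialSnd hu).comp (hg'.fst.prodMk
    (contDiffOn_const.sub ((hsin.pow 2).mul (contDiffOn_const.sub hg'.snd)))) ?_
  intro q hq
  exact ⟨(hgm hq.1).1, sub_sin_sq_mul_mem (hgm hq.1).2 _⟩

theorem eq_mul_hadamardQuot {u : ℝ × ℝ → ℝ} (hu : ContDiffOn ℝ ∞ u strip)
    (h1 : ∀ s ∈ Set.Ioo (-1 : ℝ) 1, u (s, 1) = 0) {p : ℝ × ℝ} (hp : p ∈ strip) :
    u p = (1 - p.2) * hadamardQuot u p := by
  obtain ⟨s, x⟩ := p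
  have hmem : ∀ v, (s, 1 - Real.sin v ^ 2 * (1 - x)) ∈ strip := fun v =>
    ⟨hp.1, sub_sin_sq_mul_mem hp.2 v⟩
  have hder : ∀ v, HasDerivAt (fun v => u (s, 1 - Real.sin v ^ 2 * (1 - x)))
      (-(1 - x) * (partialSnd u (s, 1 - Real.sin v ^ 2 * (1 - x)) *
        (2 * Real.sin v * Real.cos v))) v := by
    intro v
    have e1 : HasDerivAt (fun v => 1 - Real.sin v ^ 2 * (1 - x))
        (-(1 - x) * (2 * Real.sin v * Real.cos v)) v := by
      have := (((Real.hasDerivAt_sin v).pow 2).mul_const (1 - x)).const_sub 1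
      exact this.congr_deriv (by push_cast; ring)
    have e2 : HasDerivAt (fun v => (s, 1 - Real.sin v ^ 2 * (1 - x)))
        ((0 : ℝ), -(1 - x) * (2 * Real.sin v * Real.cos v)) v := (hasDerivAt_const v s).prodMk e1
    have e3 : HasFDerivWithinAt u (fderivWithin ℝ u strip (s, 1 - Real.sin v ^ 2 * (1 - x))) strip
        (s, 1 - Real.sin v ^ 2 * (1 - x)) :=
      ((hu.differentiableOn (by simp)) _ (hmem v)).hasFDerivWithinAt
    have e4 := e3.comp_hasDerivWithinAt v (e2.hasDerivWithinAt (s := Set.univ)) (fun v _ => hmem v)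
    rw [hasDerivWithinAt_univ] at e4
    refine e4.congr_deriv ?_
    have : ((0 : ℝ), -(1 - x) * (2 * Real.sin v * Real.cos v)) =
        (-(1 - x) * (2 * Real.sin v * Real.cos v)) • ((0 : ℝ), (1 : ℝ)) := by simp
    rw [this, map_smul, smul_eq_mul, partialSnd]
    ring
  have hcont : Continuous (fun v => -(1 - x) * (partialSnd u (s, 1 - Real.sin v ^ 2 * (1 - x)) *
        (2 * Real.sin v * Real.cos v))) := by
    refine continuous_const.mul (Continuous.mul ?_ (by fun_prop))
    exact (contDiffOn_partialSnd hu).continuousOn.comp_continuous (by fun_prop) hmem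
  have hint := intervalIntegral.integral_eq_sub_of_hasDerivAt (a := 0) (b := Real.pi / 2)
    (fun v _ => hder v) (hcont.intervalIntegrable _ _)
  rw [intervalIntegral.integral_const_mul] at hint
  simp only [Real.sin_pi_div_two, Real.sin_zero] at hint
  norm_num at hint
  rw [h1 s hp.1] at hint
  simp only [hadamardQuot]
  linarith

theorem hadamardQuot_one (u : ℝ × ℝ → ℝ) (s : ℝ) : hadamardQuot u (s, 1) = -partialSnd u (s, 1) := by
  have : ∫ v in (0 : ℝ)..(Real.pi / 2), (2 * Real.sin v * Real.cos v) = 1 := by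
    have h := integral_sin_mul_cos₁ (a := 0) (b := Real.pi / 2)
    simp only [mul_assoc]
    rw [intervalIntegral.integral_const_mul, h]
    norm_num
  simp [hadamardQuot, this]

theorem partialSnd_eq_zero_of_hadamardQuot {u : ℝ × ℝ → ℝ} (s : ℝ)
    (h : hadamardQuot u (s, 1) = 0) : partialSnd u (s, 1) = 0 := by
  rw [hadamardQuot_one] at h
  linarith

/-- For `u ≥ 0` the Hadamard quotient is nonnegative at the end `x = 1` too. -/
theorem hadamardQuot_one_nonneg {u : ℝ × ℝ → ℝ} (hu : ContDiffOn ℝ ∞ u strip)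
    (h1 : ∀ s ∈ Set.Ioo (-1 : ℝ) 1, u (s, 1) = 0) (h0 : ∀ p ∈ strip, 0 ≤ u p)
    {s : ℝ} (hs : s ∈ Set.Ioo (-1 : ℝ) 1) : 0 ≤ hadamardQuot u (s, 1) := by
  have hc : ContDiffOn ℝ ∞ (fun v : ℝ => hadamardQuot u (s, Real.cos v)) Set.univ :=
    contDiffOn_hadamardQuot_comp hu isOpen_univ
      (contDiff_const.prodMk Real.contDiff_cos).contDiffOn
      (fun v _ => ⟨hs, Real.neg_one_le_cos v, Real.cos_le_one v⟩)
  have hcont : ContinuousAt (fun v : ℝ => hadamardQuot u (s, Real.cos v)) 0 :=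
    (hc.continuousOn.continuousAt Filter.univ_mem)
  have hlim : Filter.Tendsto (fun v : ℝ => hadamardQuot u (s, Real.cos v)) (nhdsWithin 0 (Set.Ioi 0))
      (nhds (hadamardQuot u (s, 1))) := by
    have := hcont.tendsto.mono_left (nhdsWithin_le_nhds (s := Set.Ioi (0 : ℝ)))
    simpa using this
  refine ge_of_tendsto hlim ?_
  filter_upwards [Ioo_mem_nhdsGT Real.pi_pos] with v hv
  have hp : ((s, Real.cos v) : ℝ × ℝ) ∈ strip := ⟨hs, Real.neg_one_le_cos v, Real.cos_le_one v⟩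
  have hlt : Real.cos v < 1 := by
    rw [← Real.cos_zero]
    exact Real.cos_lt_cos_of_nonneg_of_le_pi le_rfl hv.2.le hv.1
  have h2 := h0 _ hp
  rw [eq_mul_hadamardQuot hu h1 hp] at h2
  exact nonneg_of_mul_nonneg_right h2 (by simpa using hlt)

namespace IsBand
variable {φ : ℝ × ℝ → Cyl}

theorem hasFDerivWithinAt (h : IsBand φ) {p : ℝ × ℝ} (hp : p ∈ strip) :
    HasFDerivWithinAt (fun q => (φ q).coe) (fderivWithin ℝ (fun q => (φ q).coe) strip p) strip p :=
  (h.smooth.differentiableOn (by simp) p hp).hasFDerivWithinAt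

/-- The derivative of a band takes values in the tangent planes of `S¹ × ℝ`. -/
theorem inner_fderivWithin (h : IsBand φ) {p : ℝ × ℝ} (hp : p ∈ strip) (v : ℝ × ℝ) :
    ((φ p).1 : ℂ).re * (fderivWithin ℝ (fun q => (φ q).coe) strip p v).1.re +
      ((φ p).1 : ℂ).im * (fderivWithin ℝ (fun q => (φ q).coe) strip p v).1.im = 0 := by
  have hA := h.hasFDerivWithinAt hp
  have h1 : HasFDerivWithinAt (fun q => ((φ q).1 : ℂ)) _ strip p :=
    (ContinuousLinearMap.fst ℝ ℂ ℝ).hasFDerivAt.comp_hasFDerivWithinAt p hA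
  have hre : HasFDerivWithinAt (fun q => ((φ q).1 : ℂ).re) _ strip p :=
    Complex.reCLM.hasFDerivAt.comp_hasFDerivWithinAt p h1
  have him : HasFDerivWithinAt (fun q => ((φ q).1 : ℂ).im) _ strip p :=
    Complex.imCLM.hasFDerivAt.comp_hasFDerivWithinAt p h1
  have hsum := (hre.mul hre).add (him.mul him)
  have hconst : HasFDerivWithinAt (fun _ => (1 : ℝ)) (0 : ℝ × ℝ →L[ℝ] ℝ) strip p :=
    hasFDerivWithinAt_const _ _ _
  have heq : (fun _ : ℝ × ℝ => (1 : ℝ)) =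
      ((fun q => ((φ q).1 : ℂ).re) * fun q => ((φ q).1 : ℂ).re) +
        (fun q => ((φ q).1 : ℂ).im) * fun q => ((φ q).1 : ℂ).im := by
    funext q
    have := Circle.normSq_coe (φ q).1
    rw [Complex.normSq_apply] at this
    exact this.symm
  rw [heq] at hconst
  have := (uniqueDiffOn_strip p hp).eq hsum hconst
  have h2 := congrArg (fun L : ℝ × ℝ →L[ℝ] ℝ => L v) this
  simp at h2
  linarith

theorem fderivWithin_ne_zero (h : IsBand φ) {p : ℝ × ℝ} (hp : p ∈ strip) {v : ℝ × ℝ} (hv : v ≠ 0) :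
    fderivWithin ℝ (fun q => (φ q).coe) strip p v ≠ 0 := fun h0 =>
  hv (h.immersion p hp (h0.trans (map_zero _).symm))

/-- The restriction of a band to the boundary line `x = 1` runs in the boundary of the annulus. -/
theorem fderivWithin_boundary (h : IsBand φ) {s : ℝ} (hs : s ∈ Set.Ioo (-1 : ℝ) 1) :
    (fderivWithin ℝ (fun q => (φ q).coe) strip (s, 1) (1, 0)).2 = 0 := by
  have hmem : ∀ t ∈ Set.Ioo (-1 : ℝ) 1, ((t, 1) : ℝ × ℝ) ∈ strip := fun t ht => ⟨ht, by simp⟩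
  have hX : ∀ t ∈ Set.Ioo (-1 : ℝ) 1, |(φ (t, 1)).2| = 1 := fun t ht =>
    (h.boundary _ (hmem t ht)).2 (by simp)
  have e1 : HasDerivWithinAt (fun t : ℝ => ((t, 1) : ℝ × ℝ)) (1, 0) (Set.Ioo (-1) 1) s :=
    ((hasDerivAt_id s).prodMk (hasDerivAt_const s 1)).hasDerivWithinAt
  have e2 := (h.hasFDerivWithinAt (hmem s hs)).comp_hasDerivWithinAt s e1 hmem
  have e3 := (ContinuousLinearMap.snd ℝ ℂ ℝ).hasFDerivAt.comp_hasDerivAt s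
    (e2.hasDerivAt (Ioo_mem_nhds hs.1 hs.2))
  have e4 := e3.mul e3
  have e5 : HasDerivAt (fun _ : ℝ => (1 : ℝ)) 0 s := hasDerivAt_const _ _
  have heq : (fun t : ℝ => (φ (t, 1)).2 * (φ (t, 1)).2) =ᶠ[nhds s] fun _ => 1 := by
    filter_upwards [Ioo_mem_nhds hs.1 hs.2] with t ht
    rw [← abs_mul_abs_self, hX t ht, one_mul]
  have e6 := (e5.congr_of_eventuallyEq heq).unique e4
  have hne : (φ (s, 1)).2 ≠ 0 := fun h0 => by
    have := hX s hs
    rw [h0, abs_zero] at this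
    exact zero_ne_one this
  have e7 : (φ (s, 1)).2 * (fderivWithin ℝ (fun q => (φ q).coe) strip (s, 1) (1, 0)).2 = 0 := by
    change 0 = _ * (φ (s, 1)).2 + (φ (s, 1)).2 * _ at e6
    rw [ContinuousLinearMap.coe_snd'] at e6
    linarith
  exact (mul_eq_zero.1 e7).resolve_left hne

/-- At the boundary, a band is transverse to the boundary of the annulus. -/
theorem fderivWithin_transverse (h : IsBand φ) {s : ℝ} (hs : s ∈ Set.Ioo (-1 : ℝ) 1) :
    (fderivWithin ℝ (fun q => (φ q).coe) strip (s, 1) (0, 1)).2 ≠ 0 := by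
  intro h0
  have hp : ((s, 1) : ℝ × ℝ) ∈ strip := ⟨hs, by simp⟩
  have h1 := h.fderivWithin_boundary hs
  have i1 := h.inner_fderivWithin hp (1, 0)
  have i2 := h.inner_fderivWithin hp (0, 1)
  have hne := h.fderivWithin_ne_zero hp (v := (1, 0)) (by simp)
  set A := fderivWithin ℝ (fun q => (φ q).coe) strip (s, 1) with hA
  have hw := Circle.normSq_coe (φ (s, 1)).1
  rw [Complex.normSq_apply] at hw
  set w := ((φ (s, 1)).1 : ℂ)
  -- both partial derivatives are multiples of `i w` in the plane `ℂ × 0`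
  have hdet : (A (1, 0)).1.re * (A (0, 1)).1.im - (A (1, 0)).1.im * (A (0, 1)).1.re = 0 := by
    have a1 : w.re * ((A (1, 0)).1.re * (A (0, 1)).1.im - (A (1, 0)).1.im * (A (0, 1)).1.re) = 0 := by
      linear_combination (A (0, 1)).1.im * i1 - (A (1, 0)).1.im * i2
    have a2 : w.im * ((A (1, 0)).1.re * (A (0, 1)).1.im - (A (1, 0)).1.im * (A (0, 1)).1.re) = 0 := by
      linear_combination (A (1, 0)).1.re * i2 - (A (0, 1)).1.re * i1
    linear_combination w.re * a1 + w.im * a2 -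
      ((A (1, 0)).1.re * (A (0, 1)).1.im - (A (1, 0)).1.im * (A (0, 1)).1.re) * hw
  have hcomb : ∀ c d : ℝ, A (c, d) = c • A (1, 0) + d • A (0, 1) := fun c d => by
    rw [← map_smul, ← map_smul, ← map_add]; simp
  have key1 : A ((A (0, 1)).1.re, -(A (1, 0)).1.re) = 0 := by
    rw [hcomb]
    refine Prod.ext (Complex.ext ?_ ?_) ?_
    · simp; ring
    · simp; linarith
    · simp [h0, h1]
  have key2 : A ((A (0, 1)).1.im, -(A (1, 0)).1.im) = 0 := by
    rw [hcomb]
    refine Prod.ext (Complex.ext ?_ ?_) ?_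
    · simp; linarith
    · simp; ring
    · simp [h0, h1]
  have k1 : (A (1, 0)).1.re = 0 := by
    by_contra hc
    exact h.fderivWithin_ne_zero hp (fun hz => hc (neg_eq_zero.1 (congrArg Prod.snd hz))) key1
  have k2 : (A (1, 0)).1.im = 0 := by
    by_contra hc
    exact h.fderivWithin_ne_zero hp (fun hz => hc (neg_eq_zero.1 (congrArg Prod.snd hz))) key2
  exact hne (Prod.ext (Complex.ext k1 k2) h1)

/-- The square of the radius of the vertical circle over a point of the band. -/
def radiusSq (φ : ℝ × ℝ → Cyl) (p : ℝ × ℝ) : ℝ := 1 - (φ p).2 ^ 2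

theorem contDiffOn_radiusSq (h : IsBand φ) : ContDiffOn ℝ ∞ (radiusSq φ) strip :=
  contDiffOn_const.sub (h.smooth.snd.pow 2)

theorem radiusSq_nonneg (h : IsBand φ) {p : ℝ × ℝ} (hp : p ∈ strip) : 0 ≤ radiusSq φ p := by
  have : |(φ p).2| ≤ 1 := h.mapsTo hp
  have := (sq_le_one_iff_abs_le_one _).2 this
  simp only [radiusSq]; linarith

theorem radiusSq_eq_zero_iff (h : IsBand φ) {p : ℝ × ℝ} (hp : p ∈ strip) :
    radiusSq φ p = 0 ↔ |p.2| = 1 := by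
  rw [← h.boundary p hp, radiusSq, ← sq_abs,
    ← pow_eq_one_iff_of_nonneg (abs_nonneg (φ p).2) two_ne_zero]
  constructor <;> intro h <;> linarith

theorem hadamardQuot_one_pos (h : IsBand φ) {s : ℝ} (hs : s ∈ Set.Ioo (-1 : ℝ) 1) :
    0 < hadamardQuot (radiusSq φ) (s, 1) := by
  have hmem : ∀ t ∈ Set.Ioo (-1 : ℝ) 1, ((t, 1) : ℝ × ℝ) ∈ strip := fun t ht => ⟨ht, by simp⟩
  have hz : ∀ t ∈ Set.Ioo (-1 : ℝ) 1, radiusSq φ (t, 1) = 0 := fun t ht =>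
    (h.radiusSq_eq_zero_iff (hmem t ht)).2 (by simp)
  refine lt_of_le_of_ne (hadamardQuot_one_nonneg h.contDiffOn_radiusSq hz
    (fun p hp => h.radiusSq_nonneg hp) hs) fun h0 => ?_
  have h1 := partialSnd_eq_zero_of_hadamardQuot s h0.symm
  have e1 := (ContinuousLinearMap.snd ℝ ℂ ℝ).hasFDerivAt.comp_hasFDerivWithinAt _
    (h.hasFDerivWithinAt (hmem s hs))
  have e2 : HasFDerivWithinAt (radiusSq φ) _ strip (s, 1) := (e1.mul e1).const_sub 1 |>.congr
    (fun q _ => by simp [radiusSq, Cyl.coe, sq]) (by simp [radiusSq, Cyl.coe, sq])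
  rw [partialSnd, e2.fderivWithin (uniqueDiffOn_strip _ (hmem s hs))] at h1
  simp [Cyl.coe] at h1
  rcases h1 with h1 | h1
  · have := (h.boundary _ (hmem s hs)).2 (by simp)
    rw [h1, abs_zero] at this
    exact zero_ne_one this
  · exact h.fderivWithin_transverse hs h1

/-- The reflection of the strip in its core. -/
theorem flip (h : IsBand φ) : IsBand (fun p => φ (p.1, -p.2)) := by
  have hm : Set.MapsTo (fun p : ℝ × ℝ => (p.1, -p.2)) strip strip := fun p hp =>
    ⟨hp.1, by linarith [hp.2.2], by linarith [hp.2.1]⟩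
  let R : ℝ × ℝ →L[ℝ] ℝ × ℝ :=
    (ContinuousLinearMap.fst ℝ ℝ ℝ).prod (-ContinuousLinearMap.snd ℝ ℝ ℝ)
  have hR : (fun p : ℝ × ℝ => (p.1, -p.2)) = R := rfl
  refine ⟨h.smooth.comp R.contDiff.contDiffOn hm, fun p hp => ?_, fun p hp q hq hpq => ?_,
    fun p hp => h.mapsTo (hm hp), fun p hp => ?_⟩
  · have := (h.hasFDerivWithinAt (hm hp)).comp p (R.hasFDerivAt.hasFDerivWithinAt (s := strip)) hm
    have h2 : fderivWithin ℝ (fun q : ℝ × ℝ => (φ (q.1, -q.2)).coe) strip p = _ :=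
      this.fderivWithin (uniqueDiffOn_strip p hp)
    rw [h2]
    refine (h.immersion _ (hm hp)).comp fun v w hvw => ?_
    have a := congrArg Prod.fst hvw
    have b := congrArg Prod.snd hvw
    exact Prod.ext a (neg_injective b)
  · have := h.injOn (hm hp) (hm hq) hpq
    exact Prod.ext (Prod.ext_iff.1 this).1 (neg_injective (Prod.ext_iff.1 this).2)
  · rw [h.boundary _ (hm hp)]
    simp

/-- The smooth positive function `k` on the strip with `1 - X² = k (1 - x²)`, where `X` is the second
coordinate of the band. -/
def ratioSq (φ : ℝ × ℝ → Cyl) (p : ℝ × ℝ) : ℝ :=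
  if 0 ≤ p.2 then hadamardQuot (radiusSq φ) p / (1 + p.2)
  else hadamardQuot (radiusSq fun q => φ (q.1, -q.2)) (p.1, -p.2) / (1 - p.2)

theorem radiusSq_eq_right (h : IsBand φ) {p : ℝ × ℝ} (hp : p ∈ strip) :
    radiusSq φ p = (1 - p.2) * hadamardQuot (radiusSq φ) p :=
  eq_mul_hadamardQuot h.contDiffOn_radiusSq
    (fun _ ht => (h.radiusSq_eq_zero_iff ⟨ht, by simp⟩).2 (by simp)) hp

theorem radiusSq_eq_left (h : IsBand φ) {p : ℝ × ℝ} (hp : p ∈ strip) :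
    radiusSq φ p = (1 + p.2) * hadamardQuot (radiusSq fun q => φ (q.1, -q.2)) (p.1, -p.2) := by
  have hm : (p.1, -p.2) ∈ strip := ⟨hp.1, by linarith [hp.2.2], by linarith [hp.2.1]⟩
  have := h.flip.radiusSq_eq_right hm
  simpa [radiusSq] using this

theorem radiusSq_eq_ratioSq_mul (h : IsBand φ) {p : ℝ × ℝ} (hp : p ∈ strip) :
    1 - (φ p).2 ^ 2 = ratioSq φ p * (1 - p.2 ^ 2) := by
  change radiusSq φ p = _
  rw [ratioSq]
  split_ifs with h0
  · rw [h.radiusSq_eq_right hp]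
    have : 1 + p.2 ≠ 0 := by linarith
    field_simp
    ring
  · rw [h.radiusSq_eq_left hp]
    have : 1 - p.2 ≠ 0 := by linarith
    field_simp
    ring

theorem ratioSq_pos (h : IsBand φ) {p : ℝ × ℝ} (hp : p ∈ strip) : 0 < ratioSq φ p := by
  by_cases hb : |p.2| = 1
  · obtain ⟨s, x⟩ := p
    rcases eq_or_eq_neg_of_abs_eq hb with h1 | h1 <;> simp only at h1 <;> subst h1
    · have := h.hadamardQuot_one_pos hp.1
      simp only [ratioSq, zero_le_one, if_true]
      positivity
    · have := h.flip.hadamardQuot_one_pos hp.1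
      simp only [ratioSq, neg_neg]
      norm_num
      exact this
  · have h1 := h.radiusSq_nonneg hp
    have h2 := (h.radiusSq_eq_zero_iff hp).not.2 hb
    have h3 := h.radiusSq_eq_ratioSq_mul hp
    have h4 : 0 < radiusSq φ p := lt_of_le_of_ne h1 (Ne.symm h2)
    rw [radiusSq, h3] at h4
    refine pos_of_mul_pos_left h4 ?_
    have := abs_le.2 hp.2
    linarith [(sq_le_one_iff_abs_le_one _).2 this]

theorem contDiffOn_ratioSq_comp (h : IsBand φ)
    {E : Type*} [NormedAddCommGroup E] [NormedSpace ℝ E] {S : Set E} (hS : IsOpen S) {g : E → ℝ × ℝ}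
    (hg : ContDiffOn ℝ ∞ g S) (hgm : Set.MapsTo g S strip) :
    ContDiffOn ℝ ∞ (fun x => ratioSq φ (g x)) S := by
  have c1 := contDiffOn_hadamardQuot_comp h.contDiffOn_radiusSq hS hg hgm
  have c2 := contDiffOn_hadamardQuot_comp h.flip.contDiffOn_radiusSq hS
    (hg.fst.prodMk hg.snd.neg) (fun x hx => ⟨(hgm hx).1, by linarith [(hgm hx).2.2],
      by linarith [(hgm hx).2.1]⟩)
  intro x hx
  have hgc : ContinuousAt (fun x => (g x).2) x :=
    ((hg.continuousOn x hx).continuousAt (hS.mem_nhds hx)).snd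
  refine ContDiffAt.contDiffWithinAt ?_
  rcases lt_or_ge (-1) (g x).2 with h1 | h1
  · have c3 : ContDiffAt ℝ ∞ (fun x => hadamardQuot (radiusSq φ) (g x) / (1 + (g x).2)) x :=
      (c1.contDiffAt (hS.mem_nhds hx)).div
        (contDiffAt_const.add (hg.contDiffAt (hS.mem_nhds hx)).snd) (by linarith)
    refine c3.congr_of_eventuallyEq ?_
    filter_upwards [hS.mem_nhds hx, hgc.eventually_const_lt h1] with y hy hy1
    rw [ratioSq]
    split_ifs with h0
    · rfl
    · rw [div_eq_div_iff (by linarith) (by linarith)]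
      have a := h.radiusSq_eq_right (hgm hy)
      have b := h.radiusSq_eq_left (hgm hy)
      linarith
  · have c3 : ContDiffAt ℝ ∞ (fun x => hadamardQuot (radiusSq fun q => φ (q.1, -q.2))
        ((g x).1, -(g x).2) / (1 - (g x).2)) x :=
      (c2.contDiffAt (hS.mem_nhds hx)).div
        (contDiffAt_const.sub (hg.contDiffAt (hS.mem_nhds hx)).snd) (by linarith)
    refine c3.congr_of_eventuallyEq ?_
    filter_upwards [hgc.eventually_lt_const (show (g x).2 < 0 by linarith)] with y hy1
    rw [ratioSq, if_neg (by linarith)]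

end IsBand

open Classical in
/-- A vector of `ℝ³` as a point of `S²` (with a junk value if it is not a unit vector). -/
def toS2 (v : EuclideanSpace ℝ (Fin 3)) : S2 :=
  if h : v ∈ Metric.sphere (0 : EuclideanSpace ℝ (Fin 3)) 1 then ⟨v, h⟩ else hemi 0 0 (by norm_num)

theorem coe_toS2 {v : EuclideanSpace ℝ (Fin 3)}
    (h : v ∈ Metric.sphere (0 : EuclideanSpace ℝ (Fin 3)) 1) : (toS2 v).1 = v := by
  rw [toS2, dif_pos h]

theorem S2_abs_le_one (q : S2) : q.1 0 ∈ Set.Icc (-1 : ℝ) 1 := by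
  have := S2_sum_sq q
  rw [Set.mem_Icc, ← abs_le, ← sq_le_one_iff_abs_le_one]
  nlinarith [sq_nonneg (q.1 1), sq_nonneg (q.1 2)]

/-- The double of the solid torus `S¹ × (lower hemisphere)` restricts to a double of the part
of the solid torus over the band, which is identified here with `(-1,1) × S²`: the vertical circle over
`(s, x)` is mapped by a dilation to the one over `φ (s, x)`. -/
def bandDouble (φ : ℝ × ℝ → Cyl) (s : ℝ) (q : S2) : S1S2 :=
  ((φ (s, q.1 0)).1, toS2 !₂[(φ (s, q.1 0)).2, √(IsBand.ratioSq φ (s, q.1 0)) * q.1 1,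
    √(IsBand.ratioSq φ (s, q.1 0)) * q.1 2])

namespace IsBand
variable {φ : ℝ × ℝ → Cyl}

theorem coe_bandDouble_snd (h : IsBand φ) {s : ℝ} (hs : s ∈ Set.Ioo (-1 : ℝ) 1) (q : S2) :
    (bandDouble φ s q).2.1 = !₂[(φ (s, q.1 0)).2, √(ratioSq φ (s, q.1 0)) * q.1 1,
      √(ratioSq φ (s, q.1 0)) * q.1 2] := by
  have hp : (s, q.1 0) ∈ strip := ⟨hs, S2_abs_le_one q⟩
  refine coe_toS2 (mem_S2_of_sum_sq ?_)
  have h1 := h.radiusSq_eq_ratioSq_mul hp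
  have h2 := S2_sum_sq q
  rw [mul_pow, mul_pow, Real.sq_sqrt (h.ratioSq_pos hp).le]
  simp only at h1
  linear_combination -h1 + ratioSq φ (s, q.1 0) * h2

theorem toCyl_bandDouble (h : IsBand φ) {s : ℝ} (hs : s ∈ Set.Ioo (-1 : ℝ) 1) (q : S2) :
    toCyl (bandDouble φ s q) = φ (s, q.1 0) := by
  simp only [toCyl, h.coe_bandDouble_snd hs]
  rfl

theorem bandDouble_injective (h : IsBand φ) {s s' : ℝ} (hs : s ∈ Set.Ioo (-1 : ℝ) 1)
    (hs' : s' ∈ Set.Ioo (-1 : ℝ) 1) {q q' : S2} (heq : bandDouble φ s q = bandDouble φ s' q') :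
    s = s' ∧ q = q' := by
  have h1 := congrArg toCyl heq
  rw [h.toCyl_bandDouble hs, h.toCyl_bandDouble hs'] at h1
  have h2 := h.injOn ⟨hs, S2_abs_le_one q⟩ ⟨hs', S2_abs_le_one q'⟩ h1
  have hss : s = s' := (Prod.ext_iff.1 h2).1
  have hxx : q.1 0 = q'.1 0 := (Prod.ext_iff.1 h2).2
  subst hss
  have h3 : (bandDouble φ s q).2.1 = (bandDouble φ s q').2.1 := by rw [heq]
  rw [h.coe_bandDouble_snd hs, h.coe_bandDouble_snd hs, ← hxx] at h3
  have hr : √(ratioSq φ (s, q.1 0)) ≠ 0 :=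
    (Real.sqrt_pos.2 (h.ratioSq_pos ⟨hs, S2_abs_le_one q⟩)).ne'
  have h4 := congrArg (fun v : EuclideanSpace ℝ (Fin 3) => v 1) h3
  have h5 := congrArg (fun v : EuclideanSpace ℝ (Fin 3) => v 2) h3
  exact ⟨rfl, S2_ext hxx (mul_left_cancel₀ hr h4) (mul_left_cancel₀ hr h5)⟩

/-- Over the core of the band, the double of the band is the annulus at height `0`. -/
theorem bandDouble_hemi_zero (h : IsBand φ) {s : ℝ} (hs : s ∈ Set.Ioo (-1 : ℝ) 1) {x : ℝ}
    (hx : x ^ 2 + 0 ^ 2 ≤ 1) (hX : (φ (s, x)).2 ^ 2 + 0 ^ 2 ≤ 1) :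
    bandDouble φ s (hemi x 0 hx) = ((φ (s, x)).1, hemi (φ (s, x)).2 0 hX) := by
  have h0 : (hemi x 0 hx).1 0 = x := rfl
  have hp : (s, x) ∈ strip := ⟨hs, S2_abs_le_one (hemi x 0 hx)⟩
  refine Prod.ext rfl (Subtype.ext ?_)
  rw [h.coe_bandDouble_snd hs, h0]
  have h1 := h.radiusSq_eq_ratioSq_mul hp
  simp only at h1
  have h2 : √(ratioSq φ (s, x)) * -√(1 - x ^ 2 - 0 ^ 2) = -√(1 - (φ (s, x)).2 ^ 2 - 0 ^ 2) := by
    rw [mul_neg, ← Real.sqrt_mul (h.ratioSq_pos hp).le]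
    congr 2
    linear_combination -h1
  ext i
  fin_cases i
  · rfl
  · exact mul_zero _
  · exact h2

theorem contDiffOn_bandDouble (h : IsBand φ) {E : Type*} [NormedAddCommGroup E] [NormedSpace ℝ E]
    {S : Set E} (hS : IsOpen S) {σ : E → ℝ} {G : E → S2} (hσ : ContDiffOn ℝ ∞ σ S)
    (hσm : ∀ x ∈ S, σ x ∈ Set.Ioo (-1 : ℝ) 1) (hG : ContDiffOn ℝ ∞ (fun x => (G x).1) S) :
    ContDiffOn ℝ ∞ (fun x => ((bandDouble φ (σ x) (G x)).1 : ℂ)) S ∧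
      ContDiffOn ℝ ∞ (fun x => (bandDouble φ (σ x) (G x)).2.1) S := by
  have hGi : ∀ i, ContDiffOn ℝ ∞ (fun x => (G x).1 i) S := fun i => by
    have h3 : ContDiff ℝ ∞ (fun v : EuclideanSpace ℝ (Fin 3) => v i) := by fun_prop
    exact h3.comp_contDiffOn hG
  have hg : ContDiffOn ℝ ∞ (fun x => (σ x, (G x).1 0)) S := hσ.prodMk (hGi 0)
  have hgm : Set.MapsTo (fun x => (σ x, (G x).1 0)) S strip := fun x hx =>
    ⟨hσm x hx, S2_abs_le_one _⟩
  have hφ := h.smooth.comp hg hgm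
  have hr : ContDiffOn ℝ ∞ (fun x => √(ratioSq φ (σ x, (G x).1 0))) S :=
    (h.contDiffOn_ratioSq_comp hS hg hgm).sqrt fun x hx => (h.ratioSq_pos (hgm hx)).ne'
  refine ⟨hφ.fst, fun x hx => ContDiffAt.contDiffWithinAt ?_⟩
  have hn := hS.mem_nhds hx
  refine (contDiffAt_E3 (hφ.snd.contDiffAt hn) ((hr.mul (hGi 1)).contDiffAt hn)
    ((hr.mul (hGi 2)).contDiffAt hn)).congr_of_eventuallyEq ?_
  filter_upwards [hn] with y hy
  rw [h.coe_bandDouble_snd (hσm y hy)]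
  rfl

/-- A band has a smooth local inverse at the interior points of the strip. -/
theorem exists_local_inverse (h : IsBand φ) {p : ℝ × ℝ} (h1 : p.1 ∈ Set.Ioo (-1 : ℝ) 1)
    (h2 : p.2 ∈ Set.Ioo (-1 : ℝ) 1) :
    ∃ ρ : ℂ × ℝ → ℝ × ℝ, ContDiffAt ℝ ∞ ρ (φ p).coe ∧ ρ (φ p).coe = p ∧
      ∀ᶠ z in nhds (φ p), φ (ρ z.coe) = z := by
  have hnhds : strip ∈ nhds p :=
    prod_mem_nhds (Ioo_mem_nhds h1.1 h1.2) (Icc_mem_nhds h2.1 h2.2)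
  have hps : p ∈ strip := mem_of_mem_nhds hnhds
  set w₀ : ℂ := ((φ p).1 : ℂ) with hw₀
  -- the angle from `w₀`, as a local coordinate on the circle
  let A : ℂ × ℝ → ℝ × ℝ := fun q => (Complex.arg (q.1 * (starRingEnd ℂ) w₀), q.2)
  let E : ℝ × ℝ → ℂ × ℝ := fun q => (w₀ * Complex.exp (q.1 * Complex.I), q.2)
  have hww : w₀ * (starRingEnd ℂ) w₀ = 1 := by
    rw [Complex.mul_conj, hw₀, Circle.normSq_coe]; simp
  have hEA : ∀ z : Cyl, E (A z.coe) = z.coe := by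
    intro z
    refine Prod.ext ?_ rfl
    have hn : ‖(z.1 : ℂ) * (starRingEnd ℂ) w₀‖ = 1 := by
      rw [norm_mul, Circle.norm_coe, RCLike.norm_conj, hw₀, Circle.norm_coe, one_mul]
    have := Complex.norm_mul_exp_arg_mul_I ((z.1 : ℂ) * (starRingEnd ℂ) w₀)
    rw [hn, Complex.ofReal_one, one_mul] at this
    change w₀ * Complex.exp (_ * Complex.I) = (z.1 : ℂ)
    change w₀ * Complex.exp ((((z.1 : ℂ) * (starRingEnd ℂ) w₀).arg : ℝ) * Complex.I) = (z.1 : ℂ)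
    rw [this]
    linear_combination (z.1 : ℂ) * hww
  have hA : ContDiffAt ℝ ∞ A (φ p).coe := by
    refine ContDiffAt.prodMk ?_ contDiff_snd.contDiffAt
    have e1 : ContDiffAt ℝ ∞ (fun q : ℂ × ℝ => q.1 * (starRingEnd ℂ) w₀) (φ p).coe :=
      (contDiff_fst.mul contDiff_const).contDiffAt
    have e2 : ContDiffAt ℝ ∞ Complex.log
        ((fun q : ℂ × ℝ => q.1 * (starRingEnd ℂ) w₀) (φ p).coe) := by
      have : (φ p).coe.1 * (starRingEnd ℂ) w₀ = 1 := hww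
      simp only [this]
      exact (Complex.contDiffAt_log (by simp)).restrict_scalars ℝ
    have e3 := Complex.imCLM.contDiff.contDiffAt.comp (φ p).coe (e2.comp (φ p).coe e1)
    refine e3.congr_of_eventuallyEq (Filter.Eventually.of_forall fun q => ?_)
    simp [Complex.log_im]
  have hE : Differentiable ℝ E := by
    have : ContDiff ℝ 1 E := by
      refine ContDiff.prodMk (contDiff_const.mul ?_) contDiff_snd
      have e1 : ContDiff ℝ 1 (fun q : ℝ × ℝ => (q.1 : ℂ) * Complex.I) :=
        (Complex.ofRealCLM.contDiff.comp contDiff_fst).mul contDiff_const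
      exact e1.cexp
    exact this.differentiable one_ne_zero
  let f : ℝ × ℝ → ℝ × ℝ := fun q => A (φ q).coe
  have hφ : ContDiffAt ℝ ∞ (fun q => (φ q).coe) p := h.smooth.contDiffAt hnhds
  have hf : ContDiffAt ℝ ∞ f p := hA.comp p hφ
  have hfd : HasFDerivAt f (fderiv ℝ f p) p := (hf.differentiableAt (by simp)).hasFDerivAt
  have hinj : Function.Injective (fderiv ℝ f p) := by
    have e1 : HasFDerivAt (fun q => (φ q).coe) ((fderiv ℝ E (f p)).comp (fderiv ℝ f p)) p := by
      have := (hE (f p)).hasFDerivAt.comp p hfd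
      refine this.congr_of_eventuallyEq (Filter.Eventually.of_forall fun q => ?_)
      exact (hEA (φ q)).symm
    have e2 := h.immersion p hps
    rw [fderivWithin_of_mem_nhds hnhds, e1.fderiv] at e2
    exact Function.Injective.of_comp e2
  let B : (ℝ × ℝ) ≃L[ℝ] (ℝ × ℝ) :=
    (LinearEquiv.ofInjectiveEndo (fderiv ℝ f p).toLinearMap hinj).toContinuousLinearEquiv
  have hB : HasFDerivAt f (B : ℝ × ℝ →L[ℝ] ℝ × ℝ) p := by
    have : (B : ℝ × ℝ →L[ℝ] ℝ × ℝ) = fderiv ℝ f p := by ext <;> rfl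
    rw [this]; exact hfd
  have hn : (∞ : WithTop ℕ∞) ≠ 0 := by simp
  have hstrict : HasStrictFDerivAt f (B : ℝ × ℝ →L[ℝ] ℝ × ℝ) p := hf.hasStrictFDerivAt' hB hn
  refine ⟨fun q => hf.localInverse hB hn (A q), ?_, ?_, ?_⟩
  · exact ContDiffAt.comp (g := hf.localInverse hB hn) (f := A) (φ p).coe
      (hf.to_localInverse hB hn) hA
  · exact hf.localInverse_apply_image hB hn
  · have e1 : Filter.Tendsto (fun z : Cyl => A z.coe) (nhds (φ p)) (nhds (f p)) :=
      (hA.continuousAt.tendsto.comp Cyl.isEmbedding_coe.continuous.continuousAt)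
    filter_upwards [e1.eventually hstrict.eventually_right_inverse] with z hz
    apply Cyl.coe_injective
    exact (hEA _).symm.trans ((congrArg E hz).trans (hEA z))

end IsBand

/-! ### Diagrams that meet a band in three parallel strands -/

/-- The second coordinate of the `i`-th parallel strand. -/
def strandLevel (i : Fin 3) : ℝ := parallelStrand i 0

theorem strandLevel_injective : Function.Injective strandLevel := by
  intro i j h
  fin_cases i <;> fin_cases j <;> first | rfl | (norm_num [strandLevel, parallelStrand] at h)

theorem strandLevel_sq_lt (i : Fin 3) : strandLevel i ^ 2 < 1 := by
  fin_cases i <;> norm_num [strandLevel, parallelStrand]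

theorem strandLevel_mem (i : Fin 3) : strandLevel i ∈ Set.Ioo (-1 : ℝ) 1 := by
  have := abs_lt.1 ((sq_lt_one_iff_abs_lt_one _).1 (strandLevel_sq_lt i))
  exact this

theorem mk_strandLevel_mem_strip {s : ℝ} (hs : s ∈ Set.Ioo (-1 : ℝ) 1) (i : Fin 3) :
    (s, strandLevel i) ∈ strip :=
  ⟨hs, (strandLevel_mem i).1.le, (strandLevel_mem i).2.le⟩

theorem basePoint_aux (i : Fin 3) : strandLevel i ^ 2 + 0 ^ 2 ≤ 1 := by
  have := strandLevel_sq_lt i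
  linarith

/-- The point of `S²` over the `i`-th strand. -/
def basePoint (i : Fin 3) : S2 := hemi (strandLevel i) 0 (basePoint_aux i)

/-- The part of the diagram in the band `φ` runs in three parallel strands. -/
structure MeetsBandInStrands (D : AnnularDiagram) (φ : ℝ × ℝ → Cyl) : Prop where
  isBand : IsBand φ
  strands : ∀ k t, D.curve k t ∈ φ '' strip →
    ∃ i, ∃ s ∈ Set.Ioo (-1 : ℝ) 1, D.curve k t = φ (s, strandLevel i)

namespace MeetsBandInStrands
variable {D : AnnularDiagram} {φ : ℝ × ℝ → Cyl}

theorem unique (h : MeetsBandInStrands D φ) {s s' : ℝ} (hs : s ∈ Set.Ioo (-1 : ℝ) 1)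
    (hs' : s' ∈ Set.Ioo (-1 : ℝ) 1) {i j : Fin 3}
    (heq : φ (s, strandLevel i) = φ (s', strandLevel j)) : s = s' ∧ i = j := by
  have := h.isBand.injOn (mk_strandLevel_mem_strip hs i) (mk_strandLevel_mem_strip hs' j) heq
  exact ⟨(Prod.ext_iff.1 this).1, strandLevel_injective (Prod.ext_iff.1 this).2⟩

/-- Along a strand the band parameter `s` is a smooth function of the parameter of the curve. -/
theorem exists_local_param (h : MeetsBandInStrands D φ) {k : Fin D.n} {t : ℝ} {i : Fin 3} {s : ℝ}
    (hs : s ∈ Set.Ioo (-1 : ℝ) 1) (ht : D.curve k t = φ (s, strandLevel i)) :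
    ∃ σ : ℝ → ℝ, ContDiffAt ℝ ∞ σ t ∧ σ t = s ∧
      ∀ᶠ t' in nhds t, σ t' ∈ Set.Ioo (-1 : ℝ) 1 ∧ D.curve k t' = φ (σ t', strandLevel i) := by
  obtain ⟨ρ, hρ, hρ0, hρ1⟩ := h.isBand.exists_local_inverse (p := (s, strandLevel i)) hs
    (strandLevel_mem i)
  rw [← ht] at hρ hρ0 hρ1
  have hc : ContDiffAt ℝ ∞ (fun t' => ρ (D.curve k t').coe) t :=
    ContDiffAt.comp (g := ρ) (f := fun t' => (D.curve k t').coe) t hρ (D.smooth k).contDiffAt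
  refine ⟨fun t' => (ρ (D.curve k t').coe).1, hc.fst, by simp only [hρ0], ?_⟩
  have hcont := hc.continuousAt
  have hs1 : ∀ᶠ t' in nhds t, (ρ (D.curve k t').coe).1 ∈ Set.Ioo (-1 : ℝ) 1 :=
    hcont.fst (isOpen_Ioo.mem_nhds (by simp only [hρ0]; exact hs))
  have hs2 : ∀ᶠ t' in nhds t, (ρ (D.curve k t').coe).2 ∈
      Set.Ioo (-1 : ℝ) 1 ∩ (strandLevel '' {i}ᶜ)ᶜ := by
    refine hcont.snd ((isOpen_Ioo.inter
      (Set.toFinite (strandLevel '' {i}ᶜ)).isClosed.isOpen_compl).mem_nhds ?_)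
    simp only [hρ0]
    refine ⟨strandLevel_mem i, ?_⟩
    rintro ⟨j, hj, hji⟩
    exact hj (strandLevel_injective hji)
  filter_upwards [hs1, hs2, (D.continuous_curve k).continuousAt.eventually hρ1] with t' a1 a2 a3
  refine ⟨a1, ?_⟩
  have hp : ρ (D.curve k t').coe ∈ strip := ⟨a1, a2.1.1.le, a2.1.2.le⟩
  obtain ⟨j, s', hs', hj⟩ := h.strands k t' ⟨_, hp, a3⟩
  have := h.isBand.injOn hp (mk_strandLevel_mem_strip hs' j) (a3.trans hj)
  have hji : j = i := by
    by_contra hne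
    exact a2.2 ⟨j, hne, (Prod.ext_iff.1 this).2.symm⟩
  simp only [this]
  rw [← hji, hj]

theorem hasDerivAt_comp (h : MeetsBandInStrands D φ) {σ x : ℝ → ℝ} {t σ' x' : ℝ}
    (hσ : HasDerivAt σ σ' t) (hx : HasDerivAt x x' t)
    (hm : ∀ᶠ t' in nhds t, (σ t', x t') ∈ strip) :
    HasDerivAt (fun t' => (φ (σ t', x t')).coe)
      (fderivWithin ℝ (fun q => (φ q).coe) strip (σ t, x t) (σ', x')) t := by
  have e1 := (h.isBand.hasFDerivWithinAt hm.self_of_nhds).comp_hasDerivWithinAt t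
    ((hσ.prodMk hx).hasDerivWithinAt (s := {t' | (σ t', x t') ∈ strip})) (fun _ ht => ht)
  exact e1.hasDerivAt hm

theorem deriv_curve (h : MeetsBandInStrands D φ) {k : Fin D.n} {t : ℝ} {i : Fin 3} {σ : ℝ → ℝ}
    (hσ : DifferentiableAt ℝ σ t) (hσ1 : ∀ᶠ t' in nhds t, σ t' ∈ Set.Ioo (-1 : ℝ) 1 ∧
      D.curve k t' = φ (σ t', strandLevel i)) :
    deriv (fun t' => (D.curve k t').coe) t = deriv σ t •
      fderivWithin ℝ (fun q => (φ q).coe) strip (σ t, strandLevel i) (1, 0) := by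
  have e1 := h.hasDerivAt_comp hσ.hasDerivAt (hasDerivAt_const t (strandLevel i))
    (hσ1.mono fun t' ht' => mk_strandLevel_mem_strip ht'.1 i)
  have e2 := e1.congr_of_eventuallyEq (hσ1.mono fun t' ht' => congrArg Cyl.coe ht'.2)
  rw [e2.deriv, ← map_smul]
  simp

theorem deriv_param_ne_zero (h : MeetsBandInStrands D φ) {k : Fin D.n} {t : ℝ} {i : Fin 3}
    {σ : ℝ → ℝ} (hσ : DifferentiableAt ℝ σ t)
    (hσ1 : ∀ᶠ t' in nhds t, σ t' ∈ Set.Ioo (-1 : ℝ) 1 ∧ D.curve k t' = φ (σ t', strandLevel i)) :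
    deriv σ t ≠ 0 := fun h0 =>
  D.immersion k t (by rw [h.deriv_curve hσ hσ1, h0, zero_smul])

/-- Each strand is run through only once, since the double points are transverse. -/
theorem sameParam (h : MeetsBandInStrands D φ) {k l : Fin D.n} {t u s : ℝ} {i : Fin 3}
    (hs : s ∈ Set.Ioo (-1 : ℝ) 1) (ht : D.curve k t = φ (s, strandLevel i))
    (hu : D.curve l u = φ (s, strandLevel i)) : SameParam k t l u := by
  by_contra hcon
  have hli := D.transverse k t l u ⟨ht.trans hu.symm, hcon⟩
  obtain ⟨σ, a1, a2, a3⟩ := h.exists_local_param hs ht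
  obtain ⟨σ', b1, b2, b3⟩ := h.exists_local_param hs hu
  rw [h.deriv_curve (a1.differentiableAt (by simp)) a3,
    h.deriv_curve (b1.differentiableAt (by simp)) b3, a2, b2, LinearIndependent.pair_iff] at hli
  have h0 := h.deriv_param_ne_zero (b1.differentiableAt (by simp)) b3
  have := hli (deriv σ' u) (-deriv σ t) (by rw [smul_smul, smul_smul, ← add_smul]; ring_nf; simp)
  exact h0 this.1

theorem not_isCrossingParam (h : MeetsBandInStrands D φ) {k : Fin D.n} {t s : ℝ} {i : Fin 3}
    (hs : s ∈ Set.Ioo (-1 : ℝ) 1) (ht : D.curve k t = φ (s, strandLevel i)) :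
    ¬ D.IsCrossingParam k t := by
  rintro ⟨l, u, h1, h2⟩
  exact h2 (h.sameParam hs ht (h1.symm.trans ht))

/-- The parameters at which the `k`-th circle is in the `i`-th strand. -/
def strandSet (D : AnnularDiagram) (φ : ℝ × ℝ → Cyl) (k : Fin D.n) (i : Fin 3) : Set ℝ :=
  {t | ∃ s ∈ Set.Ioo (-1 : ℝ) 1, D.curve k t = φ (s, strandLevel i)}

open Classical in
/-- The band parameter `s` of a parameter in the `i`-th strand. -/
def strandParam (D : AnnularDiagram) (φ : ℝ × ℝ → Cyl) (k : Fin D.n) (i : Fin 3) (t : ℝ) : ℝ :=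
  if h : t ∈ strandSet D φ k i then h.choose else 0

theorem strandParam_mem {k : Fin D.n} {i : Fin 3} {t : ℝ} (ht : t ∈ strandSet D φ k i) :
    strandParam D φ k i t ∈ Set.Ioo (-1 : ℝ) 1 := by
  rw [strandParam, dif_pos ht]
  exact ht.choose_spec.1

theorem curve_strandParam {k : Fin D.n} {i : Fin 3} {t : ℝ} (ht : t ∈ strandSet D φ k i) :
    D.curve k t = φ (strandParam D φ k i t, strandLevel i) := by
  rw [strandParam, dif_pos ht]
  exact ht.choose_spec.2

theorem strandParam_eq (h : MeetsBandInStrands D φ) {k : Fin D.n} {i : Fin 3} {s t : ℝ}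
    (hs : s ∈ Set.Ioo (-1 : ℝ) 1) (ht : D.curve k t = φ (s, strandLevel i)) :
    strandParam D φ k i t = s :=
  have hm : t ∈ strandSet D φ k i := ⟨s, hs, ht⟩
  (h.unique (strandParam_mem hm) hs ((curve_strandParam hm).symm.trans ht)).1

theorem isOpen_strandSet (h : MeetsBandInStrands D φ) (k : Fin D.n) (i : Fin 3) :
    IsOpen (strandSet D φ k i) := by
  rw [isOpen_iff_mem_nhds]
  rintro t ⟨s, hs, ht⟩
  obtain ⟨σ, -, -, h3⟩ := h.exists_local_param hs ht
  filter_upwards [h3] with t' ht'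
  exact ⟨σ t', ht'⟩

theorem contDiffOn_strandParam (h : MeetsBandInStrands D φ) (k : Fin D.n) (i : Fin 3) :
    ContDiffOn ℝ ∞ (strandParam D φ k i) (strandSet D φ k i) := by
  rintro t ⟨s, hs, ht⟩
  obtain ⟨σ, h1, -, h3⟩ := h.exists_local_param hs ht
  exact (h1.congr_of_eventuallyEq (h3.mono fun t' ht' =>
    h.strandParam_eq ht'.1 ht'.2)).contDiffWithinAt

/-- The parameters in the part `|s| ≤ r` of the band. -/
def coreSet (D : AnnularDiagram) (φ : ℝ × ℝ → Cyl) (r : ℝ) (k : Fin D.n) : Set ℝ :=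
  {t | ∃ i, ∃ s ∈ Set.Icc (-r) r, D.curve k t = φ (s, strandLevel i)}

theorem isClosed_coreSet (h : MeetsBandInStrands D φ) {r : ℝ} (hr : r < 1) (k : Fin D.n) :
    IsClosed (coreSet D φ r k) := by
  have hφ : ContinuousOn φ strip := by
    rw [Cyl.isEmbedding_coe.continuousOn_iff]
    exact h.isBand.smooth.continuousOn
  have hK : IsCompact (φ '' (Set.Icc (-r) r ×ˢ Set.range strandLevel)) := by
    refine (isCompact_Icc.prod (Set.finite_range _).isCompact).image_of_continuousOn
      (hφ.mono ?_)
    rintro ⟨s, x⟩ ⟨h1, ⟨i, hi⟩⟩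
    simp only at hi h1
    rw [← hi]
    exact mk_strandLevel_mem_strip ⟨by linarith [h1.1], by linarith [h1.2]⟩ i
  have : coreSet D φ r k = D.curve k ⁻¹' (φ '' (Set.Icc (-r) r ×ˢ Set.range strandLevel)) := by
    ext t
    constructor
    · rintro ⟨i, s, hs, h1⟩
      exact ⟨(s, strandLevel i), ⟨hs, i, rfl⟩, h1.symm⟩
    · rintro ⟨⟨s, x⟩, ⟨hs, i, hi⟩, h1⟩
      simp only at hi
      exact ⟨i, s, hs, by rw [hi]; exact h1.symm⟩
  rw [this]
  exact hK.isClosed.preimage (D.continuous_curve k)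

open Classical in
/-- The link that replaces the strands over the part `|s| ≤ 3/4` of the band by the braid `g` in
`(-1,1) × S²`, in the double of the band, and that agrees with a lift of the diagram elsewhere. -/
def glue (D : AnnularDiagram) (φ : ℝ × ℝ → Cyl) (H : D.Height) (g : Fin 3 → ℝ → S2) (k : Fin D.n)
    (t : ℝ) : S1S2 :=
  if h : t ∈ coreSet D φ (3 / 4) k then bandDouble φ h.choose_spec.choose
    (g h.choose h.choose_spec.choose) else D.lift H k t

theorem glue_of_mem (h : MeetsBandInStrands D φ) {H : D.Height} {g : Fin 3 → ℝ → S2} {k : Fin D.n}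
    {t s : ℝ} {i : Fin 3} (hs : s ∈ Set.Icc (-(3 / 4) : ℝ) (3 / 4))
    (ht : D.curve k t = φ (s, strandLevel i)) : glue D φ H g k t = bandDouble φ s (g i s) := by
  have hm : t ∈ coreSet D φ (3 / 4) k := ⟨i, s, hs, ht⟩
  rw [glue, dif_pos hm]
  have h1 := hm.choose_spec.choose_spec
  have hI : ∀ {s : ℝ}, s ∈ Set.Icc (-(3 / 4) : ℝ) (3 / 4) → s ∈ Set.Ioo (-1 : ℝ) 1 := fun hs =>
    ⟨by linarith [hs.1], by linarith [hs.2]⟩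
  obtain ⟨e1, e2⟩ := h.unique (hI h1.1) (hI hs) (h1.2.symm.trans ht)
  rw [e1, e2]

theorem glue_of_notMem {H : D.Height} {g : Fin 3 → ℝ → S2} {k : Fin D.n} {t : ℝ}
    (ht : t ∉ coreSet D φ (3 / 4) k) : glue D φ H g k t = D.lift H k t := dif_neg ht

theorem lift_eq_bandDouble (h : MeetsBandInStrands D φ) {H : D.Height} {k : Fin D.n}
    {t s : ℝ} {i : Fin 3} (hs : s ∈ Set.Ioo (-1 : ℝ) 1) (ht : D.curve k t = φ (s, strandLevel i))
    (hH : H.h k t = 0) : D.lift H k t = bandDouble φ s (basePoint i) := by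
  have hX : (φ (s, strandLevel i)).2 ^ 2 + 0 ^ 2 ≤ 1 := by
    have := (H.mem_disk k t).le
    rwa [hH, ht] at this
  rw [basePoint, h.isBand.bandDouble_hemi_zero hs _ hX]
  simp only [AnnularDiagram.lift, ht, hH]

/-- Where the braid is trivial, the glued link is the lift of the diagram. -/
theorem glue_eq_lift (h : MeetsBandInStrands D φ) {H : D.Height} {g : Fin 3 → ℝ → S2} {k : Fin D.n}
    {t : ℝ} (hH : ∀ t ∈ coreSet D φ (3 / 4) k, H.h k t = 0)
    (hg : ∀ i s, 2 / 3 ≤ |s| → g i s = basePoint i) (ht : t ∉ coreSet D φ (2 / 3) k) :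
    glue D φ H g k t = D.lift H k t := by
  by_cases hm : t ∈ coreSet D φ (3 / 4) k
  · obtain ⟨i, s, hs, h1⟩ := hm
    have hlt : 2 / 3 ≤ |s| := by
      by_contra hcon
      exact ht ⟨i, s, abs_le.1 (not_le.1 hcon).le, h1⟩
    rw [h.glue_of_mem hs h1, hg i s hlt, h.lift_eq_bandDouble ⟨by linarith [hs.1],
      by linarith [hs.2]⟩ h1 (hH t ⟨i, s, hs, h1⟩)]
  · exact glue_of_notMem hm

theorem glue_injective (h : MeetsBandInStrands D φ) {H : D.Height} {g : Fin 3 → ℝ → S2}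
    (hg : ∀ i j s, i ≠ j → g i s ≠ g j s) (k : Fin D.n) (t : ℝ) (l : Fin D.n) (u : ℝ)
    (heq : glue D φ H g k t = glue D φ H g l u) : SameParam k t l u := by
  have hI : ∀ {s : ℝ}, s ∈ Set.Icc (-(3 / 4) : ℝ) (3 / 4) → s ∈ Set.Ioo (-1 : ℝ) 1 := fun hs =>
    ⟨by linarith [hs.1], by linarith [hs.2]⟩
  -- a point in the core and a point outside of it have different projections to the annulus
  have key : ∀ k t l u, t ∈ coreSet D φ (3 / 4) k → u ∉ coreSet D φ (3 / 4) l →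
      glue D φ H g k t ≠ glue D φ H g l u := by
    rintro k t l u ⟨i, s, hs, ht⟩ hu heq
    rw [h.glue_of_mem hs ht, glue_of_notMem hu] at heq
    have h1 := congrArg toCyl heq
    rw [h.isBand.toCyl_bandDouble (hI hs), AnnularDiagram.toCyl_lift] at h1
    have hp : (s, (g i s).1 0) ∈ strip := ⟨hI hs, S2_abs_le_one _⟩
    obtain ⟨j, s', hs', hj⟩ := h.strands l u ⟨_, hp, h1⟩
    have h2 := h.isBand.injOn hp (mk_strandLevel_mem_strip hs' j) (h1.trans hj)
    have h3 : s = s' := (Prod.ext_iff.1 h2).1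
    exact hu ⟨j, s, hs, by rw [h3]; exact hj⟩
  by_cases ht : t ∈ coreSet D φ (3 / 4) k
  · by_cases hu : u ∈ coreSet D φ (3 / 4) l
    · obtain ⟨i, s, hs, ht⟩ := ht
      obtain ⟨j, s', hs', hu⟩ := hu
      rw [h.glue_of_mem hs ht, h.glue_of_mem hs' hu] at heq
      obtain ⟨rfl, h2⟩ := h.isBand.bandDouble_injective (hI hs) (hI hs') heq
      have hij : i = j := by
        by_contra hne
        exact hg i j s hne h2
      subst hij
      exact h.sameParam (hI hs) ht hu
    · exact absurd heq (key _ _ _ _ ht hu)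
  · by_cases hu : u ∈ coreSet D φ (3 / 4) l
    · exact absurd heq.symm (key _ _ _ _ hu ht)
    · rw [glue_of_notMem ht, glue_of_notMem hu] at heq
      exact AnnularDiagram.lift_injective H _ _ _ _ heq

/-- A homotopy of braids in `(-1,1) × S²`, trivial at the ends and through braids, gives an isotopy of
the glued links. -/
theorem sameLink_glue (h : MeetsBandInStrands D φ) {H : D.Height}
    (hH : ∀ k, ∀ t ∈ coreSet D φ (3 / 4) k, H.h k t = 0)
    {G : Fin 3 → ℝ × ℝ → S2} (hGs : ∀ i, ContDiff ℝ ∞ fun p => (G i p).1)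
    (hGd : ∀ i j p, i ≠ j → G i p ≠ G j p)
    (hGb : ∀ i τ s, 2 / 3 ≤ |s| → G i (τ, s) = basePoint i) :
    SameLink (glue D φ H fun i s => G i (0, s)) (glue D φ H fun i s => G i (1, s)) := by
  let F : Fin D.n → ℝ × ℝ → S1S2 := fun k p => glue D φ H (fun i s => G i (p.1, s)) k p.2
  have hF : ∀ k p, p.2 ∉ coreSet D φ (2 / 3) k → F k p = D.lift H k p.2 := fun k p hp =>
    h.glue_eq_lift (hH k) (fun i s => hGb i p.1 s) hp
  have hcore : ∀ k t, t ∈ coreSet D φ (2 / 3) k → ∃ i, t ∈ strandSet D φ k i ∧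
      strandParam D φ k i t ∈ Set.Ioo (-(3 / 4) : ℝ) (3 / 4) := by
    rintro k t ⟨i, s, hs, ht⟩
    have hs' : s ∈ Set.Ioo (-1 : ℝ) 1 := ⟨by linarith [hs.1], by linarith [hs.2]⟩
    refine ⟨i, ⟨s, hs', ht⟩, ?_⟩
    rw [h.strandParam_eq hs' ht]
    constructor <;> linarith [hs.1, hs.2]
  have hnear : ∀ k i t, t ∈ strandSet D φ k i →
      strandParam D φ k i t ∈ Set.Ioo (-(3 / 4) : ℝ) (3 / 4) →
      ∀ᶠ t' in nhds t, t' ∈ strandSet D φ k i ∧ ∀ τ, F k (τ, t') =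
        bandDouble φ (strandParam D φ k i t') (G i (τ, strandParam D φ k i t')) := by
    intro k i t ht hs
    have hopen := (h.isOpen_strandSet k i).mem_nhds ht
    filter_upwards [hopen, ((h.contDiffOn_strandParam k i).continuousOn.continuousAt hopen)
      (isOpen_Ioo.mem_nhds hs)] with t' ht' hs'
    exact ⟨ht', fun τ => h.glue_of_mem (Set.Ioo_subset_Icc_self hs') (curve_strandParam ht')⟩
  have hsm : ∀ k, ContMDiff 𝓘(ℝ, ℝ × ℝ) modelS1S2 ∞ (F k) := by
    intro k
    have key : ∀ p : ℝ × ℝ, ContDiffAt ℝ ∞ (fun p => ((F k p).1 : ℂ)) p ∧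
        ContDiffAt ℝ ∞ (fun p => (F k p).2.1) p := by
      rintro ⟨τ, t⟩
      by_cases ht : t ∈ coreSet D φ (2 / 3) k
      · obtain ⟨i, hi, hs⟩ := hcore k t ht
        have hS : IsOpen (Set.univ ×ˢ strandSet D φ k i : Set (ℝ × ℝ)) :=
          isOpen_univ.prod (h.isOpen_strandSet k i)
        have hσ : ContDiffOn ℝ ∞ (fun p : ℝ × ℝ => strandParam D φ k i p.2)
            (Set.univ ×ˢ strandSet D φ k i) :=
          (h.contDiffOn_strandParam k i).comp contDiff_snd.contDiffOn fun p hp => hp.2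
        have hG : ContDiffOn ℝ ∞ (fun p : ℝ × ℝ => (G i (p.1, strandParam D φ k i p.2)).1)
            (Set.univ ×ˢ strandSet D φ k i) :=
          (hGs i).comp_contDiffOn (contDiff_fst.contDiffOn.prodMk hσ)
        obtain ⟨c1, c2⟩ := h.isBand.contDiffOn_bandDouble hS hσ
          (fun p hp => strandParam_mem hp.2) hG
        have hmem := hS.mem_nhds (show ((τ, t) : ℝ × ℝ) ∈ _ from ⟨trivial, hi⟩)
        have hev : ∀ᶠ p : ℝ × ℝ in nhds (τ, t), F k p = bandDouble φ (strandParam D φ k i p.2)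
            (G i (p.1, strandParam D φ k i p.2)) :=
          (continuous_snd.continuousAt.eventually (hnear k i t hi hs)).mono
            fun p hp => hp.2 p.1
        exact ⟨(c1.contDiffAt hmem).congr_of_eventuallyEq
            (hev.mono fun p hp => by simp only [hp]),
          (c2.contDiffAt hmem).congr_of_eventuallyEq (hev.mono fun p hp => by simp only [hp])⟩
      · have hopen' : ∀ᶠ t' in nhds t, t' ∉ coreSet D φ (2 / 3) k :=
          (h.isClosed_coreSet (by norm_num) k).isOpen_compl.mem_nhds ht
        have hopen : ∀ᶠ p : ℝ × ℝ in nhds (τ, t), p.2 ∉ coreSet D φ (2 / 3) k :=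
          (continuous_snd.tendsto ((τ, t) : ℝ × ℝ)).eventually hopen'
        obtain ⟨c1, c2⟩ := contMDiff_S1S2_iff.1
          (((AnnularDiagram.isSmoothLink_lift H).smooth k).comp
            (contDiff_snd (𝕜 := ℝ) (E := ℝ) (F := ℝ) (n := ∞)).contMDiff)
        exact ⟨c1.contDiffAt.congr_of_eventuallyEq
            (hopen.mono fun p hp => by simp only [hF k p hp, Function.comp_apply]),
          c2.contDiffAt.congr_of_eventuallyEq
            (hopen.mono fun p hp => by simp only [hF k p hp, Function.comp_apply])⟩
    exact contMDiff_S1S2_iff.2 ⟨contDiff_iff_contDiffAt.2 fun p => (key p).1,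
      contDiff_iff_contDiffAt.2 fun p => (key p).2⟩
  have hsm' : ∀ k τ, ContMDiff 𝓘(ℝ, ℝ) modelS1S2 ∞ (fun t => F k (τ, t)) := fun k τ =>
    (hsm k).comp (contDiff_const.prodMk contDiff_id).contMDiff
  refine ⟨F, Equiv.refl _, fun _ t => t, hsm, fun τ _ => ⟨fun k => hsm' k τ, fun k t => ?_,
    fun k t => injective_mfderiv_of_toCyl (hsm' k τ) ?_,
    h.glue_injective fun i j s => hGd i j (τ, s)⟩, IsReparam.refl, fun _ _ => rfl, fun _ _ => rfl⟩
  · have hcs : t + 1 ∈ coreSet D φ (3 / 4) k ↔ t ∈ coreSet D φ (3 / 4) k := by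
      simp only [coreSet, Set.mem_ofPred_eq, D.periodic k t]
    simp only [F]
    by_cases ht : t ∈ coreSet D φ (3 / 4) k
    · obtain ⟨i, s, hs, h1⟩ := ht
      rw [h.glue_of_mem hs h1, h.glue_of_mem hs ((D.periodic k t).trans h1)]
    · rw [glue_of_notMem ht, glue_of_notMem (hcs.not.2 ht)]
      exact (AnnularDiagram.isSmoothLink_lift H).periodic k t
  · by_cases ht : t ∈ coreSet D φ (2 / 3) k
    · obtain ⟨i, hi, hs⟩ := hcore k t ht
      have hopen := (h.isOpen_strandSet k i).mem_nhds hi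
      have hσ : DifferentiableAt ℝ (strandParam D φ k i) t :=
        ((h.contDiffOn_strandParam k i).contDiffAt hopen).differentiableAt (by simp)
      have hσ0 := h.deriv_param_ne_zero hσ (Filter.mem_of_superset hopen fun t' ht' =>
        ⟨strandParam_mem ht', curve_strandParam ht'⟩)
      have hx : DifferentiableAt ℝ (fun t' => (G i (τ, strandParam D φ k i t')).1 0) t := by
        have e1 : DifferentiableAt ℝ (fun p => (G i p).1) (τ, strandParam D φ k i t) :=
          (hGs i).differentiable (by simp) _
        have e2 : DifferentiableAt ℝ (fun t' => (τ, strandParam D φ k i t')) t :=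
          (differentiableAt_const τ).prodMk hσ
        have e3 : Differentiable ℝ (fun v : EuclideanSpace ℝ (Fin 3) => v 0) := by fun_prop
        exact (e3 _).comp t (DifferentiableAt.comp (g := fun p => (G i p).1) t e1 e2)
      have e4 := h.hasDerivAt_comp hσ.hasDerivAt hx.hasDerivAt
        (Filter.mem_of_superset hopen fun t' ht' => ⟨strandParam_mem ht', S2_abs_le_one _⟩)
      have hev : (fun t' => (toCyl (F k (τ, t'))).coe) =ᶠ[nhds t] fun t' =>
          (φ (strandParam D φ k i t', (G i (τ, strandParam D φ k i t')).1 0)).coe := by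
        filter_upwards [hnear k i t hi hs] with t' ht'
        rw [ht'.2 τ, h.isBand.toCyl_bandDouble (strandParam_mem ht'.1)]
      rw [hev.deriv_eq, e4.deriv]
      exact h.isBand.fderivWithin_ne_zero ⟨strandParam_mem hi, S2_abs_le_one _⟩
        (fun hz => hσ0 (congrArg Prod.fst hz))
    · have hev : (fun t' => (toCyl (F k (τ, t'))).coe) =ᶠ[nhds t] fun t' => (D.curve k t').coe := by
        filter_upwards [(h.isClosed_coreSet (by norm_num) k).isOpen_compl.mem_nhds ht] with t' ht'
        rw [hF k (τ, t') ht']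
        rfl
      rw [hev.deriv_eq]
      exact D.immersion k t

end MeetsBandInStrands

/-! ### Trivializing the braid `σ₁² σ₂⁻²` in `(-1,1) × S²` -/

/-- The direction of a nonzero vector. -/
def dir (v : EuclideanSpace ℝ (Fin 3)) : S2 := toS2 (‖v‖⁻¹ • v)

theorem coe_dir {v : EuclideanSpace ℝ (Fin 3)} (hv : v ≠ 0) : (dir v).1 = ‖v‖⁻¹ • v :=
  coe_toS2 (by rw [mem_sphere_zero_iff_norm, norm_smul, norm_inv, norm_norm,
    inv_mul_cancel₀ (norm_ne_zero_iff.2 hv)])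

theorem dir_coe (p : S2) : dir p.1 = p := by
  have h : ‖p.1‖ = 1 := mem_sphere_zero_iff_norm.1 p.2
  have h0 : p.1 ≠ 0 := fun h0 => by rw [h0, norm_zero] at h; exact zero_ne_one h
  exact Subtype.ext (by rw [coe_dir h0, h, inv_one, one_smul])

theorem eq_smul_of_dir_eq {v w : EuclideanSpace ℝ (Fin 3)} (hv : v ≠ 0) (hw : w ≠ 0)
    (h : dir v = dir w) : ∃ c > (0 : ℝ), v = c • w := by
  have h1 := congrArg Subtype.val h
  rw [coe_dir hv, coe_dir hw] at h1
  have hv' := norm_pos_iff.2 hv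
  have hw' := norm_pos_iff.2 hw
  refine ⟨‖v‖ * ‖w‖⁻¹, by positivity, ?_⟩
  rw [mul_smul, ← h1, smul_smul, mul_inv_cancel₀ hv'.ne', one_smul]

namespace MeetsBandInStrands
variable {D : AnnularDiagram} {φ : ℝ × ℝ → Cyl}

/-- A homotopy of braids in `(-1,1) × S²`, given by nonzero vectors with different directions. -/
theorem sameLink_glue_dir (h : MeetsBandInStrands D φ) {H : D.Height}
    (hH : ∀ k, ∀ t ∈ coreSet D φ (3 / 4) k, H.h k t = 0)
    {w : Fin 3 → ℝ × ℝ → EuclideanSpace ℝ (Fin 3)} (hws : ∀ i, ContDiff ℝ ∞ (w i))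
    (hw0 : ∀ i, ∀ τ ∈ Set.Icc (0 : ℝ) 1, ∀ s, w i (τ, s) ≠ 0)
    (hwd : ∀ i j, ∀ τ ∈ Set.Icc (0 : ℝ) 1, ∀ s, i < j → ∀ c > (0 : ℝ), w i (τ, s) ≠ c • w j (τ, s))
    (hwb : ∀ i, ∀ τ ∈ Set.Icc (0 : ℝ) 1, ∀ s, 2 / 3 ≤ |s| → w i (τ, s) = (basePoint i).1) :
    SameLink (glue D φ H fun i s => dir (w i (0, s))) (glue D φ H fun i s => dir (w i (1, s))) := by
  let σ := Real.smoothTransition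
  have hσ : ∀ x, σ x ∈ Set.Icc (0 : ℝ) 1 := fun x =>
    ⟨Real.smoothTransition.nonneg x, Real.smoothTransition.le_one x⟩
  have hσs : ContDiff ℝ ∞ σ := Real.smoothTransition.contDiff
  have h0 : σ 0 = 0 := Real.smoothTransition.zero
  have h1 : σ 1 = 1 := Real.smoothTransition.one
  have key := h.sameLink_glue hH (G := fun i p => dir (w i (σ p.1, p.2))) (fun i => ?_)
    (fun i j p hij heq => ?_) (fun i τ s hs => ?_)
  · simpa only [h0, h1] using key
  · have e1 : ContDiff ℝ ∞ (fun p : ℝ × ℝ => w i (σ p.1, p.2)) :=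
      (hws i).comp ((hσs.comp contDiff_fst).prodMk contDiff_snd)
    have e2 : (fun p : ℝ × ℝ => (dir (w i (σ p.1, p.2))).1) =
        fun p : ℝ × ℝ => ‖w i (σ p.1, p.2)‖⁻¹ • w i (σ p.1, p.2) :=
      funext fun p => coe_dir (hw0 i _ (hσ _) _)
    rw [e2]
    exact ((e1.norm ℝ fun p => hw0 i _ (hσ _) _).inv
      fun p => norm_ne_zero_iff.2 (hw0 i _ (hσ _) _)).smul e1
  · rcases lt_or_gt_of_ne hij with hlt | hlt
    · obtain ⟨c, hc, h2⟩ := eq_smul_of_dir_eq (hw0 i _ (hσ _) _) (hw0 j _ (hσ _) _) heq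
      exact hwd i j _ (hσ _) _ hlt c hc h2
    · obtain ⟨c, hc, h2⟩ := eq_smul_of_dir_eq (hw0 j _ (hσ _) _) (hw0 i _ (hσ _) _) heq.symm
      exact hwd j i _ (hσ _) _ hlt c hc h2
  · simp only [hwb i _ (hσ τ) s hs, dir_coe]

theorem glue_basePoint (h : MeetsBandInStrands D φ) {H : D.Height}
    (hH : ∀ k, ∀ t ∈ coreSet D φ (3 / 4) k, H.h k t = 0) :
    (glue D φ H fun i _ => basePoint i) = D.lift H := by
  funext k t
  by_cases hm : t ∈ coreSet D φ (3 / 4) k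
  · have hm' := hm
    obtain ⟨i, s, hs, h1⟩ := hm
    rw [h.glue_of_mem hs h1, h.lift_eq_bandDouble ⟨by linarith [hs.1],
      by linarith [hs.2]⟩ h1 (hH k t hm')]
  · exact glue_of_notMem hm

end MeetsBandInStrands

theorem contDiff_twistAngle₁ : ContDiff ℝ ∞ twistAngle₁ :=
  contDiff_const.mul (Real.smoothTransition.contDiff.comp
    ((contDiff_const.mul contDiff_id).add contDiff_const))

theorem contDiff_twistAngle₂ : ContDiff ℝ ∞ twistAngle₂ :=
  contDiff_const.mul (Real.smoothTransition.contDiff.comp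
    ((contDiff_const.mul contDiff_id).sub contDiff_const))

theorem twistAngle₁_of_ge {s : ℝ} (hs : -1 / 3 ≤ s) : twistAngle₁ s = 2 * Real.pi := by
  rw [twistAngle₁, Real.smoothTransition.one_of_one_le (by linarith), mul_one]

theorem twistAngle₁_of_le {s : ℝ} (hs : s ≤ -2 / 3) : twistAngle₁ s = 0 := by
  rw [twistAngle₁, Real.smoothTransition.zero_of_nonpos (by linarith), mul_zero]

theorem twistAngle₂_of_ge {s : ℝ} (hs : 2 / 3 ≤ s) : twistAngle₂ s = 2 * Real.pi := by
  rw [twistAngle₂, Real.smoothTransition.one_of_one_le (by linarith), mul_one]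

theorem twistAngle₂_of_le {s : ℝ} (hs : s ≤ 1 / 3) : twistAngle₂ s = 0 := by
  rw [twistAngle₂, Real.smoothTransition.zero_of_nonpos (by linarith), mul_zero]

/-- The two twists happen one after the other. -/
theorem twistAngle_cases (s : ℝ) : twistAngle₂ s = 0 ∨ twistAngle₁ s = 2 * Real.pi :=
  (le_total s 0).imp (fun h => twistAngle₂_of_le (by linarith))
    (fun h => twistAngle₁_of_ge (by linarith))

theorem twistAngle_ends {s : ℝ} (hs : 2 / 3 ≤ |s|) :
    (twistAngle₁ s = 0 ∧ twistAngle₂ s = 0) ∨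
      (twistAngle₁ s = 2 * Real.pi ∧ twistAngle₂ s = 2 * Real.pi) := by
  rcases le_abs.1 hs with h | h
  · exact Or.inr ⟨twistAngle₁_of_ge (by linarith), twistAngle₂_of_ge h⟩
  · exact Or.inl ⟨twistAngle₁_of_le (by linarith), twistAngle₂_of_le (by linarith)⟩

theorem twisted_sq_lt (i : Fin 3) (s : ℝ) : twistedStrand i s ^ 2 + twistedHeight i s ^ 2 < 1 := by
  have h1 := Real.sin_sq_add_cos_sq (twistAngle₁ s)
  have h2 := Real.sin_sq_add_cos_sq (twistAngle₂ s)
  have a1 := Real.cos_le_one (twistAngle₁ s)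
  have a2 := Real.cos_le_one (twistAngle₂ s)
  simp only [twistedStrand, twistedHeight]
  generalize Real.cos (twistAngle₁ s) = A at *
  generalize Real.cos (twistAngle₂ s) = B at *
  generalize Real.sin (twistAngle₁ s) = S at *
  generalize Real.sin (twistAngle₂ s) = Q at *
  fin_cases i
  · simp; nlinarith
  · simp; nlinarith [sq_nonneg (A + B), sq_nonneg (S - Q)]
  · simp; nlinarith

/-- The braid `σ₁² σ₂⁻²` in the lower hemisphere, as vectors. -/
def twistedVec (i : Fin 3) (s : ℝ) : EuclideanSpace ℝ (Fin 3) :=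
  !₂[twistedStrand i s, twistedHeight i s, -√(1 - twistedStrand i s ^ 2 - twistedHeight i s ^ 2)]

theorem contDiff_twistedStrand (i : Fin 3) : ContDiff ℝ ∞ (twistedStrand i) := by
  have hA := Real.contDiff_cos.comp contDiff_twistAngle₁
  have hB := Real.contDiff_cos.comp contDiff_twistAngle₂
  fin_cases i
  · exact contDiff_const.sub (hA.div_const 4)
  · exact (hA.sub hB).div_const 4
  · exact contDiff_const.add (hB.div_const 4)

theorem contDiff_twistedHeight (i : Fin 3) : ContDiff ℝ ∞ (twistedHeight i) := by
  have hA := Real.contDiff_sin.comp contDiff_twistAngle₁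
  have hB := Real.contDiff_sin.comp contDiff_twistAngle₂
  fin_cases i
  · exact hA.neg.div_const 4
  · exact (hA.add hB).div_const 4
  · exact hB.neg.div_const 4

theorem contDiff_twistedVec (i : Fin 3) : ContDiff ℝ ∞ (twistedVec i) := by
  have h1 := contDiff_twistedStrand i
  have h2 := contDiff_twistedHeight i
  refine contDiff_E3 h1 h2 (ContDiff.neg (ContDiff.sqrt
    ((contDiff_const.sub (h1.pow 2)).sub (h2.pow 2)) fun s => ?_))
  have := twisted_sq_lt i s
  exact ne_of_gt (by linarith)

theorem twisted_of_ends (i : Fin 3) {s : ℝ} (hs : 2 / 3 ≤ |s|) :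
    twistedStrand i s = strandLevel i ∧ twistedHeight i s = 0 := by
  rcases twistAngle_ends hs with ⟨h1, h2⟩ | ⟨h1, h2⟩ <;>
    fin_cases i <;>
    norm_num [twistedStrand, twistedHeight, h1, h2, strandLevel, parallelStrand]

theorem twistedVec_of_ends (i : Fin 3) {s : ℝ} (hs : 2 / 3 ≤ |s|) :
    twistedVec i s = (basePoint i).1 := by
  rw [twistedVec, (twisted_of_ends i hs).1, (twisted_of_ends i hs).2]
  rfl

theorem dir_twistedVec_coe (i : Fin 3) (s : ℝ) : (dir (twistedVec i s)).1 = twistedVec i s := by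
  have h := twisted_sq_lt i s
  have hm : twistedVec i s ∈ Metric.sphere (0 : EuclideanSpace ℝ (Fin 3)) 1 :=
    mem_S2_of_sum_sq (by rw [neg_sq, Real.sq_sqrt (by linarith)]; ring)
  exact congrArg Subtype.val (dir_coe ⟨twistedVec i s, hm⟩)

theorem eq_E3_iff {v w : EuclideanSpace ℝ (Fin 3)} :
    v = w ↔ v 0 = w 0 ∧ v 1 = w 1 ∧ v 2 = w 2 := by
  constructor
  · rintro rfl
    exact ⟨rfl, rfl, rfl⟩
  · rintro ⟨h0, h1, h2⟩
    ext i
    fin_cases i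
    exacts [h0, h1, h2]

/-- The braid in which the middle strand turns twice about the first axis, and the two other strands
stand still. -/
def spinVec (i : Fin 3) (s : ℝ) : EuclideanSpace ℝ (Fin 3) :=
  ![(basePoint 0).1,
    !₂[0, Real.sin (twistAngle₁ s + twistAngle₂ s), -Real.cos (twistAngle₁ s + twistAngle₂ s)],
    (basePoint 2).1] i

theorem contDiff_spinVec (i : Fin 3) : ContDiff ℝ ∞ (spinVec i) := by
  have h := contDiff_twistAngle₁.add contDiff_twistAngle₂
  fin_cases i
  · exact contDiff_const
  · exact contDiff_E3 contDiff_const (Real.contDiff_sin.comp h) (Real.contDiff_cos.comp h).neg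
  · exact contDiff_const

theorem sin_cos_twist_ends {s : ℝ} (hs : 2 / 3 ≤ |s|) :
    Real.sin (twistAngle₁ s + twistAngle₂ s) = 0 ∧ Real.cos (twistAngle₁ s + twistAngle₂ s) = 1 := by
  rcases twistAngle_ends hs with ⟨h1, h2⟩ | ⟨h1, h2⟩
  · simp [h1, h2]
  · rw [h1, h2]
    simp

theorem basePoint_coords (i : Fin 3) : (basePoint i).1 0 = strandLevel i ∧ (basePoint i).1 1 = 0 ∧
    (basePoint i).1 2 = -√(1 - strandLevel i ^ 2) := by
  refine ⟨rfl, rfl, ?_⟩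
  simp [basePoint, hemi]

theorem spinVec_of_ends (i : Fin 3) {s : ℝ} (hs : 2 / 3 ≤ |s|) :
    spinVec i s = (basePoint i).1 := by
  obtain ⟨h1, h2⟩ := sin_cos_twist_ends hs
  fin_cases i
  · rfl
  · rw [eq_E3_iff]
    obtain ⟨a, b, c⟩ := basePoint_coords 1
    simp only [Fin.mk_one]
    rw [a, b, c]
    simp [spinVec, h1, h2, strandLevel, parallelStrand]
  · rfl

/-- The two strands that turn about each other stay apart when they are moved linearly, one to its
initial position, the other to a turn about the first axis. The vectors are
`(-(1 + A)/4, -S/4, -t₀)` and `((A - 1)/4, S/4, -t₁)`, moved to `(-1/2, 0, -√(3/4))` and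
`(0, S, -A)`, for `A = cos a`, `S = sin a`. -/
theorem spin_apart {A S l τ μ t₀ t₁ : ℝ} (hAS : S ^ 2 + A ^ 2 = 1) (hl : 0 ≤ l) (hτ : 0 ≤ τ)
    (hlτ : l + τ = 1) (hμ : 0 < μ) (ht₀ : A = -1 → t₀ = 1) (ht₁ : A = -1 → t₁ = √(3 / 4))
    (hx : -(l * (1 + A) / 4) - τ / 2 = μ * (l * (A - 1) / 4))
    (hy : -(l * S / 4) = μ * ((l / 4 + τ) * S))
    (hz : -(l * t₀) - τ * √(3 / 4) = μ * (-(l * t₁) - τ * A)) : False := by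
  have hpos : 0 < l / 4 + μ * (l / 4 + τ) := by
    have : 0 < l / 4 + τ := by linarith
    positivity
  have hS : S = 0 := by
    have : (l / 4 + μ * (l / 4 + τ)) * S = 0 := by linarith
    exact (mul_eq_zero.1 this).resolve_left hpos.ne'
  have hA : A = 1 ∨ A = -1 := by
    rw [hS] at hAS
    exact sq_eq_one_iff.1 (by linarith)
  rcases hA with rfl | rfl
  · linarith
  · rw [ht₀ rfl, ht₁ rfl] at hz
    have h1 : τ = μ * l := by linarith
    have h2 : l = -(μ * τ) := by
      linear_combination -hz - √(3 / 4) * h1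
    have h3 : 0 ≤ μ * τ := by positivity
    have h4 : l = 0 := by linarith
    rw [h4] at h1 hlτ
    linarith

theorem spin_ne_zero {A S l τ t₁ : ℝ} (hAS : S ^ 2 + A ^ 2 = 1) (hl : 0 ≤ l) (hτ : 0 ≤ τ)
    (hlτ : l + τ = 1) (ht₁ : 0 < t₁) (hx : l * (A - 1) / 4 = 0) (hy : (l / 4 + τ) * S = 0)
    (hz : -(l * t₁) - τ * A = 0) : False := by
  have hS : S = 0 := (mul_eq_zero.1 hy).resolve_left (by linarith)
  rw [hS] at hAS
  rcases sq_eq_one_iff.1 (show A ^ 2 = 1 by linarith) with rfl | rfl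
  · have := mul_nonneg hl ht₁.le
    have h1 : τ = 0 := by linarith
    have h2 : l * t₁ = 0 := by linarith
    have := (mul_eq_zero.1 h2).resolve_right ht₁.ne'
    linarith
  · have h1 : l = 0 := by linarith
    rw [h1] at hz hlτ
    linarith

/-- The straight line homotopy from `σ₁² σ₂⁻²` to the spinning middle strand. -/
def straighten (i : Fin 3) (p : ℝ × ℝ) : EuclideanSpace ℝ (Fin 3) :=
  (1 - p.1) • twistedVec i p.2 + p.1 • spinVec i p.2

/-- The depth of a strand of the braid in the lower hemisphere. -/
def twistedDepth (i : Fin 3) (s : ℝ) : ℝ := √(1 - twistedStrand i s ^ 2 - twistedHeight i s ^ 2)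

theorem twistedDepth_pos (i : Fin 3) (s : ℝ) : 0 < twistedDepth i s :=
  Real.sqrt_pos.2 (by linarith [twisted_sq_lt i s])

theorem straighten_zero (τ s : ℝ) : straighten 0 (τ, s) =
    !₂[-((1 - τ) * (1 + Real.cos (twistAngle₁ s)) / 4) - τ / 2,
      -((1 - τ) * Real.sin (twistAngle₁ s) / 4),
      -((1 - τ) * twistedDepth 0 s) - τ * √(3 / 4)] := by
  have h : (1 : ℝ) - strandLevel 0 ^ 2 = 3 / 4 := by norm_num [strandLevel, parallelStrand]
  obtain ⟨a, b, c⟩ := basePoint_coords 0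
  rw [h] at c
  rw [eq_E3_iff]
  simp only [straighten, spinVec, twistedDepth, PiLp.add_apply, PiLp.smul_apply, twistedVec,
    Matrix.cons_val_zero, a, b, c, smul_eq_mul]
  refine ⟨?_, ?_, ?_⟩
  · simp [twistedStrand, strandLevel, parallelStrand]; ring
  · simp [twistedHeight]; ring
  · simp; ring

theorem straighten_two (τ s : ℝ) : straighten 2 (τ, s) =
    !₂[(1 - τ) * (1 + Real.cos (twistAngle₂ s)) / 4 + τ / 2,
      -((1 - τ) * Real.sin (twistAngle₂ s) / 4),
      -((1 - τ) * twistedDepth 2 s) - τ * √(3 / 4)] := by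
  have hl : strandLevel 2 = 1 / 2 := rfl
  have h : (1 : ℝ) - strandLevel 2 ^ 2 = 3 / 4 := by norm_num [hl]
  obtain ⟨a, b, c⟩ := basePoint_coords 2
  rw [h] at c
  have h2 : spinVec 2 s = (basePoint 2).1 := rfl
  rw [eq_E3_iff]
  simp only [straighten, h2, twistedDepth, PiLp.add_apply, PiLp.smul_apply, twistedVec,
    a, b, c, smul_eq_mul, hl]
  refine ⟨?_, ?_, ?_⟩
  · simp [twistedStrand]; ring
  · simp [twistedHeight]; ring
  · simp; ring

theorem straighten_one (τ s : ℝ) : straighten 1 (τ, s) =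
    !₂[(1 - τ) * (Real.cos (twistAngle₁ s) - Real.cos (twistAngle₂ s)) / 4,
      (1 - τ) * (Real.sin (twistAngle₁ s) + Real.sin (twistAngle₂ s)) / 4 +
        τ * Real.sin (twistAngle₁ s + twistAngle₂ s),
      -((1 - τ) * twistedDepth 1 s) - τ * Real.cos (twistAngle₁ s + twistAngle₂ s)] := by
  have h2 : spinVec 1 s = !₂[0, Real.sin (twistAngle₁ s + twistAngle₂ s),
    -Real.cos (twistAngle₁ s + twistAngle₂ s)] := rfl
  rw [eq_E3_iff]
  simp only [straighten, h2, twistedDepth, PiLp.add_apply, PiLp.smul_apply, twistedVec, smul_eq_mul]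
  refine ⟨?_, ?_, ?_⟩
  · simp [twistedStrand]; ring
  · simp [twistedHeight]; ring
  · simp; ring

theorem ne_zero_of_coord {v : EuclideanSpace ℝ (Fin 3)} (i : Fin 3) (h : v i ≠ 0) : v ≠ 0 := by
  rintro rfl
  exact h rfl

theorem straighten_ne_zero (i : Fin 3) {τ : ℝ} (hτ : τ ∈ Set.Icc (0 : ℝ) 1) (s : ℝ) :
    straighten i (τ, s) ≠ 0 := by
  have hl : 0 ≤ 1 - τ := by linarith [hτ.2]
  have hz : ∀ t : ℝ, 0 < t → -((1 - τ) * t) - τ * √(3 / 4) ≠ 0 := by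
    intro t ht
    have h3 : 0 < √(3 / 4 : ℝ) := by positivity
    rcases hτ.1.eq_or_lt with h0 | h0
    · rw [← h0]; linarith
    · have := mul_nonneg hl ht.le
      have := mul_pos h0 h3
      linarith
  fin_cases i
  · refine ne_zero_of_coord 2 ?_
    simp only [Fin.zero_eta]
    rw [straighten_zero]
    exact hz _ (twistedDepth_pos 0 s)
  · intro h0
    simp only [Fin.mk_one] at h0
    rw [straighten_one, eq_E3_iff] at h0
    simp at h0
    obtain ⟨hx, hy, hz'⟩ := h0
    rcases twistAngle_cases s with h | h
    · rw [h] at hx hy hz'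
      simp at hx hy hz'
      refine spin_ne_zero (Real.sin_sq_add_cos_sq (twistAngle₁ s)) hl hτ.1 (by ring)
        (twistedDepth_pos 1 s) ?_ ?_ hz'
      · rcases hx with hx | hx <;> rw [hx] <;> ring
      · linarith
    · rw [h, add_comm (2 * Real.pi) (twistAngle₂ s), Real.sin_add_two_pi] at hy
      rw [h, add_comm (2 * Real.pi) (twistAngle₂ s), Real.cos_add_two_pi] at hz'
      rw [h] at hx
      simp at hx hy hz'
      refine spin_ne_zero (Real.sin_sq_add_cos_sq (twistAngle₂ s)) hl hτ.1 (by ring)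
        (twistedDepth_pos 1 s) ?_ ?_ hz'
      · rcases hx with hx | hx
        · rw [hx]; ring
        · linear_combination (-(1 - τ) / 4) * hx
      · linarith
  · refine ne_zero_of_coord 2 ?_
    simp only [Fin.reduceFinMk]
    rw [straighten_two]
    exact hz _ (twistedDepth_pos 2 s)

theorem straighten_apart {i j : Fin 3} (hij : i < j) {τ : ℝ} (hτ : τ ∈ Set.Icc (0 : ℝ) 1) (s : ℝ)
    {c : ℝ} (hc : 0 < c) : straighten i (τ, s) ≠ c • straighten j (τ, s) := by
  intro heq
  have hl : 0 ≤ 1 - τ := by linarith [hτ.2]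
  have hAS := Real.sin_sq_add_cos_sq (twistAngle₁ s)
  have hBQ := Real.sin_sq_add_cos_sq (twistAngle₂ s)
  have hA1 := Real.neg_one_le_cos (twistAngle₁ s)
  have hB1 := Real.neg_one_le_cos (twistAngle₂ s)
  have hA2 := Real.cos_le_one (twistAngle₁ s)
  have hB2 := Real.cos_le_one (twistAngle₂ s)
  have hcases : (i = 0 ∧ j = 1) ∨ (i = 0 ∧ j = 2) ∨ (i = 1 ∧ j = 2) := by
    fin_cases i <;> fin_cases j <;> simp_all
  rcases hcases with ⟨rfl, rfl⟩ | ⟨rfl, rfl⟩ | ⟨rfl, rfl⟩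
  · rw [straighten_zero, straighten_one, eq_E3_iff] at heq
    simp at heq
    obtain ⟨hx, hy, hz⟩ := heq
    have hk : √3 / √4 = √(3 / 4 : ℝ) := by simp
    rcases twistAngle_cases s with h | h
    · rw [h] at hx hy hz
      simp at hx hy hz
      rw [hk] at hz
      refine spin_apart hAS hl hτ.1 (by ring) hc (t₀ := twistedDepth 0 s) (t₁ := twistedDepth 1 s)
        (fun hA => ?_) (fun hA => ?_) (by linarith) (by linarith) hz
      · have hS : Real.sin (twistAngle₁ s) = 0 := by
          rw [hA] at hAS; exact pow_eq_zero_iff two_ne_zero |>.1 (by linarith)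
        simp [twistedDepth, twistedStrand, twistedHeight, hA, hS]
      · have hS : Real.sin (twistAngle₁ s) = 0 := by
          rw [hA] at hAS; exact pow_eq_zero_iff two_ne_zero |>.1 (by linarith)
        simp [twistedDepth, twistedStrand, twistedHeight, hA, hS, h]
        norm_num
    · rw [h] at hx
      simp at hx
      have : 0 ≤ c * ((1 - τ) * (1 - Real.cos (twistAngle₂ s)) / 4) := by
        have := mul_nonneg hl (sub_nonneg.2 hB2)
        positivity
      linarith
  · rw [straighten_zero, straighten_two, eq_E3_iff] at heq
    simp at heq
    have hx := heq.1
    have e1 := mul_nonneg hl (show 0 ≤ 1 + Real.cos (twistAngle₁ s) by linarith)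
    have e2 := mul_nonneg hl (show 0 ≤ 1 + Real.cos (twistAngle₂ s) by linarith)
    rcases twistAngle_cases s with h | h
    · rw [h, Real.cos_zero] at hx
      have : 0 < c * ((1 - τ) * (1 + 1) / 4 + τ / 2) := mul_pos hc (by linarith)
      linarith [hτ.1]
    · rw [h, Real.cos_two_pi] at hx
      have : 0 ≤ c * ((1 - τ) * (1 + Real.cos (twistAngle₂ s)) / 4 + τ / 2) :=
        mul_nonneg hc.le (by linarith [hτ.1])
      linarith
  · rw [straighten_one, straighten_two, eq_E3_iff] at heq
    simp at heq
    obtain ⟨hx, hy, hz⟩ := heq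
    have hk : √3 / √4 = √(3 / 4 : ℝ) := by simp
    rcases twistAngle_cases s with h | h
    · rw [h] at hx
      simp at hx
      have h1 := mul_nonneg hl (sub_nonneg.2 hA2)
      have : 0 < c * ((1 - τ) * (1 + 1) / 4 + τ / 2) := mul_pos hc (by linarith)
      linarith
    · rw [h, add_comm (2 * Real.pi) (twistAngle₂ s), Real.sin_add_two_pi] at hy
      rw [h, add_comm (2 * Real.pi) (twistAngle₂ s), Real.cos_add_two_pi] at hz
      rw [h] at hx
      simp at hx hy hz
      rw [hk] at hz
      have hci : c⁻¹ * c = 1 := inv_mul_cancel₀ hc.ne'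
      refine spin_apart hBQ hl hτ.1 (by ring) (inv_pos.2 hc) (t₀ := twistedDepth 2 s)
        (t₁ := twistedDepth 1 s) (fun hB => ?_) (fun hB => ?_) ?_ ?_ ?_
      · have hQ : Real.sin (twistAngle₂ s) = 0 := by
          rw [hB] at hBQ; exact pow_eq_zero_iff two_ne_zero |>.1 (by linarith)
        simp [twistedDepth, twistedStrand, twistedHeight, hB, hQ]
        norm_num
      · have hQ : Real.sin (twistAngle₂ s) = 0 := by
          rw [hB] at hBQ; exact pow_eq_zero_iff two_ne_zero |>.1 (by linarith)
        simp [twistedDepth, twistedStrand, twistedHeight, hB, hQ, h]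
        norm_num
      · linear_combination c⁻¹ * hx + ((1 - τ) * (1 + Real.cos (twistAngle₂ s)) / 4 + τ / 2) * hci
      · linear_combination -c⁻¹ * hy + ((1 - τ) * Real.sin (twistAngle₂ s) / 4) * hci
      · linear_combination -c⁻¹ * hz + ((1 - τ) * twistedDepth 2 s + τ * √(3 / 4)) * hci

namespace MeetsBandInStrands
variable {D : AnnularDiagram} {φ : ℝ × ℝ → Cyl}

/-- The first step: `σ₁² σ₂⁻²` is a double turn of the middle strand about the first axis, since it
turns about the left strand and then, in the opposite sense, about the right one. -/
theorem sameLink_glue_twisted_spin (h : MeetsBandInStrands D φ) {H : D.Height}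
    (hH : ∀ k, ∀ t ∈ coreSet D φ (3 / 4) k, H.h k t = 0) :
    SameLink (glue D φ H fun i s => dir (twistedVec i s))
      (glue D φ H fun i s => dir (spinVec i s)) := by
  have key := h.sameLink_glue_dir hH (w := straighten) (fun i => ?_)
    (fun i τ hτ s => straighten_ne_zero i hτ s)
    (fun i j τ hτ s hij c hc => straighten_apart hij hτ s hc) (fun i τ _ s hs => ?_)
  · simpa [straighten] using key
  · exact ((contDiff_const.sub contDiff_fst).smul ((contDiff_twistedVec i).comp contDiff_snd)).add
      (contDiff_fst.smul ((contDiff_spinVec i).comp contDiff_snd))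
  · rw [straighten, twistedVec_of_ends i hs, spinVec_of_ends i hs, ← add_smul]
    simp

end MeetsBandInStrands

/-- The rotation by the angle `c` about the first axis. -/
def rotX (c : ℝ) (v : EuclideanSpace ℝ (Fin 3)) : EuclideanSpace ℝ (Fin 3) :=
  !₂[v 0, v 1 * Real.cos c - v 2 * Real.sin c, v 1 * Real.sin c + v 2 * Real.cos c]

/-- The rotation by the angle `c` about the third axis. -/
def rotZ (c : ℝ) (v : EuclideanSpace ℝ (Fin 3)) : EuclideanSpace ℝ (Fin 3) :=
  !₂[v 0 * Real.cos c - v 1 * Real.sin c, v 0 * Real.sin c + v 1 * Real.cos c, v 2]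

theorem rotX_rotX (c d : ℝ) (v : EuclideanSpace ℝ (Fin 3)) : rotX c (rotX d v) = rotX (c + d) v := by
  rw [eq_E3_iff]
  simp only [rotX, Real.sin_add, Real.cos_add]
  refine ⟨rfl, ?_, ?_⟩ <;> simp <;> ring

theorem rotZ_rotZ (c d : ℝ) (v : EuclideanSpace ℝ (Fin 3)) : rotZ c (rotZ d v) = rotZ (c + d) v := by
  rw [eq_E3_iff]
  simp only [rotZ, Real.sin_add, Real.cos_add]
  refine ⟨?_, ?_, rfl⟩ <;> simp <;> ring

theorem rotX_of_cos_eq_one {c : ℝ} (hc : Real.cos c = 1) (v : EuclideanSpace ℝ (Fin 3)) :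
    rotX c v = v := by
  have hs : Real.sin c = 0 := by
    have := Real.sin_sq_add_cos_sq c
    rw [hc] at this
    exact pow_eq_zero_iff two_ne_zero |>.1 (by linarith)
  rw [eq_E3_iff]
  simp [rotX, hc, hs]

theorem rotZ_zero (v : EuclideanSpace ℝ (Fin 3)) : rotZ 0 v = v := by
  rw [eq_E3_iff]
  simp [rotZ]

theorem rotX_smul (c μ : ℝ) (v : EuclideanSpace ℝ (Fin 3)) : rotX c (μ • v) = μ • rotX c v := by
  rw [eq_E3_iff]
  refine ⟨rfl, ?_, ?_⟩ <;> simp [rotX] <;> ring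

theorem rotZ_smul (c μ : ℝ) (v : EuclideanSpace ℝ (Fin 3)) : rotZ c (μ • v) = μ • rotZ c v := by
  rw [eq_E3_iff]
  refine ⟨?_, ?_, rfl⟩ <;> simp [rotZ] <;> ring

theorem rotX_injective (c : ℝ) : Function.Injective (rotX c) := fun v w h => by
  have := congrArg (rotX (-c)) h
  rwa [rotX_rotX, rotX_rotX, neg_add_cancel, rotX_of_cos_eq_one Real.cos_zero,
    rotX_of_cos_eq_one Real.cos_zero] at this

theorem rotZ_injective (c : ℝ) : Function.Injective (rotZ c) := fun v w h => by
  have := congrArg (rotZ (-c)) h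
  rwa [rotZ_rotZ, rotZ_rotZ, neg_add_cancel, rotZ_zero, rotZ_zero] at this

/-- A half turn about the third axis inverts the rotations about the first one. -/
theorem rotZ_pi_rotX_rotZ_neg_pi (c : ℝ) (v : EuclideanSpace ℝ (Fin 3)) :
    rotZ Real.pi (rotX c (rotZ (-Real.pi) v)) = rotX (-c) v := by
  rw [eq_E3_iff]
  simp [rotZ, rotX]
  ring

theorem contDiff_rotX {E : Type*} [NormedAddCommGroup E] [NormedSpace ℝ E] {c : E → ℝ}
    {v : E → EuclideanSpace ℝ (Fin 3)} (hc : ContDiff ℝ ∞ c) (hv : ContDiff ℝ ∞ v) :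
    ContDiff ℝ ∞ fun p => rotX (c p) (v p) := by
  have h := fun i => (contDiff_piLp_apply (p := 2) (i := i) (𝕜 := ℝ) (n := ∞)
    (E := fun _ : Fin 3 => ℝ)).comp hv
  have hs := Real.contDiff_sin.comp hc
  have hk := Real.contDiff_cos.comp hc
  exact contDiff_E3 (h 0) (((h 1).mul hk).sub ((h 2).mul hs)) (((h 1).mul hs).add ((h 2).mul hk))

theorem contDiff_rotZ {E : Type*} [NormedAddCommGroup E] [NormedSpace ℝ E] {c : E → ℝ}
    {v : E → EuclideanSpace ℝ (Fin 3)} (hc : ContDiff ℝ ∞ c) (hv : ContDiff ℝ ∞ v) :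
    ContDiff ℝ ∞ fun p => rotZ (c p) (v p) := by
  have h := fun i => (contDiff_piLp_apply (p := 2) (i := i) (𝕜 := ℝ) (n := ∞)
    (E := fun _ : Fin 3 => ℝ)).comp hv
  have hs := Real.contDiff_sin.comp hc
  have hk := Real.contDiff_cos.comp hc
  exact contDiff_E3 (((h 0).mul hk).sub ((h 1).mul hs)) (((h 0).mul hs).add ((h 1).mul hk)) (h 2)

/-- Vectors over different strands have different first coordinates, even up to positive factors. -/
theorem strandLevel_ne_mul {i j : Fin 3} (hij : i < j) {c : ℝ} (hc : 0 < c) :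
    strandLevel i ≠ c * strandLevel j := by
  have h0 : strandLevel 0 = -1 / 2 := rfl
  have h1 : strandLevel 1 = 0 := rfl
  have h2 : strandLevel 2 = 1 / 2 := rfl
  have hcases : (i = 0 ∧ j = 1) ∨ (i = 0 ∧ j = 2) ∨ (i = 1 ∧ j = 2) := by
    fin_cases i <;> fin_cases j <;> simp_all
  intro h
  rcases hcases with ⟨rfl, rfl⟩ | ⟨rfl, rfl⟩ | ⟨rfl, rfl⟩
  · rw [h0, h1] at h; linarith
  · rw [h0, h2] at h; linarith
  · rw [h1, h2] at h; linarith

theorem basePoint_ne_zero (i : Fin 3) : (basePoint i).1 ≠ 0 := fun h => by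
  have := mem_sphere_zero_iff_norm.1 (basePoint i).2
  rw [h, norm_zero] at this
  exact zero_ne_one this

theorem rotX_zero_right (c : ℝ) : rotX c 0 = 0 := by
  simpa using rotX_smul c 0 0

theorem rotZ_zero_right (c : ℝ) : rotZ c 0 = 0 := by
  simpa using rotZ_smul c 0 0

/-- The homotopy that lets the outer strands join the double turn of the middle strand. -/
def joinSpin (i : Fin 3) (p : ℝ × ℝ) : EuclideanSpace ℝ (Fin 3) :=
  (1 - p.1) • spinVec i p.2 +
    p.1 • rotX (twistAngle₁ p.2 + twistAngle₂ p.2) (basePoint i).1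

theorem joinSpin_apply_zero (i : Fin 3) (p : ℝ × ℝ) : joinSpin i p 0 = strandLevel i := by
  have h : spinVec i p.2 0 = strandLevel i := by
    fin_cases i <;> rfl
  have h2 : rotX (twistAngle₁ p.2 + twistAngle₂ p.2) (basePoint i).1 0 = strandLevel i := rfl
  simp only [joinSpin, PiLp.add_apply, PiLp.smul_apply, h, h2, smul_eq_mul]
  ring

theorem spinVec_one (s : ℝ) :
    spinVec 1 s = rotX (twistAngle₁ s + twistAngle₂ s) (basePoint 1).1 := by
  obtain ⟨a, b, c⟩ := basePoint_coords 1
  have hl : strandLevel 1 = 0 := rfl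
  rw [eq_E3_iff]
  simp [rotX, a, b, c, hl, spinVec]

theorem joinSpin_ne_zero (i : Fin 3) (p : ℝ × ℝ) : joinSpin i p ≠ 0 := by
  by_cases hi : i = 1
  · subst hi
    rw [joinSpin, spinVec_one, ← add_smul, sub_add_cancel, one_smul]
    intro h
    exact basePoint_ne_zero 1 (rotX_injective _ (h.trans (rotX_zero_right _).symm))
  · refine ne_zero_of_coord 0 ?_
    rw [joinSpin_apply_zero]
    intro h
    exact hi (strandLevel_injective (h.trans (show (0 : ℝ) = strandLevel 1 from rfl)))

/-- The belt trick: a double turn of all of `S²` about the first axis is the product of two turns,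
and turning the axis of one of them around makes them cancel. -/
def beltTrick (i : Fin 3) (p : ℝ × ℝ) : EuclideanSpace ℝ (Fin 3) :=
  rotX ((twistAngle₁ p.2 + twistAngle₂ p.2) / 2) (rotZ (Real.pi * p.1)
    (rotX ((twistAngle₁ p.2 + twistAngle₂ p.2) / 2) (rotZ (-(Real.pi * p.1)) (basePoint i).1)))

theorem contDiff_beltTrick (i : Fin 3) : ContDiff ℝ ∞ (beltTrick i) := by
  have h1 : ContDiff ℝ ∞ fun p : ℝ × ℝ => (twistAngle₁ p.2 + twistAngle₂ p.2) / 2 :=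
    ((contDiff_twistAngle₁.add contDiff_twistAngle₂).comp contDiff_snd).div_const 2
  have h2 : ContDiff ℝ ∞ fun p : ℝ × ℝ => Real.pi * p.1 := contDiff_const.mul contDiff_fst
  exact contDiff_rotX h1 (contDiff_rotZ h2 (contDiff_rotX h1 (contDiff_rotZ h2.neg contDiff_const)))

theorem beltTrick_zero (i : Fin 3) (s : ℝ) :
    beltTrick i (0, s) = rotX (twistAngle₁ s + twistAngle₂ s) (basePoint i).1 := by
  simp only [beltTrick, mul_zero, neg_zero, rotZ_zero, rotX_rotX, add_halves]

theorem beltTrick_one (i : Fin 3) (s : ℝ) : beltTrick i (1, s) = (basePoint i).1 := by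
  simp only [beltTrick, mul_one, rotZ_pi_rotX_rotZ_neg_pi, rotX_rotX, add_neg_cancel]
  exact rotX_of_cos_eq_one Real.cos_zero _

theorem cos_half_twist_ends {s : ℝ} (hs : 2 / 3 ≤ |s|) :
    Real.cos ((twistAngle₁ s + twistAngle₂ s) / 2) = 1 := by
  rcases twistAngle_ends hs with ⟨h1, h2⟩ | ⟨h1, h2⟩ <;> simp [h1, h2]

theorem beltTrick_of_ends (i : Fin 3) (τ : ℝ) {s : ℝ} (hs : 2 / 3 ≤ |s|) :
    beltTrick i (τ, s) = (basePoint i).1 := by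
  rw [beltTrick]
  simp only [rotX_of_cos_eq_one (cos_half_twist_ends hs), rotZ_rotZ, add_neg_cancel, rotZ_zero]

namespace MeetsBandInStrands
variable {D : AnnularDiagram} {φ : ℝ × ℝ → Cyl}

/-- The second step: the outer strands join the double turn of the middle strand. -/
theorem sameLink_glue_spin_rotX (h : MeetsBandInStrands D φ) {H : D.Height}
    (hH : ∀ k, ∀ t ∈ coreSet D φ (3 / 4) k, H.h k t = 0) :
    SameLink (glue D φ H fun i s => dir (spinVec i s))
      (glue D φ H fun i s => dir (rotX (twistAngle₁ s + twistAngle₂ s) (basePoint i).1)) := by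
  have key := h.sameLink_glue_dir hH (w := joinSpin) (fun i => ?_)
    (fun i τ _ s => joinSpin_ne_zero i _)
    (fun i j τ _ s hij c hc heq => strandLevel_ne_mul hij hc ?_) (fun i τ _ s hs => ?_)
  · simpa [joinSpin] using key
  · exact ((contDiff_const.sub contDiff_fst).smul ((contDiff_spinVec i).comp contDiff_snd)).add
      (contDiff_fst.smul (contDiff_rotX
        ((contDiff_twistAngle₁.add contDiff_twistAngle₂).comp contDiff_snd) contDiff_const))
  · have := congrArg (fun v : EuclideanSpace ℝ (Fin 3) => v 0) heq
    simpa only [PiLp.smul_apply, joinSpin_apply_zero, smul_eq_mul] using this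
  · rw [joinSpin, spinVec_of_ends i hs, rotX_of_cos_eq_one (sin_cos_twist_ends hs).2, ← add_smul]
    simp

/-- The third step: the double turn of `S²` is undone. -/
theorem sameLink_glue_rotX_lift (h : MeetsBandInStrands D φ) {H : D.Height}
    (hH : ∀ k, ∀ t ∈ coreSet D φ (3 / 4) k, H.h k t = 0) :
    SameLink (glue D φ H fun i s => dir (rotX (twistAngle₁ s + twistAngle₂ s) (basePoint i).1))
      (D.lift H) := by
  have key := h.sameLink_glue_dir hH (w := beltTrick) contDiff_beltTrick
    (fun i τ _ s h0 => basePoint_ne_zero i ?_)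
    (fun i j τ _ s hij c hc heq => strandLevel_ne_mul hij hc ?_)
    (fun i τ _ s hs => beltTrick_of_ends i τ hs)
  · simp only [beltTrick_zero, beltTrick_one, dir_coe] at key
    rwa [h.glue_basePoint hH] at key
  · have h1 := rotX_injective _ (h0.trans (rotX_zero_right _).symm)
    have h2 := rotZ_injective _ (h1.trans (rotZ_zero_right _).symm)
    have h3 := rotX_injective _ (h2.trans (rotX_zero_right _).symm)
    exact rotZ_injective _ (h3.trans (rotZ_zero_right _).symm)
  · simp only [beltTrick, ← rotX_smul, ← rotZ_smul] at heq
    have h1 := rotZ_injective _ (rotX_injective _ (rotZ_injective _ (rotX_injective _ heq)))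
    exact congrArg (fun v : EuclideanSpace ℝ (Fin 3) => v 0) h1

theorem sameLink_glue_twisted_lift (h : MeetsBandInStrands D φ) {H : D.Height}
    (hH : ∀ k, ∀ t ∈ coreSet D φ (3 / 4) k, H.h k t = 0) :
    SameLink (glue D φ H fun i s => dir (twistedVec i s)) (D.lift H) :=
  ((h.sameLink_glue_twisted_spin hH).trans (h.sameLink_glue_spin_rotX hH)).trans
    (h.sameLink_glue_rotX_lift hH)

end MeetsBandInStrands

/-! ### The band move is an isotopy -/

namespace MeetsBandInStrands
variable {D : AnnularDiagram} {φ : ℝ × ℝ → Cyl}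

theorem coreSet_add_one (r : ℝ) (k : Fin D.n) (t : ℝ) :
    t + 1 ∈ coreSet D φ r k ↔ t ∈ coreSet D φ r k := by
  simp only [coreSet, Set.mem_ofPred_eq, D.periodic k t]

/-- The braid `σ₁² σ₂⁻²` put into the band stays in the lower hemisphere and projects to the
strands of its diagram. -/
theorem glue_twisted_of_mem (h : MeetsBandInStrands D φ) {H : D.Height} {k : Fin D.n} {t s : ℝ}
    {i : Fin 3} (hs : s ∈ Set.Icc (-(3 / 4) : ℝ) (3 / 4)) (ht : D.curve k t = φ (s, strandLevel i)) :
    toCyl (glue D φ H (fun i s => dir (twistedVec i s)) k t) = φ (s, twistedStrand i s) ∧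
    (glue D φ H (fun i s => dir (twistedVec i s)) k t).2.1 1 =
      √(IsBand.ratioSq φ (s, twistedStrand i s)) * twistedHeight i s ∧
    (glue D φ H (fun i s => dir (twistedVec i s)) k t).2.1 2 < 0 := by
  have hI : s ∈ Set.Ioo (-1 : ℝ) 1 := ⟨by linarith [hs.1], by linarith [hs.2]⟩
  have h0 : (dir (twistedVec i s)).1 0 = twistedStrand i s := by rw [dir_twistedVec_coe]; rfl
  have h1 : (dir (twistedVec i s)).1 1 = twistedHeight i s := by rw [dir_twistedVec_coe]; rfl
  have h2 : (dir (twistedVec i s)).1 2 = -twistedDepth i s := by rw [dir_twistedVec_coe]; rfl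
  have hp : (s, twistedStrand i s) ∈ strip := ⟨hI, h0 ▸ S2_abs_le_one _⟩
  rw [h.glue_of_mem hs ht, h.isBand.toCyl_bandDouble hI, h.isBand.coe_bandDouble_snd hI, h0, h1, h2]
  refine ⟨rfl, rfl, ?_⟩
  have := mul_pos (Real.sqrt_pos.2 (h.isBand.ratioSq_pos hp)) (twistedDepth_pos i s)
  simpa using this

end MeetsBandInStrands

open MeetsBandInStrands in
/-- The double of the band carries the isotopy of `S¹ × S²` that undoes the band move. -/
theorem DifferByBandMove.exists_sameLink_lift {D D' : AnnularDiagram} (hd : DifferByBandMove D D') :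
    ∃ (H : D.Height) (H' : D'.Height), SameLink (D.lift H) (D'.lift H') := by
  obtain ⟨φ, e, ψ, hB, hψ, hcurve, -, hout, hin⟩ := hd
  have h : MeetsBandInStrands D φ := ⟨hB, fun k t hm => by
    rcases hcurve k t with ⟨h1, -⟩ | ⟨i, s, hs, h1, -⟩
    exacts [absurd hm h1, ⟨i, s, hs, h1⟩]⟩
  have hcore : ∀ {s : ℝ}, s ∈ Set.Icc (-(3 / 4) : ℝ) (3 / 4) → s ∈ Set.Ioo (-1 : ℝ) 1 :=
    fun hs => ⟨by linarith [hs.1], by linarith [hs.2]⟩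
  obtain ⟨H, hH⟩ := D.exists_height (Z := coreSet D φ (3 / 4)) (fun k t => coreSet_add_one _ k t)
    (fun k => h.isClosed_coreSet (by norm_num) k)
    (fun k t ⟨i, s, hs, ht⟩ => h.not_isCrossingParam (hcore hs) ht)
  have hL := h.sameLink_glue_twisted_lift hH
  set g := glue D φ H fun i s => dir (twistedVec i s) with hg
  have hgl : IsSmoothLink g := hL.left
  have htw : ∀ i s, (s, twistedStrand i s) ∈ strip ↔ s ∈ Set.Ioo (-1 : ℝ) 1 := fun i s =>
    ⟨fun hp => hp.1, fun hs => ⟨hs, abs_le.1 ((sq_le_one_iff_abs_le_one _).1 (by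
      have := twisted_sq_lt i s
      have := sq_nonneg (twistedHeight i s)
      linarith))⟩⟩
  have hin' : ∀ {k t i s}, s ∈ Set.Ioo (-1 : ℝ) 1 → D.curve k t = φ (s, strandLevel i) →
      D'.curve (e k) (ψ k t) = φ (s, twistedStrand i s) := by
    intro k t i s hs ht
    rcases hcurve k t with ⟨h1, -⟩ | ⟨j, s', hs', h1, h2⟩
    · exact absurd ⟨_, mk_strandLevel_mem_strip hs i, ht.symm⟩ h1
    · obtain ⟨rfl, rfl⟩ := h.unique hs hs' (ht.symm.trans h1)
      exact h2
  have hout' : ∀ {k t}, D.curve k t ∉ φ '' strip → D'.curve (e k) (ψ k t) = D.curve k t := by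
    intro k t hm
    rcases hcurve k t with ⟨-, h1⟩ | ⟨i, s, hs, h1, -⟩
    exacts [h1, absurd ⟨_, mk_strandLevel_mem_strip hs i, h1.symm⟩ hm]
  have hproj : ∀ k t, toCyl (g k t) = D'.curve (e k) (ψ k t) ∧ (g k t).2.1 2 < 0 := by
    intro k t
    by_cases hm : t ∈ coreSet D φ (3 / 4) k
    · obtain ⟨i, s, hs, ht⟩ := hm
      obtain ⟨h1, -, h3⟩ := h.glue_twisted_of_mem (H := H) hs ht
      exact ⟨h1.trans (hin' (hcore hs) ht).symm, h3⟩
    · rw [hg, glue_of_notMem hm]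
      constructor
      · rw [AnnularDiagram.toCyl_lift]
        by_cases hb : D.curve k t ∈ φ '' strip
        · obtain ⟨i, s, hs, ht⟩ := h.strands k t hb
          have h2 : 2 / 3 ≤ |s| := by
            by_contra! hlt
            have := abs_lt.1 hlt
            exact hm ⟨i, s, ⟨by linarith, by linarith⟩, ht⟩
          rw [hin' hs ht, (twisted_of_ends i h2).1, ht]
        · exact (hout' hb).symm
      · have := H.mem_disk k t
        have h3 : 0 < √(1 - (D.curve k t).2 ^ 2 - H.h k t ^ 2) := Real.sqrt_pos.2 (by linarith)
        simpa [AnnularDiagram.lift, hemi] using h3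
  have hdisk : ∀ k t, (g k t).2.1 0 ^ 2 + (g k t).2.1 1 ^ 2 < 1 := fun k t => by
    have h1 := S2_sum_sq (g k t).2
    have h2 := pow_pos (neg_pos.2 (hproj k t).2) 2
    nlinarith
  have hsnd : ∀ k t, (D'.curve (e k) (ψ k t)).2 = (g k t).2.1 0 := fun k t =>
    congrArg Prod.snd (hproj k t).1.symm
  have hover : ∀ k t m u, IsDoublePair D'.curve (e k) (ψ k t) (e m) (ψ m u) →
      (D'.isOver (e k) (ψ k t) ↔ (g m u).2.1 1 < (g k t).2.1 1) := by
    rintro k t m u ⟨heq, hne⟩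
    rw [hψ.sameParam_iff] at hne
    have hmixed : ∀ {k t m u}, D'.curve (e k) (ψ k t) = D'.curve (e m) (ψ m u) →
        D.curve k t ∈ φ '' strip → D.curve m u ∈ φ '' strip := by
      intro k t m u heq hk
      by_contra hm
      obtain ⟨i, s, hs, ht⟩ := h.strands k t hk
      rw [hout' hm, hin' hs ht] at heq
      exact hm ⟨_, (htw i s).2 hs, heq⟩
    by_cases hk : D.curve k t ∈ φ '' strip
    · obtain ⟨i, s, hs, ht⟩ := h.strands k t hk
      obtain ⟨j, s', hs', hu⟩ := h.strands m u (hmixed heq hk)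
      have h2 := h.isBand.injOn ((htw i s).2 hs) ((htw j s').2 hs')
        ((hin' hs ht).symm.trans (heq.trans (hin' hs' hu)))
      obtain rfl : s = s' := (Prod.ext_iff.1 h2).1
      have h3 : twistedStrand i s = twistedStrand j s := (Prod.ext_iff.1 h2).2
      have hij : i ≠ j := by
        rintro rfl
        exact hne (h.sameParam hs ht hu)
      have hlt : |s| < 2 / 3 := by
        by_contra! hge
        rw [(twisted_of_ends i hge).1, (twisted_of_ends j hge).1] at h3
        exact hij (strandLevel_injective h3)
      have hs34 : s ∈ Set.Icc (-(3 / 4) : ℝ) (3 / 4) := by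
        have := abs_lt.1 hlt
        exact ⟨by linarith, by linarith⟩
      rw [(h.glue_twisted_of_mem (H := H) hs34 ht).2.1, (h.glue_twisted_of_mem (H := H) hs34 hu).2.1,
        ← h3, mul_lt_mul_iff_right₀ (Real.sqrt_pos.2 (h.isBand.ratioSq_pos ((htw i s).2 hs)))]
      exact hin k t m u i j s hs hij ht hu h3
    · have hm : D.curve m u ∉ φ '' strip := fun hm => hk (hmixed heq.symm hm)
      have hdp : IsDoublePair D.curve k t m u := ⟨by rw [← hout' hk, ← hout' hm, heq], hne⟩
      have hnc : ∀ {k t}, D.curve k t ∉ φ '' strip → t ∉ coreSet D φ (3 / 4) k :=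
        fun hk ⟨i, s, hs, ht⟩ => hk ⟨_, mk_strandLevel_mem_strip (hcore hs) i, ht.symm⟩
      rw [hout k t hk ⟨m, u, hdp⟩, H.over_iff k t m u hdp, hg, glue_of_notMem (hnc hk),
        glue_of_notMem (hnc hm)]
      rfl
  have hinv : ∀ l u, e (e.symm l) = l ∧ ψ (e.symm l) (hψ.inv l u) = u := fun l u =>
    ⟨e.apply_symm_apply l, hψ.apply_inv l u⟩
  have hcurve' : ∀ l u, D'.curve (e (e.symm l)) (ψ (e.symm l) (hψ.inv l u)) = D'.curve l u :=
    fun l u => by rw [(hinv l u).2, (hinv l u).1]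
  let H' : D'.Height :=
    { h := fun l u => (g (e.symm l) (hψ.inv l u)).2.1 1
      smooth := fun l => by
        have h1 := (contMDiff_S1S2_iff.1 (hgl.smooth (e.symm l))).2
        exact (contDiff_piLp_apply (p := 2) (i := (1 : Fin 3)) (𝕜 := ℝ) (n := ∞)
          (E := fun _ : Fin 3 => ℝ)).comp (h1.comp (hψ.isReparam_inv l).1)
      periodic := fun l u => by
        have hp := hgl.periodic (e.symm l)
        rcases (hψ.isReparam_inv l).2.2 with h1 | h1
        · simp only [h1, hp _]
        · simp only [h1, hp.sub_eq]
      mem_disk := fun l u => by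
        have := hdisk (e.symm l) (hψ.inv l u)
        rwa [← hsnd, hcurve'] at this
      over_iff := fun l u l' u' hdp => by
        have := hover (e.symm l) (hψ.inv l u) (e.symm l') (hψ.inv l' u')
        simp only [(hinv _ _).2, (hinv _ 0).1] at this
        exact this hdp }
  have hlift : ∀ k t, D'.lift H' (e k) (ψ k t) = g k t := by
    intro k t
    have h1 : H'.h (e k) (ψ k t) = (g k t).2.1 1 := by
      show (g (e.symm (e k)) (hψ.inv (e k) (ψ k t))).2.1 1 = _
      rw [hψ.inv_apply, e.symm_apply_apply]
    have h2 : (D'.curve (e k) (ψ k t)).1 = (toCyl (g k t)).1 :=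
      congrArg Prod.fst (hproj k t).1.symm
    refine Prod.ext h2 ?_
    rw [eq_hemi_of_neg _ (hproj k t).2 (hdisk k t).le]
    simp only [AnnularDiagram.lift, h1, hsnd]
  have hR := SameLink.of_reparam (AnnularDiagram.isSmoothLink_lift H') hψ
  simp only [hlift] at hR
  exact ⟨H, H', hL.symm.trans hR⟩

/-- The link that a diagram represents. -/
def AnnularDiagram.toLink (D : AnnularDiagram) (H : D.Height) (ι : AnnulusEmbedding) : SmoothLink :=
  ⟨D.n, fun k t => ι (D.lift H k t), (AnnularDiagram.isSmoothLink_lift H).diffeo ι⟩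

theorem AnnularDiagram.represents_toLink (D : AnnularDiagram) (H : D.Height) (ι : AnnulusEmbedding) :
    D.Represents ι (D.toLink H ι) :=
  ⟨H, SameLink.refl ((AnnularDiagram.isSmoothLink_lift H).diffeo ι)⟩

/-- Diagrams that differ by a band move represent the same link. -/
theorem DifferByBandMove.representSameLink {D D' : AnnularDiagram} (hd : DifferByBandMove D D')
    (ι : AnnulusEmbedding) : RepresentSameLink ι D D' := by
  obtain ⟨H, H', hL⟩ := hd.exists_sameLink_lift
  refine ⟨⟨D.toLink H ι, D.represents_toLink H ι⟩, fun K => ⟨?_, ?_⟩⟩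
  · rintro ⟨H₀, h0⟩
    exact ⟨H', ((hL.symm.trans (AnnularDiagram.sameLink_lift H H₀)).diffeo ι).trans h0⟩
  · rintro ⟨H₀, h0⟩
    exact ⟨H, ((hL.trans (AnnularDiagram.sameLink_lift H' H₀)).diffeo ι).trans h0⟩

/-! ### Closed 3-braids with one component -/

/-- A closed 3-braid with one component, as a diagram in the annulus: the curve
`t ↦ (exp (6πit), X t)` runs three times around the annulus, and the three points over the same
angle have the parameters `t`, `t + 1/3` and `t + 2/3`. -/
structure ClosedBraid where
  X : ℝ → ℝ
  isOver : ℝ → Prop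
  smooth : ContDiff ℝ ∞ X
  periodic : Function.Periodic X 1
  abs_lt : ∀ t, |X t| < 1
  transverse : ∀ t, X t = X (t + 1 / 3) → deriv X t ≠ deriv X (t + 1 / 3)
  no_triple : ∀ t, X t = X (t + 1 / 3) → X t ≠ X (t + 2 / 3)
  over_periodic : ∀ t, isOver (t + 1) ↔ isOver t
  over_iff : ∀ t, X t = X (t + 1 / 3) → (isOver t ↔ ¬ isOver (t + 1 / 3))

namespace ClosedBraid
variable (B : ClosedBraid)

/-- The curve of a closed braid. -/
def curve (t : ℝ) : Cyl := (Circle.exp (6 * Real.pi * t), B.X t)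

theorem exp_eq_exp_iff {t u : ℝ} :
    Circle.exp (6 * Real.pi * t) = Circle.exp (6 * Real.pi * u) ↔ ∃ m : ℤ, u = t + m / 3 := by
  rw [Circle.exp_eq_exp]
  constructor
  · rintro ⟨m, hm⟩
    refine ⟨-m, ?_⟩
    have := Real.pi_pos.ne'
    have h2 : Real.pi * (6 * t) = Real.pi * (6 * u + m * 2) := by linear_combination hm
    have h3 := mul_left_cancel₀ this h2
    push_cast
    linarith
  · rintro ⟨m, rfl⟩
    refine ⟨-m, ?_⟩
    push_cast
    ring

theorem X_add_int (t : ℝ) (m : ℤ) : B.X (t + m) = B.X t := by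
  simpa using B.periodic.int_mul m t

theorem deriv_X_add_int (t : ℝ) (m : ℤ) : deriv B.X (t + m) = deriv B.X t := by
  have h : (fun x => B.X (x + m)) = B.X := funext fun x => B.X_add_int x m
  rw [← deriv_comp_add_const, h]

theorem isOver_add_int (t : ℝ) (m : ℤ) : B.isOver (t + m) ↔ B.isOver t := by
  induction m with
  | zero => simp
  | succ n ih => rw [← ih, ← B.over_periodic (t + ((n : ℤ) : ℝ))]; push_cast; rw [add_assoc]
  | pred n ih =>
    rw [← ih, ← B.over_periodic (t + ((-(n : ℤ) - 1 : ℤ) : ℝ))]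
    push_cast
    rw [add_assoc, sub_add_cancel]

theorem curve_add_int (t : ℝ) (m : ℤ) : B.curve (t + m) = B.curve t := by
  refine Prod.ext (exp_eq_exp_iff.2 ⟨-(3 * m), ?_⟩) (B.X_add_int t m)
  push_cast
  ring

/-- Two parameters of a double point differ by `1/3`, in one of the two orders. -/
theorem isDoublePair_iff {k l : Fin 1} {t u : ℝ} :
    IsDoublePair (fun _ => B.curve) k t l u ↔
      (B.X t = B.X (t + 1 / 3) ∧ ∃ m : ℤ, u = t + 1 / 3 + m) ∨
        (B.X u = B.X (u + 1 / 3) ∧ ∃ m : ℤ, t = u + 1 / 3 + m) := by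
  have hk : k = l := Subsingleton.elim _ _
  constructor
  · rintro ⟨h1, h2⟩
    obtain ⟨m, hm⟩ := exp_eq_exp_iff.1 (congrArg Prod.fst h1)
    have hX : B.X t = B.X u := congrArg Prod.snd h1
    have hm3 : m % 3 = 0 ∨ m % 3 = 1 ∨ m % 3 = 2 := by omega
    have hmd : (m : ℝ) = 3 * (m / 3 : ℤ) + (m % 3 : ℤ) := by exact_mod_cast (Int.mul_ediv_add_emod m 3).symm
    rcases hm3 with h | h | h
    · exact absurd ⟨hk, m / 3, by rw [hm, hmd, h]; push_cast; ring⟩ h2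
    · have hu : u = t + 1 / 3 + (m / 3 : ℤ) := by rw [hm, hmd, h]; push_cast; ring
      exact Or.inl ⟨by rw [hX, hu, B.X_add_int], _, hu⟩
    · have hu : t = u + 1 / 3 + (-(m / 3) - 1 : ℤ) := by rw [hm, hmd, h]; push_cast; ring
      exact Or.inr ⟨by rw [← hX]; nth_rewrite 1 [hu]; rw [B.X_add_int], _, hu⟩
  · have key : ∀ {t u : ℝ}, B.X t = B.X (t + 1 / 3) → (∃ m : ℤ, u = t + 1 / 3 + m) →
        IsDoublePair (fun _ : Fin 1 => B.curve) k t l u := by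
      rintro t u hX ⟨m, rfl⟩
      refine ⟨Prod.ext (exp_eq_exp_iff.2 ⟨1 + 3 * m, by push_cast; ring⟩)
        (hX.trans (B.X_add_int _ m).symm), ?_⟩
      rintro ⟨-, n, hn⟩
      have h3 : (1 + 3 * m : ℝ) = 3 * n := by linarith
      have h4 : 1 + 3 * m = 3 * n := by exact_mod_cast h3
      omega
    rintro (⟨hX, hm⟩ | ⟨hX, hm⟩)
    · exact key hX hm
    · have := key hX hm
      rw [Subsingleton.elim l k] at this ⊢
      exact this.symm

theorem hasDerivAt_coe_curve (t : ℝ) : HasDerivAt (fun s => (B.curve s).coe)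
    ((6 * Real.pi * Complex.I * (Circle.exp (6 * Real.pi * t) : ℂ) : ℂ), deriv B.X t) t := by
  have h1 : HasDerivAt (fun s : ℝ => Complex.exp ((6 * Real.pi * Complex.I) * s))
      (6 * Real.pi * Complex.I * Complex.exp (6 * Real.pi * Complex.I * t)) t := by
    have := ((Complex.ofRealCLM.hasDerivAt (x := t)).const_mul (6 * Real.pi * Complex.I)).cexp
    simp only [Complex.ofRealCLM_apply] at this
    convert this using 1
    simp; ring
  have e : ∀ s : ℝ, (Circle.exp (6 * Real.pi * s) : ℂ) =
      Complex.exp ((6 * Real.pi * Complex.I) * s) := fun s => by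
    rw [Circle.coe_exp]; push_cast; ring_nf
  simp only [curve, Cyl.coe, e]
  exact h1.prodMk (B.smooth.differentiable (by norm_num)).differentiableAt.hasDerivAt

theorem finite_crossingParam : {t ∈ Set.Icc (0 : ℝ) 1 | B.X t = B.X (t + 1 / 3)}.Finite := by
  -- the parameters are simple zeros of `X t - X (t + 1/3)`, hence isolated
  by_contra hinf
  obtain ⟨x, -, hx⟩ := Set.Infinite.exists_accPt_of_subset_isCompact hinf isCompact_Icc
    (fun t ht => ht.1)
  have hX := B.smooth.differentiable (by norm_num)
  have hd : HasDerivAt (fun t => B.X t - B.X (t + 1 / 3)) (deriv B.X x - deriv B.X (x + 1 / 3)) x :=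
    (hX x).hasDerivAt.sub ((hX (x + 1 / 3)).hasDerivAt.comp_add_const x (1 / 3))
  have hfreq : ∃ᶠ y in nhdsWithin x {x}ᶜ, B.X y - B.X (y + 1 / 3) = 0 :=
    ((accPt_iff_frequently_nhdsNE).1 hx).mono fun y hy => sub_eq_zero.2 hy.2
  by_cases h0 : B.X x - B.X (x + 1 / 3) = 0
  · exact hfreq (hd.eventually_ne (sub_ne_zero.2 (B.transverse x (sub_eq_zero.1 h0))))
  · exact hfreq ((hd.continuousAt.eventually_ne h0).filter_mono nhdsWithin_le_nhds)

/-- The diagram of a closed braid. -/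
def toDiagram : AnnularDiagram where
  n := 1
  curve _ := B.curve
  isOver _ := B.isOver
  smooth _ := by
    have e : (fun t => (B.curve t).coe) =
        fun t => (Complex.exp ((6 * Real.pi * t : ℝ) * Complex.I), B.X t) := by
      funext t
      simp only [curve, Cyl.coe, Circle.coe_exp]
    rw [e]
    refine ContDiff.prodMk (ContDiff.cexp (ContDiff.mul (Complex.ofRealCLM.contDiff.comp
      (contDiff_const.mul contDiff_id)) contDiff_const)) B.smooth
  periodic _ t := by simpa using B.curve_add_int t 1
  mem_interior _ t := B.abs_lt t
  immersion _ t := by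
    rw [(B.hasDerivAt_coe_curve t).deriv]
    intro h
    have := congrArg Prod.fst h
    simp [Real.pi_ne_zero] at this
  transverse k t l u h := by
    have hw : Circle.exp (6 * Real.pi * t) = Circle.exp (6 * Real.pi * u) := congrArg Prod.fst h.1
    have hne : deriv B.X t ≠ deriv B.X u := by
      rcases B.isDoublePair_iff.1 h with ⟨hX, m, rfl⟩ | ⟨hX, m, rfl⟩
      · rw [B.deriv_X_add_int]; exact B.transverse t hX
      · rw [B.deriv_X_add_int]; exact (B.transverse u hX).symm
    rw [(B.hasDerivAt_coe_curve t).deriv, (B.hasDerivAt_coe_curve u).deriv, hw,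
      LinearIndependent.pair_iff]
    intro a b hab
    have h1 := congrArg Prod.fst hab
    have h2 : a * deriv B.X t + b * deriv B.X u = 0 := congrArg Prod.snd hab
    have hz : (6 * Real.pi * Complex.I * (Circle.exp (6 * Real.pi * u) : ℂ) : ℂ) ≠ 0 := by
      simp [Real.pi_ne_zero]
    simp only [Prod.fst_add, Prod.smul_fst, ← add_smul, Prod.fst_zero, smul_eq_zero, hz,
      or_false] at h1
    obtain rfl : b = -a := by linarith
    have h3 : a * (deriv B.X t - deriv B.X u) = 0 := by linarith
    have h4 := (mul_eq_zero.1 h3).resolve_right (sub_ne_zero.2 hne)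
    simp [h4]
  no_triple k t l u j v h1 h2 h3 := by
    have e1 := congrArg Prod.snd h1.1
    have e2 := congrArg Prod.snd h2.1
    simp only [curve] at e1 e2
    have hnt : ∀ r : ℝ, ¬ (B.X r = B.X (r + 1 / 3) ∧ B.X (r + 1 / 3) = B.X (r + 1 / 3 + 1 / 3)) := by
      rintro r ⟨ha, hb⟩
      refine B.no_triple r ha (ha.trans (hb.trans ?_))
      rw [add_assoc]
      norm_num
    rcases B.isDoublePair_iff.1 h1 with ⟨a1, m, rfl⟩ | ⟨a1, m, rfl⟩ <;>
      rcases B.isDoublePair_iff.1 h2 with ⟨b1, n, hn⟩ | ⟨b1, n, hn⟩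
    · have hb : t + 1 / 3 + m + 1 / 3 = t + 1 / 3 + 1 / 3 + m := by ring
      rw [hb, B.X_add_int, B.X_add_int] at b1
      exact hnt t ⟨a1, b1⟩
    · exact h3.2 ⟨Subsingleton.elim _ _, m - n, by push_cast; linarith⟩
    · exact h3.2 ⟨Subsingleton.elim _ _, n - m, by push_cast; linarith⟩
    · have hu : u = v + 1 / 3 + n := hn
      have hb : u + 1 / 3 = v + 1 / 3 + 1 / 3 + n := by rw [hu]; ring
      rw [hb, B.X_add_int, hu, B.X_add_int] at a1
      exact hnt v ⟨b1, a1⟩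
  finite_double := by
    refine (B.finite_crossingParam.image B.curve).subset ?_
    have key : ∀ t, B.X t = B.X (t + 1 / 3) →
        B.curve t ∈ B.curve '' {t ∈ Set.Icc (0 : ℝ) 1 | B.X t = B.X (t + 1 / 3)} := by
      intro t ht
      refine ⟨Int.fract t, ⟨⟨Int.fract_nonneg t, (Int.fract_lt_one t).le⟩, ?_⟩, ?_⟩
      · have e : Int.fract t = t + ((-⌊t⌋ : ℤ) : ℝ) := by rw [Int.fract]; push_cast; ring
        have e2 : Int.fract t + 1 / 3 = t + 1 / 3 + ((-⌊t⌋ : ℤ) : ℝ) := by rw [e]; ring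
        rw [e2, B.X_add_int, e, B.X_add_int, ht]
      · have e : Int.fract t = t + ((-⌊t⌋ : ℤ) : ℝ) := by rw [Int.fract]; push_cast; ring
        rw [e, B.curve_add_int]
    rintro z ⟨k, t, l, u, h, rfl⟩
    rcases B.isDoublePair_iff.1 h with ⟨a1, -⟩ | ⟨a1, -⟩
    · exact key t a1
    · exact (show B.curve t = B.curve u from h.1) ▸ key u a1
  over_periodic _ t := B.over_periodic t
  over_iff k t l u h := by
    rcases B.isDoublePair_iff.1 h with ⟨a1, m, rfl⟩ | ⟨a1, m, rfl⟩
    · rw [B.isOver_add_int]; exact B.over_iff t a1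
    · rw [B.isOver_add_int, B.over_iff u a1, not_not]

theorem isCrossingParam_iff {k : Fin 1} {t : ℝ} :
    B.toDiagram.IsCrossingParam k t ↔
      B.X t = B.X (t + 1 / 3) ∨ B.X (t - 1 / 3) = B.X t := by
  constructor
  · rintro ⟨l, u, h⟩
    rcases B.isDoublePair_iff.1 h with ⟨a1, -⟩ | ⟨a1, m, rfl⟩
    · exact Or.inl a1
    · refine Or.inr ?_
      have e : u + 1 / 3 + m - 1 / 3 = u + m := by ring
      rw [e, B.X_add_int, B.X_add_int, a1]
  · rintro (h | h)
    · exact ⟨k, t + 1 / 3, B.isDoublePair_iff.2 (Or.inl ⟨h, 0, by simp⟩)⟩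
    · exact ⟨k, t - 1 / 3, B.isDoublePair_iff.2 (Or.inr ⟨by rw [sub_add_cancel, h], 0, by simp⟩)⟩

theorem mem_crossings_iff {z : Cyl} :
    z ∈ B.toDiagram.crossings ↔ ∃ t, B.X t = B.X (t + 1 / 3) ∧ B.curve t = z := by
  constructor
  · rintro ⟨k, t, l, u, h, rfl⟩
    rcases B.isDoublePair_iff.1 h with ⟨a1, -⟩ | ⟨a1, -⟩
    · exact ⟨t, a1, rfl⟩
    · exact ⟨u, a1, h.1.symm⟩
  · rintro ⟨t, h, rfl⟩
    exact ⟨(0 : Fin 1), t, (0 : Fin 1), t + 1 / 3, B.isDoublePair_iff.2 (Or.inl ⟨h, 0, by simp⟩), rfl⟩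

end ClosedBraid

/-! ### Diagrams of closed braids are simple -/

/-- On a contractible space every circle-valued function has an angle. -/
theorem exists_angle {A : Type*} [TopologicalSpace A] [ContractibleSpace A] (f : C(A, Circle)) :
    ∃ θ : C(A, ℝ), ∀ a, Circle.exp (θ a) = f a := by
  obtain ⟨y, ⟨F⟩⟩ := id_nullhomotopic A
  obtain ⟨e, he⟩ := Circle.exp_surjective (f y)
  let H : C(unitInterval × A, Circle) := f.comp (F.symm.toContinuousMap)
  have H0 : ∀ a, H (0, a) = Circle.exp ((ContinuousMap.const A e) a) := fun a => by
    have : F.symm (0, a) = y := by simp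
    exact (congrArg f this).trans he.symm
  refine ⟨(Circle.isCoveringMap_exp.liftHomotopy H (.const A e) H0).comp
    ((ContinuousMap.const A (1 : unitInterval)).prodMk (.id A)), fun a => ?_⟩
  have h1 := congrFun (Circle.isCoveringMap_exp.liftHomotopy_lifts H (.const A e) H0) (1, a)
  have h2 : F.symm (1, a) = a := by simp
  exact h1.trans (congrArg f h2)

namespace ClosedBraid
variable (B : ClosedBraid)

theorem continuous_curve : Continuous B.curve :=
  (Circle.exp.continuous.comp (continuous_const.mul continuous_id)).prodMk B.smooth.continuous

/-- A closed disk contains no part of the curve that starts and ends at the same crossing: such a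
loop winds around the annulus. -/
theorem eq_of_mapsTo_disk {E : Set Cyl} (hE : Nonempty (E ≃ₜ Metric.closedBall (0 : ℂ) 1)) {t u : ℝ}
    (htu : t ≤ u) (hm : ∀ v ∈ Set.Icc t u, B.curve v ∈ E) (heq : B.curve t = B.curve u) : t = u := by
  obtain ⟨h⟩ := hE
  have hball : ContractibleSpace (Metric.closedBall (0 : ℂ) 1) :=
    (convex_closedBall (0 : ℂ) 1).contractibleSpace ⟨0, by simp⟩
  have : ContractibleSpace E := h.toHomotopyEquiv.contractibleSpace
  obtain ⟨θ, hθ⟩ := exists_angle (A := E) ⟨fun z => z.1.1, continuous_fst.comp continuous_subtype_val⟩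
  simp only [ContinuousMap.coe_mk] at hθ
  let c : Set.Icc t u → E := fun v => ⟨B.curve v, hm v v.2⟩
  have hc : Continuous c := (B.continuous_curve.comp continuous_subtype_val).subtype_mk _
  have : PreconnectedSpace (Set.Icc t u) := Subtype.preconnectedSpace isPreconnected_Icc
  -- the lift of the angle of the curve differs from `6πt` by a constant
  have hconst := Circle.isCoveringMap_exp.isSeparatedMap.const_of_comp
    Circle.isCoveringMap_exp.isLocalHomeomorph.isLocallyInjective
    (g := fun v : Set.Icc t u => θ (c v) - 6 * Real.pi * v)
    ((θ.continuous.comp hc).sub (continuous_const.mul continuous_subtype_val))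
    (fun v w => by
      have hc' : ∀ x, Circle.exp (θ (c x)) = Circle.exp (6 * Real.pi * x) := fun x => hθ (c x)
      simp only [Circle.exp_sub, hc', div_self'])
  have h1 := hconst ⟨t, Set.left_mem_Icc.2 htu⟩ ⟨u, Set.right_mem_Icc.2 htu⟩
  have h2 : c ⟨t, Set.left_mem_Icc.2 htu⟩ = c ⟨u, Set.right_mem_Icc.2 htu⟩ := Subtype.ext heq
  simp only [h2] at h1
  have h3 : Real.pi * (6 * t) = Real.pi * (6 * u) := by linarith
  have := mul_left_cancel₀ Real.pi_ne_zero h3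
  linarith

theorem not_isCutByDisk {c : Cyl} (hc : c ∈ B.toDiagram.crossings) :
    ¬ B.toDiagram.IsCutByDisk c := by
  rintro ⟨E, -, hE, hfr, hcl, -⟩
  obtain ⟨t, hX, rfl⟩ := B.mem_crossings_iff.1 hc
  have hdp : IsDoublePair (fun _ : Fin 1 => B.curve) 0 t 0 (t + 1 / 3) :=
    B.isDoublePair_iff.2 (Or.inl ⟨hX, 0, by simp⟩)
  have heq : B.curve t = B.curve (t + 1 / 3) := hdp.1
  have hclosed : IsClosed E := by
    obtain ⟨h⟩ := hE
    have : CompactSpace (Metric.closedBall (0 : ℂ) 1) :=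
      isCompact_iff_compactSpace.1 (isCompact_closedBall 0 1)
    have : CompactSpace E := h.symm.compactSpace
    exact (isCompact_iff_compactSpace.2 this).isClosed
  have himage : ∀ v, B.curve v ∈ B.toDiagram.image := fun v => ⟨(0 : Fin 1), v, rfl⟩
  -- the crossing is only passed at `t` and `t + 1/3`
  have honly : ∀ v, B.curve v = B.curve t → (∃ m : ℤ, v = t + m) ∨ ∃ m : ℤ, v = t + 1 / 3 + m := by
    intro v hv
    by_contra hcon
    push Not at hcon
    have d1 : IsDoublePair (fun _ : Fin 1 => B.curve) 0 v 0 t := ⟨hv, fun ⟨_, m, hm⟩ =>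
      hcon.1 (-m) (by push_cast; linarith)⟩
    have d2 : IsDoublePair (fun _ : Fin 1 => B.curve) 0 v 0 (t + 1 / 3) :=
      ⟨hv.trans heq, fun ⟨_, m, hm⟩ => hcon.2 (-m) (by push_cast; linarith)⟩
    exact B.toDiagram.no_triple (0 : Fin 1) v (0 : Fin 1) t (0 : Fin 1) (t + 1 / 3) d1 hdp d2
  -- hence an open arc between two passages lies in the interior of the disk or outside of it
  have harc : ∀ a b : ℝ, a < b → B.curve a = B.curve t → B.curve b = B.curve t →
      (∀ v ∈ Set.Ioo a b, B.curve v ≠ B.curve t) → ∀ v ∈ Set.Ioo a b, B.curve v ∉ interior E := by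
    intro a b hab ha hb hne v hv hvE
    have hsub : B.curve '' Set.Ioo a b ⊆ interior E ∪ Eᶜ := by
      rintro _ ⟨w, hw, rfl⟩
      by_contra hcon
      rw [Set.mem_union, not_or, Set.notMem_compl_iff] at hcon
      have hf : B.curve w ∈ frontier E ∩ B.toDiagram.image :=
        ⟨⟨subset_closure hcon.2, hcon.1⟩, himage w⟩
      rw [hfr] at hf
      exact hne w hw hf
    have hin : B.curve '' Set.Ioo a b ⊆ interior E :=
      (isPreconnected_Ioo.image _ B.continuous_curve.continuousOn).subset_left_of_subset_union
        isOpen_interior hclosed.isOpen_compl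
        (Set.disjoint_compl_right_iff_subset.2 interior_subset) hsub ⟨_, ⟨v, hv, rfl⟩, hvE⟩
    have hmaps : ∀ w ∈ Set.Icc a b, B.curve w ∈ E := by
      intro w hw
      have h1 : Set.MapsTo B.curve (Set.Ioo a b) E := fun w hw => interior_subset (hin ⟨w, hw, rfl⟩)
      have h2 := h1.closure B.continuous_curve
      rw [closure_Ioo hab.ne, hclosed.closure_eq] at h2
      exact h2 hw
    exact hab.ne (B.eq_of_mapsTo_disk hE hab.le hmaps (ha.trans hb.symm))
  obtain ⟨z, hzE, ⟨k, v, hz⟩⟩ := (closure_nonempty_iff (s := interior E ∩ B.toDiagram.image)).1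
    ⟨_, hcl⟩
  replace hz : B.curve v = z := hz
  subst hz
  have hcE : B.curve t ∉ interior E := by
    have : B.curve t ∈ frontier E ∩ B.toDiagram.image := by rw [hfr]; rfl
    exact this.1.2
  -- bring `v` into the period that starts at `t`
  obtain ⟨m, hm, -⟩ := existsUnique_add_zsmul_mem_Ico (zero_lt_one' ℝ) v t
  simp only [zsmul_eq_mul, mul_one] at hm
  rw [← B.curve_add_int v m] at hzE
  have hnt : ∀ w, t < w → w < t + 1 → w ≠ t + 1 / 3 → B.curve w ≠ B.curve t := by
    intro w h1 h2 h3 h4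
    rcases honly w h4 with ⟨n, rfl⟩ | ⟨n, rfl⟩
    · have e1 : (0 : ℝ) < n := by linarith
      have e2 : (n : ℝ) < 1 := by linarith
      have e1' : 0 < n := by exact_mod_cast e1
      have e2' : n < 1 := by exact_mod_cast e2
      omega
    · have e1 : (-1 : ℝ) < n := by linarith
      have e2 : (n : ℝ) < 1 := by linarith
      have e1' : -1 < n := by exact_mod_cast e1
      have e2' : n < 1 := by exact_mod_cast e2
      obtain rfl : n = 0 := by omega
      simp at h3
  have ht1 : B.curve (t + 1) = B.curve t := by simpa using B.curve_add_int t 1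
  rcases hm.1.eq_or_lt with h0 | h0
  · rw [← h0] at hzE
    exact hcE hzE
  · rcases lt_trichotomy (v + m) (t + 1 / 3) with h1 | h1 | h1
    · exact harc t (t + 1 / 3) (by linarith) rfl heq.symm
        (fun w hw => hnt w hw.1 (by linarith [hw.2]) hw.2.ne) _ ⟨h0, h1⟩ hzE
    · rw [h1, ← heq] at hzE
      exact hcE hzE
    · exact harc (t + 1 / 3) (t + 1) (by linarith) heq.symm ht1
        (fun w hw => hnt w (by linarith [hw.1]) hw.2 hw.1.ne') _ ⟨h1, hm.2⟩ hzE

/-- The universal cover of the cylinder, with the parameter of the braid as coordinate. -/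
def cover (p : ℝ × ℝ) : Cyl := (Circle.exp (6 * Real.pi * p.1), p.2)

theorem isOpenQuotientMap_cover : IsOpenQuotientMap cover := by
  have h1 : IsOpenQuotientMap fun t : ℝ => Circle.exp (6 * Real.pi * t) := by
    have e : IsOpenQuotientMap fun t : ℝ => 6 * Real.pi * t :=
      (Homeomorph.mulLeft₀ (6 * Real.pi) (by positivity)).isOpenQuotientMap
    exact IsOpenQuotientMap.comp ⟨Circle.exp_surjective, Circle.exp.continuous,
      isLocalHomeomorph_circleExp.isOpenMap⟩ e
  exact h1.prodMap (Homeomorph.refl ℝ).isOpenQuotientMap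

/-- An external region lies on one side of the three strands. -/
theorem le_of_mem_closure_externalRegion {ε : ℝ} (hε : ε = 1 ∨ ε = -1) {t y : ℝ}
    (h : cover (t, y) ∈ closure (B.toDiagram.externalRegion ε)) : ε * B.X t ≤ ε * y := by
  have hε2 : ε * ε = 1 := by rcases hε with rfl | rfl <;> norm_num
  have hX := B.smooth.continuous
  let P : Set Cyl := {z | ∀ t, Circle.exp (6 * Real.pi * t) = z.1 → ε * B.X t < ε * z.2}
  let Q : Set Cyl := {z | ∃ t, Circle.exp (6 * Real.pi * t) = z.1 ∧ ε * z.2 < ε * B.X t}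
  have hP : IsOpen P := by
    rw [← isOpenQuotientMap_cover.isQuotientMap.isOpen_preimage]
    have e : cover ⁻¹' P = {p | ε * B.X p.1 < ε * p.2} ∩ ({p | ε * B.X (p.1 + 1 / 3) < ε * p.2} ∩
        {p | ε * B.X (p.1 + 2 / 3) < ε * p.2}) := by
      ext ⟨s, x⟩
      constructor
      · intro hp
        exact ⟨hp s rfl, hp _ (exp_eq_exp_iff.2 ⟨-1, by push_cast; ring⟩),
          hp _ (exp_eq_exp_iff.2 ⟨-2, by push_cast; ring⟩)⟩
      · rintro ⟨h0, h1, h2⟩ u hu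
        simp only [Set.mem_ofPred_eq] at h0 h1 h2
        obtain ⟨m, hm⟩ := exp_eq_exp_iff.1 hu.symm
        have hm3 : m % 3 = 0 ∨ m % 3 = 1 ∨ m % 3 = 2 := by omega
        have hmd : (m : ℝ) = 3 * (m / 3 : ℤ) + (m % 3 : ℤ) := by
          exact_mod_cast (Int.mul_ediv_add_emod m 3).symm
        show ε * B.X u < ε * x
        rcases hm3 with h3 | h3 | h3 <;> rw [h3] at hmd
        · rwa [show u = s + (m / 3 : ℤ) by rw [hm, hmd]; push_cast; ring, B.X_add_int]
        · rwa [show u = s + 1 / 3 + (m / 3 : ℤ) by rw [hm, hmd]; push_cast; ring, B.X_add_int]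
        · rwa [show u = s + 2 / 3 + (m / 3 : ℤ) by rw [hm, hmd]; push_cast; ring, B.X_add_int]
    rw [e]
    refine (isOpen_lt ?_ ?_).inter ((isOpen_lt ?_ ?_).inter (isOpen_lt ?_ ?_)) <;> fun_prop
  have hQ : IsOpen Q := by
    have e : Q = cover '' {p | ε * p.2 < ε * B.X p.1} := by
      ext z
      constructor
      · rintro ⟨s, hs, hlt⟩
        exact ⟨(s, z.2), hlt, Prod.ext hs rfl⟩
      · rintro ⟨p, hp, rfl⟩
        exact ⟨p.1, rfl, hp⟩
    rw [e]
    refine isOpenQuotientMap_cover.isOpenMap _ (isOpen_lt ?_ ?_) <;> fun_prop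
  have hdisj : Disjoint P Q := by
    rw [Set.disjoint_left]
    rintro z hz ⟨s, hs, hlt⟩
    exact lt_asymm (hz s hs) hlt
  have hsub : B.toDiagram.externalRegion ε ⊆ P := by
    by_cases hmem : ((1 : Circle), ε) ∈ annulus \ B.toDiagram.image
    · refine isPreconnected_connectedComponentIn.subset_left_of_subset_union hP hQ hdisj ?_
        ⟨_, mem_connectedComponentIn hmem, fun s _ => ?_⟩
      · refine (connectedComponentIn_subset _ _).trans fun z hz => ?_
        by_contra hcon
        rw [Set.mem_union, not_or] at hcon
        refine hcon.1 fun s hs => lt_of_le_of_ne (not_lt.1 fun hlt => hcon.2 ⟨s, hs, hlt⟩) fun he => ?_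
        have hz2 : B.X s = z.2 := by
          have : ε * (ε * B.X s) = ε * (ε * z.2) := by rw [he]
          rwa [← mul_assoc, ← mul_assoc, hε2, one_mul, one_mul] at this
        exact hz.2 ⟨(0 : Fin 1), s, Prod.ext hs hz2⟩
      · simp only [hε2]
        have := _root_.abs_lt.1 (B.abs_lt s)
        rcases hε with rfl | rfl <;> linarith
    · rw [AnnularDiagram.externalRegion, connectedComponentIn_eq_empty hmem]
      exact Set.empty_subset _
  by_contra! hlt
  have hq : cover (t, y) ∈ Q := ⟨t, rfl, hlt⟩
  obtain ⟨z, hz1, hz2⟩ := mem_closure_iff.1 h Q hQ hq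
  exact Set.disjoint_left.1 hdisj (hsub hz2) hz1

theorem not_isAdjacentToBothEnds {c : Cyl} (hc : c ∈ B.toDiagram.crossings) :
    ¬ B.toDiagram.IsAdjacentToBothEnds c := by
  rintro ⟨-, h1, h2⟩
  obtain ⟨t, hX, rfl⟩ := B.mem_crossings_iff.1 hc
  -- otherwise all three strands would pass through the crossing
  have e : B.curve t = cover (t + 2 / 3, B.X t) :=
    Prod.ext (exp_eq_exp_iff.2 ⟨2, by push_cast; ring⟩) rfl
  rw [e] at h1 h2
  have h3 := B.le_of_mem_closure_externalRegion (Or.inl rfl) h1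
  have h4 := B.le_of_mem_closure_externalRegion (Or.inr rfl) h2
  exact B.no_triple t hX (by linarith)

/-- The diagram of a closed braid is simple. -/
theorem isSimple_toDiagram : B.toDiagram.IsSimple := fun _ hc =>
  ⟨B.not_isCutByDisk hc, B.not_isAdjacentToBothEnds hc⟩

end ClosedBraid

/-! ### Monotonicity of the smooth transition function -/

theorem one_sub_smoothTransition (x : ℝ) :
    Real.smoothTransition (1 - x) = 1 - Real.smoothTransition x := by
  have h := (Real.smoothTransition.pos_denom x).ne'
  rw [Real.smoothTransition, Real.smoothTransition, sub_sub_cancel,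
    add_comm (expNegInvGlue (1 - x))]
  field_simp
  ring

theorem hasDerivAt_expNegInvGlue (x : ℝ) :
    HasDerivAt expNegInvGlue ((x⁻¹) ^ 2 * expNegInvGlue x) x := by
  simpa using expNegInvGlue.hasDerivAt_polynomial_eval_inv_mul 1 x

theorem deriv_smoothTransition_pos {x : ℝ} (hx : x ∈ Set.Ioo (0 : ℝ) 1) :
    0 < deriv Real.smoothTransition x := by
  have h1 := hasDerivAt_expNegInvGlue x
  have h2 : HasDerivAt (fun y => expNegInvGlue (1 - y))
      (-(((1 - x)⁻¹) ^ 2 * expNegInvGlue (1 - x))) x := by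
    simpa using (hasDerivAt_expNegInvGlue (1 - x)).comp_const_sub 1 x
  have h3 : HasDerivAt Real.smoothTransition _ x :=
    h1.div (h1.add h2) (Real.smoothTransition.pos_denom x).ne'
  rw [h3.deriv]
  have a := expNegInvGlue.pos_of_pos hx.1
  have b := expNegInvGlue.pos_of_pos (sub_pos.2 hx.2)
  have c : 0 < x⁻¹ ^ 2 := by have := hx.1; positivity
  have d : 0 < (1 - x)⁻¹ ^ 2 := by have := sub_pos.2 hx.2; positivity
  refine div_pos ?_ (pow_pos (Real.smoothTransition.pos_denom x) 2)
  have e : 0 < (x⁻¹ ^ 2 + (1 - x)⁻¹ ^ 2) * (expNegInvGlue x * expNegInvGlue (1 - x)) := by positivity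
  linarith

theorem deriv_smoothTransition_nonneg (x : ℝ) : 0 ≤ deriv Real.smoothTransition x := by
  have := (Real.smoothTransition.monotone.monotoneOn Set.univ).derivWithin_nonneg (x := x)
  rwa [derivWithin_univ] at this

theorem strictMonoOn_smoothTransition : StrictMonoOn Real.smoothTransition (Set.Icc 0 1) :=
  strictMonoOn_of_deriv_pos (convex_Icc 0 1) Real.smoothTransition.continuous.continuousOn
    fun x hx => deriv_smoothTransition_pos (by rwa [interior_Icc] at hx)

theorem smoothTransition_eq_of_lt {x y : ℝ} (hxy : x < y)
    (h : Real.smoothTransition x = Real.smoothTransition y) : y ≤ 0 ∨ 1 ≤ x := by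
  by_contra! hcon
  have hx : Real.smoothTransition (max 0 x) = Real.smoothTransition x := by
    rcases le_total 0 x with h0 | h0
    · rw [max_eq_right h0]
    · rw [max_eq_left h0, Real.smoothTransition.zero, Real.smoothTransition.zero_of_nonpos h0]
  have hy : Real.smoothTransition (min 1 y) = Real.smoothTransition y := by
    rcases le_total 1 y with h0 | h0
    · rw [min_eq_left h0, Real.smoothTransition.one, Real.smoothTransition.one_of_one_le h0]
    · rw [min_eq_right h0]
  have hlt : max 0 x < min 1 y :=
    max_lt (lt_min zero_lt_one hcon.1) (lt_min hcon.2 hxy)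
  have := strictMonoOn_smoothTransition ⟨le_max_left _ _, hlt.le.trans (min_le_left _ _)⟩
    ⟨(le_max_left 0 x).trans hlt.le, min_le_left _ _⟩ hlt
  rw [hx, hy, h] at this
  exact lt_irrefl _ this

/-! ### The closure of `σ₁ σ₂⁻¹` -/

/-- A smooth monotone step function with plateaus at `-1/2`, `0` and `1/2`. -/
def threeSteps (c : ℝ) : ℝ :=
  -1 / 2 + Real.smoothTransition (5 / 2 * (c - 3 / 10)) / 2 +
    Real.smoothTransition (5 / 2 * (c + 7 / 10)) / 2

theorem contDiff_threeSteps : ContDiff ℝ ∞ threeSteps :=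
  (contDiff_const.add ((Real.smoothTransition.contDiff.comp
    (contDiff_const.mul (contDiff_id.sub contDiff_const))).div_const 2)).add
    ((Real.smoothTransition.contDiff.comp
      (contDiff_const.mul (contDiff_id.add contDiff_const))).div_const 2)

theorem threeSteps_of_ge {c : ℝ} (hc : 7 / 10 ≤ c) : threeSteps c = 1 / 2 := by
  rw [threeSteps, Real.smoothTransition.one_of_one_le (by linarith),
    Real.smoothTransition.one_of_one_le (by linarith)]
  norm_num

theorem threeSteps_of_le {c : ℝ} (hc : c ≤ -7 / 10) : threeSteps c = -1 / 2 := by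
  rw [threeSteps, Real.smoothTransition.zero_of_nonpos (by linarith),
    Real.smoothTransition.zero_of_nonpos (by linarith)]
  norm_num

theorem threeSteps_of_abs_le {c : ℝ} (hc : |c| ≤ 3 / 10) : threeSteps c = 0 := by
  have := abs_le.1 hc
  rw [threeSteps, Real.smoothTransition.zero_of_nonpos (by linarith),
    Real.smoothTransition.one_of_one_le (by linarith)]
  norm_num

theorem abs_threeSteps_le (c : ℝ) : |threeSteps c| ≤ 1 / 2 := by
  have h1 := Real.smoothTransition.nonneg (5 / 2 * (c - 3 / 10))
  have h2 := Real.smoothTransition.nonneg (5 / 2 * (c + 7 / 10))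
  have h3 := Real.smoothTransition.le_one (5 / 2 * (c - 3 / 10))
  have h4 := Real.smoothTransition.le_one (5 / 2 * (c + 7 / 10))
  rw [threeSteps, abs_le]
  constructor <;> linarith

theorem threeSteps_eq_of_lt {c d : ℝ} (hcd : c < d) (h : threeSteps c = threeSteps d) :
    d ≤ -7 / 10 ∨ (-3 / 10 ≤ c ∧ d ≤ 3 / 10) ∨ 7 / 10 ≤ c := by
  have m1 := Real.smoothTransition.monotone
    (show 5 / 2 * (c - 3 / 10) ≤ 5 / 2 * (d - 3 / 10) by linarith)
  have m2 := Real.smoothTransition.monotone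
    (show 5 / 2 * (c + 7 / 10) ≤ 5 / 2 * (d + 7 / 10) by linarith)
  simp only [threeSteps] at h
  have e1 := smoothTransition_eq_of_lt
    (show 5 / 2 * (c - 3 / 10) < 5 / 2 * (d - 3 / 10) by linarith) (by linarith)
  have e2 := smoothTransition_eq_of_lt
    (show 5 / 2 * (c + 7 / 10) < 5 / 2 * (d + 7 / 10) by linarith) (by linarith)
  rcases e1 with e1 | e1
  · rcases e2 with e2 | e2
    · exact Or.inl (by linarith)
    · exact Or.inr (Or.inl ⟨by linarith, by linarith⟩)
  · exact Or.inr (Or.inr (by linarith))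

theorem deriv_threeSteps_pos {c : ℝ} (hc : c = 1 / 2 ∨ c = -1 / 2) : 0 < deriv threeSteps c := by
  have hd : ∀ x, HasDerivAt Real.smoothTransition (deriv Real.smoothTransition x) x := fun x =>
    ((Real.smoothTransition.contDiff (n := 1)).differentiable (by norm_num)).differentiableAt.hasDerivAt
  have h1 : HasDerivAt (fun c : ℝ => 5 / 2 * (c - 3 / 10)) (5 / 2) c := by
    simpa using ((hasDerivAt_id c).sub_const (3 / 10)).const_mul (5 / 2)
  have h2 : HasDerivAt (fun c : ℝ => 5 / 2 * (c + 7 / 10)) (5 / 2) c := by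
    simpa using ((hasDerivAt_id c).add_const (7 / 10)).const_mul (5 / 2)
  have h3 : HasDerivAt threeSteps _ c :=
    ((((hd _).comp c h1).div_const 2).const_add (-1 / 2)).add (((hd _).comp c h2).div_const 2)
  rw [h3.deriv]
  have n1 := deriv_smoothTransition_nonneg (5 / 2 * (c - 3 / 10))
  have n2 := deriv_smoothTransition_nonneg (5 / 2 * (c + 7 / 10))
  rcases hc with rfl | rfl
  · have : 0 < deriv Real.smoothTransition (5 / 2 * (1 / 2 - 3 / 10)) :=
      deriv_smoothTransition_pos (by norm_num)
    linarith
  · have : 0 < deriv Real.smoothTransition (5 / 2 * (-1 / 2 + 7 / 10)) :=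
      deriv_smoothTransition_pos (by norm_num)
    linarith

/-- The closed braid `σ₁ σ₂⁻¹` in closed form. -/
def baseX (t : ℝ) : ℝ := threeSteps (Real.cos (2 * Real.pi * t))

theorem contDiff_baseX : ContDiff ℝ ∞ baseX :=
  contDiff_threeSteps.comp (Real.contDiff_cos.comp (contDiff_const.mul contDiff_id))

theorem baseX_add_int (t : ℝ) (m : ℤ) : baseX (t + m) = baseX t := by
  rw [baseX, baseX, ← Real.cos_add_int_mul_two_pi (2 * Real.pi * t) m]
  ring_nf

theorem baseX_neg (t : ℝ) : baseX (-t) = baseX t := by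
  rw [baseX, baseX, mul_neg, Real.cos_neg]

theorem baseX_eq_iff {t : ℝ} : baseX t = baseX (t + 1 / 3) ↔ ∃ m : ℤ, t = m / 2 - 1 / 6 := by
  constructor
  · intro h
    -- the two cosines are `cos (β ∓ π / 3)`, where `β = 2 π t + π / 3`
    set β := 2 * Real.pi * t + Real.pi / 3 with hβ
    have e1 : Real.cos (2 * Real.pi * t) = Real.cos β / 2 + √3 / 2 * Real.sin β := by
      have : 2 * Real.pi * t = β - Real.pi / 3 := by rw [hβ]; ring
      rw [this, Real.cos_sub, Real.cos_pi_div_three, Real.sin_pi_div_three]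
      ring
    have e2 : Real.cos (2 * Real.pi * (t + 1 / 3)) = Real.cos β / 2 - √3 / 2 * Real.sin β := by
      have : 2 * Real.pi * (t + 1 / 3) = β + Real.pi / 3 := by rw [hβ]; ring
      rw [this, Real.cos_add, Real.cos_pi_div_three, Real.sin_pi_div_three]
      ring
    have h3 : √3 ^ 2 = 3 := Real.sq_sqrt (by norm_num)
    have hs := Real.sin_sq_add_cos_sq β
    set c := Real.cos (2 * Real.pi * t)
    set d := Real.cos (2 * Real.pi * (t + 1 / 3))
    have hq : (c + d) ^ 2 + (c - d) ^ 2 / 3 = 1 := by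
      rw [e1, e2]
      linear_combination hs + Real.sin β ^ 2 / 3 * h3
    have key : ∀ {c d : ℝ}, (c + d) ^ 2 + (c - d) ^ 2 / 3 = 1 → c < d →
        threeSteps c ≠ threeSteps d := by
      intro c d hq hlt heq
      rcases threeSteps_eq_of_lt hlt heq with h | ⟨h, h'⟩ | h <;> nlinarith
    have hcd : c = d := by
      rcases lt_trichotomy c d with hlt | heq | hlt
      · exact absurd h (key hq hlt)
      · exact heq
      · exact absurd h.symm (key (by linarith) hlt)
    have hsin : Real.sin β = 0 := by
      have h4 : √3 * Real.sin β = 0 := by linarith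
      exact (mul_eq_zero.1 h4).resolve_left (by positivity)
    obtain ⟨m, hm⟩ := Real.sin_eq_zero_iff.1 hsin
    refine ⟨m, ?_⟩
    have h5 : Real.pi * m = Real.pi * (2 * t + 1 / 3) := by rw [mul_comm, hm, hβ]; ring
    have := mul_left_cancel₀ Real.pi_ne_zero h5
    linarith
  · rintro ⟨m, rfl⟩
    have e : (m / 2 - 1 / 6 + 1 / 3 : ℝ) = -(m / 2 - 1 / 6) + m := by ring
    rw [e, baseX_add_int, baseX_neg]

theorem deriv_baseX_add_int (t : ℝ) (m : ℤ) : deriv baseX (t + m) = deriv baseX t := by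
  have h : (fun x => baseX (x + m)) = baseX := funext fun x => baseX_add_int x m
  rw [← deriv_comp_add_const, h]

theorem deriv_baseX_ne {t : ℝ} (h : baseX t = baseX (t + 1 / 3)) :
    deriv baseX t ≠ deriv baseX (t + 1 / 3) := by
  obtain ⟨m, rfl⟩ := baseX_eq_iff.1 h
  -- the curve is even, so that the two slopes at a crossing are opposite
  have e : (m / 2 - 1 / 6 + 1 / 3 : ℝ) = -(m / 2 - 1 / 6) + m := by ring
  have hneg : ∀ t, deriv baseX (-t) = -deriv baseX t := fun t => by
    have h1 : (fun x => baseX (-x)) = baseX := funext baseX_neg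
    have h2 := deriv_comp_neg baseX t
    rw [h1] at h2
    linarith
  rw [e, deriv_baseX_add_int, hneg]
  have hcos : Real.cos (2 * Real.pi * (m / 2 - 1 / 6)) = (-1) ^ m * (1 / 2) := by
    rw [← Real.cos_pi_div_three, ← Real.cos_int_mul_pi_sub]
    ring_nf
  have hcos2 : Real.cos (2 * Real.pi * (m / 2 - 1 / 6)) = 1 / 2 ∨
      Real.cos (2 * Real.pi * (m / 2 - 1 / 6)) = -1 / 2 := by
    rw [hcos]
    rcases Int.even_or_odd m with hm | hm
    · rw [hm.neg_one_zpow]; norm_num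
    · rw [hm.neg_one_zpow]; norm_num
  set t : ℝ := m / 2 - 1 / 6
  have hsin : Real.sin (2 * Real.pi * t) ≠ 0 := by
    intro h0
    have h1 := Real.sin_sq_add_cos_sq (2 * Real.pi * t)
    rcases hcos2 with h2 | h2 <;> rw [h0, h2] at h1 <;> norm_num at h1
  have h1 : HasDerivAt (fun x : ℝ => Real.cos (2 * Real.pi * x))
      (-Real.sin (2 * Real.pi * t) * (2 * Real.pi)) t := by
    simpa using ((hasDerivAt_id t).const_mul (2 * Real.pi)).cos
  have h2 : HasDerivAt baseX _ t :=
    ((contDiff_threeSteps.differentiable (by norm_num)).differentiableAt.hasDerivAt).comp t h1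
  have h3 : deriv baseX t ≠ 0 := by
    rw [h2.deriv]
    exact mul_ne_zero (deriv_threeSteps_pos hcos2).ne'
      (mul_ne_zero (neg_ne_zero.2 hsin) (by positivity))
  intro h4
  exact h3 (by linarith)

/-- The closure of the braid `σ₁ σ₂⁻¹`, with its alternating diagram with two crossings. -/
def baseBraid : ClosedBraid where
  X := baseX
  isOver t := ∃ m : ℤ, t = m / 2 - 1 / 6
  smooth := contDiff_baseX
  periodic t := by simpa using baseX_add_int t 1
  abs_lt t := (abs_threeSteps_le _).trans_lt (by norm_num)
  transverse _ := deriv_baseX_ne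
  no_triple t h1 h2 := by
    obtain ⟨m, hm⟩ := baseX_eq_iff.1 h1
    obtain ⟨n, hn⟩ := (baseX_eq_iff (t := t + 1 / 3)).1 (by rw [← h1, h2]; ring_nf)
    have h3 : (2 : ℝ) = 3 * (n - m) := by linarith
    have h4 : (2 : ℤ) = 3 * (n - m) := by exact_mod_cast h3
    omega
  over_periodic t := by
    constructor
    · rintro ⟨m, hm⟩
      exact ⟨m - 2, by push_cast; linarith⟩
    · rintro ⟨m, hm⟩
      exact ⟨m + 2, by push_cast; linarith⟩
  over_iff t h := by
    obtain ⟨m, rfl⟩ := baseX_eq_iff.1 h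
    refine iff_of_true ⟨m, rfl⟩ ?_
    rintro ⟨n, hn⟩
    have h3 : (2 : ℝ) = 3 * (n - m) := by linarith
    have h4 : (2 : ℤ) = 3 * (n - m) := by exact_mod_cast h3
    omega

theorem isCrossingParam_baseBraid {k : Fin 1} {t : ℝ} :
    baseBraid.toDiagram.IsCrossingParam k t ↔
      (∃ m : ℤ, t = m / 2 - 1 / 6) ∨ ∃ m : ℤ, t = m / 2 + 1 / 6 := by
  rw [baseBraid.isCrossingParam_iff]
  refine or_congr baseX_eq_iff ?_
  have h := baseX_eq_iff (t := t - 1 / 3)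
  rw [sub_add_cancel] at h
  refine h.trans ⟨?_, ?_⟩ <;> rintro ⟨m, hm⟩ <;> exact ⟨m, by linarith⟩

theorem isAlternating_baseBraid : baseBraid.toDiagram.IsAlternating := by
  intro k t u htu ht hu hno
  replace ht := isCrossingParam_baseBraid.1 ht
  replace hu := isCrossingParam_baseBraid.1 hu
  have hov : ∀ m : ℤ, baseBraid.isOver (m / 2 - 1 / 6) := fun m => ⟨m, rfl⟩
  have hun : ∀ m : ℤ, ¬ baseBraid.isOver (m / 2 + 1 / 6) := by
    rintro m ⟨n, hn⟩
    have h3 : (2 : ℝ) = 3 * (n - m) := by linarith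
    have h4 : (2 : ℤ) = 3 * (n - m) := by exact_mod_cast h3
    omega
  show baseBraid.isOver t ↔ ¬ baseBraid.isOver u
  rcases ht with ⟨m, rfl⟩ | ⟨m, rfl⟩ <;> rcases hu with ⟨n, rfl⟩ | ⟨n, rfl⟩
  · exfalso
    have h1 : (m : ℝ) < n := by linarith
    have h2 : m + 1 ≤ n := by exact_mod_cast h1
    have h3 : (m : ℝ) + 1 ≤ n := by exact_mod_cast h2
    exact hno (m / 2 + 1 / 6) ⟨by linarith, by linarith⟩ (isCrossingParam_baseBraid.2 (Or.inr ⟨m, rfl⟩))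
  · exact iff_of_true (hov m) (hun n)
  · exact iff_of_false (hun m) (not_not.2 (hov n))
  · exfalso
    have h1 : (m : ℝ) < n := by linarith
    have h2 : m + 1 ≤ n := by exact_mod_cast h1
    have h3 : (m : ℝ) + 1 ≤ n := by exact_mod_cast h2
    exact hno ((m + 1 : ℤ) / 2 - 1 / 6) ⟨by push_cast; linarith, by push_cast; linarith⟩
      (isCrossingParam_baseBraid.2 (Or.inl ⟨m + 1, rfl⟩))

/-! ### The closure of `σ₁ σ₂⁻¹` with the braid `σ₁² σ₂⁻²` inserted -/

theorem exists_smoothTransition_eq_quarter :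
    ∃ q ∈ Set.Ioo (0 : ℝ) (1 / 2), Real.smoothTransition q = 1 / 4 := by
  have h0 : Real.smoothTransition (1 / 2) = 1 / 2 := by
    have h := one_sub_smoothTransition (1 / 2)
    rw [show (1 : ℝ) - 1 / 2 = 1 / 2 by norm_num] at h
    linarith
  obtain ⟨q, hq, h⟩ := intermediate_value_Ioo (show (0 : ℝ) ≤ 1 / 2 by norm_num)
    Real.smoothTransition.continuous.continuousOn
    (show (1 / 4 : ℝ) ∈ Set.Ioo (Real.smoothTransition 0) (Real.smoothTransition (1 / 2)) by
      rw [h0, Real.smoothTransition.zero]; norm_num)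
  exact ⟨q, hq, h⟩

/-- The time at which a quarter of a full turn is made; then the two strands cross for the first
time. They cross again after three quarters of the turn, at the time `1 - quarterTime`. -/
def quarterTime : ℝ := exists_smoothTransition_eq_quarter.choose

theorem quarterTime_pos : 0 < quarterTime := exists_smoothTransition_eq_quarter.choose_spec.1.1

theorem quarterTime_lt : quarterTime < 1 / 2 := exists_smoothTransition_eq_quarter.choose_spec.1.2

theorem smoothTransition_quarterTime : Real.smoothTransition quarterTime = 1 / 4 :=
  exists_smoothTransition_eq_quarter.choose_spec.2

theorem smoothTransition_one_sub_quarterTime :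
    Real.smoothTransition (1 - quarterTime) = 3 / 4 := by
  rw [one_sub_smoothTransition, smoothTransition_quarterTime]
  norm_num

theorem eq_of_smoothTransition_eq {x y : ℝ} (hx : x ∈ Set.Ioo (0 : ℝ) 1)
    (h : Real.smoothTransition y = Real.smoothTransition x) : y = x := by
  rcases lt_trichotomy y x with hlt | heq | hlt
  · rcases smoothTransition_eq_of_lt hlt h with h1 | h1
    · exact absurd hx.1 (not_lt.2 h1)
    · linarith [hx.2]
  · exact heq
  · rcases smoothTransition_eq_of_lt hlt h.symm with h1 | h1
    · linarith [hx.1]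
    · exact absurd hx.2 (not_lt.2 h1)

theorem quarterTime_mem : quarterTime ∈ Set.Ioo (0 : ℝ) 1 :=
  ⟨quarterTime_pos, quarterTime_lt.trans (by norm_num)⟩

theorem one_sub_quarterTime_mem : 1 - quarterTime ∈ Set.Ioo (0 : ℝ) 1 :=
  ⟨by linarith [quarterTime_mem.2], by linarith [quarterTime_mem.1]⟩

theorem cos_turn_eq_zero_iff {y : ℝ} : Real.cos (2 * Real.pi * Real.smoothTransition y) = 0 ↔
    y = quarterTime ∨ y = 1 - quarterTime := by
  constructor
  · intro h
    obtain ⟨k, hk⟩ := Real.cos_eq_zero_iff.1 h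
    have h1 : Real.pi * (4 * Real.smoothTransition y) = Real.pi * (2 * k + 1) := by linarith
    have h2 := mul_left_cancel₀ Real.pi_ne_zero h1
    have h3 := Real.smoothTransition.nonneg y
    have h4 := Real.smoothTransition.le_one y
    have h5 : (-1 : ℝ) < k := by linarith
    have h6 : (k : ℝ) < 2 := by linarith
    have h5' : -1 < k := by exact_mod_cast h5
    have h6' : k < 2 := by exact_mod_cast h6
    have hk2 : k = 0 ∨ k = 1 := by omega
    rcases hk2 with rfl | rfl
    · refine Or.inl (eq_of_smoothTransition_eq quarterTime_mem ?_)
      rw [smoothTransition_quarterTime]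
      push_cast at h2
      linarith
    · refine Or.inr (eq_of_smoothTransition_eq one_sub_quarterTime_mem ?_)
      rw [smoothTransition_one_sub_quarterTime]
      push_cast at h2
      linarith
  · rintro (rfl | rfl)
    · rw [smoothTransition_quarterTime, Real.cos_eq_zero_iff]
      exact ⟨0, by push_cast; ring⟩
    · rw [smoothTransition_one_sub_quarterTime, Real.cos_eq_zero_iff]
      exact ⟨1, by push_cast; ring⟩

theorem sin_quarterTime : Real.sin (2 * Real.pi * Real.smoothTransition quarterTime) = 1 := by
  rw [smoothTransition_quarterTime, show 2 * Real.pi * (1 / 4) = Real.pi / 2 by ring,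
    Real.sin_pi_div_two]

theorem sin_one_sub_quarterTime :
    Real.sin (2 * Real.pi * Real.smoothTransition (1 - quarterTime)) = -1 := by
  rw [smoothTransition_one_sub_quarterTime,
    show 2 * Real.pi * (3 / 4) = Real.pi / 2 + Real.pi by ring, Real.sin_add_pi,
    Real.sin_pi_div_two]

theorem cos_twistAngle₁_eq_zero_iff {s : ℝ} : Real.cos (twistAngle₁ s) = 0 ↔
    s = (quarterTime - 2) / 3 ∨ s = -(1 + quarterTime) / 3 := by
  rw [twistAngle₁, cos_turn_eq_zero_iff]
  constructor <;> rintro (h | h) <;> [left; right; left; right] <;> linarith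

theorem cos_twistAngle₂_eq_zero_iff {s : ℝ} : Real.cos (twistAngle₂ s) = 0 ↔
    s = (1 + quarterTime) / 3 ∨ s = (2 - quarterTime) / 3 := by
  rw [twistAngle₂, cos_turn_eq_zero_iff]
  constructor <;> rintro (h | h) <;> [left; right; left; right] <;> linarith

theorem twistedStrand_zero_eq_one_iff {s : ℝ} : twistedStrand 0 s = twistedStrand 1 s ↔
    s = (quarterTime - 2) / 3 ∨ s = -(1 + quarterTime) / 3 := by
  rw [← cos_twistAngle₁_eq_zero_iff]
  have h1 := Real.cos_le_one (twistAngle₁ s)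
  have h2 : twistAngle₂ s = 0 ∨ twistAngle₁ s = 2 * Real.pi := twistAngle_cases s
  simp only [twistedStrand, Matrix.cons_val_zero, Matrix.cons_val_one]
  rcases h2 with h | h <;> simp only [h, Real.cos_zero, Real.cos_two_pi]
  · constructor <;> intro h3 <;> linarith
  · have h4 := Real.cos_le_one (twistAngle₂ s)
    constructor <;> intro h3 <;> linarith

theorem twistedStrand_one_eq_two_iff {s : ℝ} : twistedStrand 1 s = twistedStrand 2 s ↔
    s = (1 + quarterTime) / 3 ∨ s = (2 - quarterTime) / 3 := by
  rw [← cos_twistAngle₂_eq_zero_iff]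
  have h1 := Real.cos_le_one (twistAngle₁ s)
  have h2 : twistAngle₂ s = 0 ∨ twistAngle₁ s = 2 * Real.pi := twistAngle_cases s
  have e2 : twistedStrand 2 s = 1 / 4 + Real.cos (twistAngle₂ s) / 4 := rfl
  rw [e2]
  simp only [twistedStrand, Matrix.cons_val_one, Matrix.cons_val_zero]
  rcases h2 with h | h <;> simp only [h, Real.cos_zero, Real.cos_two_pi]
  · constructor <;> intro h3 <;> linarith
  · constructor <;> intro h3 <;> linarith

theorem twistedStrand_two_ne_zero (s : ℝ) : twistedStrand 2 s ≠ twistedStrand 0 s := by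
  have h1 := Real.neg_one_le_cos (twistAngle₁ s)
  have h2 := Real.neg_one_le_cos (twistAngle₂ s)
  have e2 : twistedStrand 2 s = 1 / 4 + Real.cos (twistAngle₂ s) / 4 := rfl
  have e0 : twistedStrand 0 s = -1 / 4 - Real.cos (twistAngle₁ s) / 4 := rfl
  rw [e2, e0]
  rcases twistAngle_cases s with h | h <;> simp only [h, Real.cos_zero, Real.cos_two_pi] <;>
    intro h3 <;> linarith

/-- The `1`-periodic function with copies of `g`, scaled by `1/24`, around the points `c/24 + m`; it is
smooth for smooth `g` with support in `[-2/3, 2/3]`. -/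
def periodize (g : ℝ → ℝ) (c t : ℝ) : ℝ := g (24 * (t - c / 24 - round (t - c / 24)))

theorem round_eq_of_abs_sub_lt {y : ℝ} {n : ℤ} (h : |y - n| < 1 / 2) : round y = n := by
  have h1 := abs_sub_round y
  have h2 : |((round y - n : ℤ) : ℝ)| < 1 := by
    push_cast
    rw [abs_le] at h1
    rw [abs_lt] at h ⊢
    constructor <;> linarith
  rw [← Int.cast_abs] at h2
  have h3 : |round y - n| < 1 := by exact_mod_cast h2
  have := Int.abs_lt_one_iff.1 h3
  omega

theorem periodize_eq (g : ℝ → ℝ) {c t s : ℝ} {n : ℤ} (h : 24 * t = c + 24 * n + s) (hs : |s| < 12) :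
    periodize g c t = g s := by
  have hr : round (t - c / 24) = n := by
    refine round_eq_of_abs_sub_lt ?_
    rw [show t - c / 24 - n = s / 24 by linarith, abs_div]
    norm_num
    linarith
  rw [periodize, hr]
  congr 1
  linarith

theorem periodize_eq_zero {g : ℝ → ℝ} (hg : ∀ s, 2 / 3 ≤ |s| → g s = 0) {c t : ℝ}
    (h : ∀ m : ℤ, 2 / 3 ≤ |24 * t - c - 24 * m|) : periodize g c t = 0 := by
  refine hg _ ?_
  convert h (round (t - c / 24)) using 2
  ring

theorem periodize_add_one (g : ℝ → ℝ) (c t : ℝ) : periodize g c (t + 1) = periodize g c t := by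
  rw [periodize, periodize, show t + 1 - c / 24 = t - c / 24 + 1 by ring, round_add_one]
  congr 1
  push_cast
  ring

theorem contDiff_periodize {g : ℝ → ℝ} (hg : ∀ s, 2 / 3 ≤ |s| → g s = 0) (hgs : ContDiff ℝ ∞ g)
    (c : ℝ) : ContDiff ℝ ∞ (periodize g c) := by
  rw [contDiff_iff_contDiffAt]
  intro t
  set y := t - c / 24 with hy
  rcases lt_or_ge |y - round y| (1 / 2) with h | h
  · have hev : ∀ᶠ t' in nhds t, |t' - c / 24 - round y| < 1 / 2 :=
      (isOpen_lt (by fun_prop) continuous_const).mem_nhds h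
    have hs : ContDiff ℝ ∞ fun t' : ℝ => g (24 * (t' - c / 24 - round y)) :=
      hgs.comp (contDiff_const.mul ((contDiff_id.sub contDiff_const).sub contDiff_const))
    refine hs.contDiffAt.congr_of_eventuallyEq (hev.mono fun t' ht' => ?_)
    rw [periodize, round_eq_of_abs_sub_lt ht']
  · have hev : ∀ᶠ t' in nhds t, |t' - t| < 1 / 4 := by
      refine (isOpen_lt (f := fun t' => |t' - t|) (by fun_prop) continuous_const).mem_nhds ?_
      simp
    refine (contDiffAt_const (c := (0 : ℝ))).congr_of_eventuallyEq (hev.mono fun t' ht' => ?_)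
    refine periodize_eq_zero hg fun m => ?_
    have h1 := h.trans (round_le y m)
    have h2 : |24 * (t' - c / 24 - m)| = 24 * |t' - c / 24 - m| := by rw [abs_mul]; norm_num
    rw [show 24 * t' - c - 24 * m = 24 * (t' - c / 24 - m) by ring, h2]
    have h3 : |y - m| ≤ |t' - c / 24 - m| + |t' - t| := by
      have := abs_sub_abs_le_abs_sub (y - m) (t' - c / 24 - m)
      rw [show y - m - (t' - c / 24 - m) = -(t' - t) by rw [hy]; ring, abs_neg] at this
      linarith
    linarith

/-- The strand of the closed braid that runs through the band for `24 t` near `2 + 8 n`. -/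
def bandStrand (n : ℤ) : Fin 3 := if n % 3 = 0 then 2 else if n % 3 = 1 then 0 else 1

theorem bandStrand_add_one (n : ℤ) : bandStrand (n + 1) = bandStrand n + 1 := by
  have h : n % 3 = 0 ∨ n % 3 = 1 ∨ n % 3 = 2 := by omega
  rcases h with h | h | h
  · have h' : (n + 1) % 3 = 1 := by omega
    simp [bandStrand, h, h']
  · have h' : (n + 1) % 3 = 2 := by omega
    simp [bandStrand, h, h']
  · have h' : (n + 1) % 3 = 0 := by omega
    simp [bandStrand, h, h']

theorem exists_bandStrand (n : ℤ) : ∃ m : ℤ,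
    (n = 3 * m ∧ bandStrand n = 2) ∨ (n = 3 * m + 1 ∧ bandStrand n = 0) ∨
      (n = 3 * m + 2 ∧ bandStrand n = 1) := by
  have h : n % 3 = 0 ∨ n % 3 = 1 ∨ n % 3 = 2 := by omega
  refine ⟨n / 3, ?_⟩
  rcases h with h | h | h
  · exact Or.inl ⟨by omega, by simp [bandStrand, h]⟩
  · exact Or.inr (Or.inl ⟨by omega, by simp [bandStrand, h]⟩)
  · exact Or.inr (Or.inr ⟨by omega, by simp [bandStrand, h]⟩)

theorem seven_tenths_le_cos {s : ℝ} (hs : |s| < 1) : 7 / 10 ≤ Real.cos (Real.pi * (2 + s) / 12) := by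
  have h := abs_lt.1 hs
  have hp := Real.pi_pos
  have h1 : Real.cos (Real.pi / 4) ≤ Real.cos (Real.pi * (2 + s) / 12) :=
    Real.cos_le_cos_of_nonneg_of_le_pi (by nlinarith) (by linarith) (by nlinarith)
  have h2 : (7 / 10 : ℝ) ≤ √2 / 2 := by
    have : (7 / 5 : ℝ) ≤ √2 := Real.le_sqrt_of_sq_le (by norm_num)
    linarith
  rw [Real.cos_pi_div_four] at h1
  exact h2.trans h1

/-- In the band, the closed braid `σ₁ σ₂⁻¹` consists of three parallel strands. -/
theorem baseX_of_band {t s : ℝ} {n : ℤ} (h : 24 * t = 2 + 8 * n + s) (hs : |s| < 1) :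
    baseX t = strandLevel (bandStrand n) := by
  obtain ⟨m, ⟨hn, hb⟩ | ⟨hn, hb⟩ | ⟨hn, hb⟩⟩ := exists_bandStrand n <;> rw [hb, baseX]
  · rw [threeSteps_of_ge]
    · rfl
    · have e : 2 * Real.pi * t = Real.pi * (2 + s) / 12 + m * (2 * Real.pi) := by
        rw [hn] at h
        push_cast at h
        linear_combination Real.pi / 12 * h
      rw [e, Real.cos_add_int_mul_two_pi]
      exact seven_tenths_le_cos hs
  · rw [threeSteps_of_le]
    · rfl
    · have e : 2 * Real.pi * t = Real.pi - Real.pi * (2 + -s) / 12 + m * (2 * Real.pi) := by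
        rw [hn] at h
        push_cast at h
        linear_combination Real.pi / 12 * h
      rw [e, Real.cos_add_int_mul_two_pi, Real.cos_pi_sub]
      have := seven_tenths_le_cos (s := -s) (by rwa [abs_neg])
      linarith
  · rw [threeSteps_of_abs_le]
    · rfl
    · have e : 2 * Real.pi * t = -(Real.pi / 2 - Real.pi * s / 12) + (m + 1 : ℤ) * (2 * Real.pi) := by
        rw [hn] at h
        push_cast at h ⊢
        linear_combination Real.pi / 12 * h
      rw [e, Real.cos_add_int_mul_two_pi, Real.cos_neg, Real.cos_pi_div_two_sub]
      refine Real.abs_sin_le_abs.trans ?_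
      rw [abs_div, abs_mul, abs_of_pos Real.pi_pos, abs_of_pos (show (0 : ℝ) < 12 by norm_num)]
      have := Real.pi_lt_d2
      have h2 := abs_nonneg s
      have h3 := Real.pi_pos
      nlinarith

/-- The difference of a strand of `σ₁² σ₂⁻²` and a parallel strand. -/
def strandShift (i : Fin 3) (s : ℝ) : ℝ := twistedStrand i s - strandLevel i

theorem strandShift_of_ends (i : Fin 3) (s : ℝ) (hs : 2 / 3 ≤ |s|) : strandShift i s = 0 := by
  rw [strandShift, (twisted_of_ends i hs).1, sub_self]

theorem contDiff_strandShift (i : Fin 3) : ContDiff ℝ ∞ (strandShift i) :=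
  (contDiff_twistedStrand i).sub contDiff_const

/-- The closed braid `σ₁ σ₂⁻¹` with `σ₁² σ₂⁻²` inserted in the band. -/
def insertedX (t : ℝ) : ℝ :=
  baseX t + periodize (strandShift 2) 2 t + periodize (strandShift 0) 10 t +
    periodize (strandShift 1) 18 t

theorem contDiff_insertedX : ContDiff ℝ ∞ insertedX :=
  ((contDiff_baseX.add (contDiff_periodize (strandShift_of_ends 2) (contDiff_strandShift 2) 2)).add
    (contDiff_periodize (strandShift_of_ends 0) (contDiff_strandShift 0) 10)).add
    (contDiff_periodize (strandShift_of_ends 1) (contDiff_strandShift 1) 18)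

theorem insertedX_add_one (t : ℝ) : insertedX (t + 1) = insertedX t := by
  have h := baseX_add_int t 1
  rw [Int.cast_one] at h
  simp only [insertedX, periodize_add_one, h]

theorem insertedX_of_band {t s : ℝ} {n : ℤ} (h : 24 * t = 2 + 8 * n + s) (hs : |s| < 1) :
    insertedX t = twistedStrand (bandStrand n) s := by
  have hs' := abs_lt.1 hs
  have hfar1 : ∀ i, strandShift i (s + 8) = 0 := fun i =>
    strandShift_of_ends i _ (le_abs.2 (Or.inl (by linarith)))
  have hfar2 : ∀ i, strandShift i (s - 8) = 0 := fun i =>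
    strandShift_of_ends i _ (le_abs.2 (Or.inr (by linarith)))
  have hs0 : |s| < 12 := by linarith
  have hs1 : |s + 8| < 12 := abs_lt.2 ⟨by linarith, by linarith⟩
  have hs2 : |s - 8| < 12 := abs_lt.2 ⟨by linarith, by linarith⟩
  rw [insertedX, baseX_of_band h hs]
  obtain ⟨m, ⟨hn, hb⟩ | ⟨hn, hb⟩ | ⟨hn, hb⟩⟩ := exists_bandStrand n <;> rw [hb] <;>
    rw [hn] at h <;> push_cast at h
  · rw [periodize_eq _ (n := m) (s := s) (by linarith) hs0,
      periodize_eq _ (n := m) (s := s - 8) (by linarith) hs2,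
      periodize_eq _ (n := m - 1) (s := s + 8) (by push_cast; linarith) hs1, hfar1, hfar2,
      strandShift]
    ring
  · rw [periodize_eq _ (n := m) (s := s + 8) (by linarith) hs1,
      periodize_eq _ (n := m) (s := s) (by linarith) hs0,
      periodize_eq _ (n := m) (s := s - 8) (by linarith) hs2, hfar1, hfar2,
      strandShift]
    ring
  · rw [periodize_eq _ (n := m + 1) (s := s - 8) (by push_cast; linarith) hs2,
      periodize_eq _ (n := m) (s := s + 8) (by linarith) hs1,
      periodize_eq _ (n := m) (s := s) (by linarith) hs0, hfar1, hfar2,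
      strandShift]
    ring

theorem insertedX_of_notBand {t : ℝ} (h : ∀ n : ℤ, 2 / 3 ≤ |24 * t - 2 - 8 * n|) :
    insertedX t = baseX t := by
  rw [insertedX, periodize_eq_zero (strandShift_of_ends 2) fun m => ?_,
    periodize_eq_zero (strandShift_of_ends 0) fun m => ?_,
    periodize_eq_zero (strandShift_of_ends 1) fun m => ?_]
  · ring
  · convert h (3 * m + 2) using 2; push_cast; ring
  · convert h (3 * m + 1) using 2; push_cast; ring
  · convert h (3 * m) using 2; push_cast; ring

theorem abs_insertedX_lt (t : ℝ) : |insertedX t| < 1 := by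
  by_cases h : ∀ n : ℤ, 2 / 3 ≤ |24 * t - 2 - 8 * n|
  · rw [insertedX_of_notBand h]
    exact baseBraid.abs_lt t
  · push Not at h
    obtain ⟨n, hn⟩ := h
    rw [insertedX_of_band (n := n) (s := 24 * t - 2 - 8 * n) (by ring) (by linarith)]
    refine (sq_lt_one_iff_abs_lt_one _).1 ?_
    have := twisted_sq_lt (bandStrand n) (24 * t - 2 - 8 * n)
    nlinarith [sq_nonneg (twistedHeight (bandStrand n) (24 * t - 2 - 8 * n))]

/-- The crossings of `σ₁ σ₂⁻¹` are far away from the band. -/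
theorem two_le_abs_sub (m n : ℤ) : (2 : ℝ) ≤ |12 * (m : ℝ) - 4 - 2 - 8 * (n : ℝ)| := by
  have h : (2 : ℤ) ≤ |12 * m - 4 - 2 - 8 * n| := by
    rw [le_abs]
    omega
  exact_mod_cast h

theorem insertedX_eq_iff {t : ℝ} : insertedX t = insertedX (t + 1 / 3) ↔
    (∃ m : ℤ, t = m / 2 - 1 / 6) ∨ ∃ (n : ℤ) (s : ℝ), |s| < 1 ∧ 24 * t = 2 + 8 * n + s ∧
      twistedStrand (bandStrand n) s = twistedStrand (bandStrand n + 1) s := by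
  have hband : ∀ (n : ℤ) (s : ℝ), |s| < 1 → 24 * t = 2 + 8 * n + s →
      (insertedX t = insertedX (t + 1 / 3) ↔
        twistedStrand (bandStrand n) s = twistedStrand (bandStrand n + 1) s) := by
    intro n s hs h
    rw [insertedX_of_band h hs, insertedX_of_band (n := n + 1) (s := s) (by push_cast; linarith) hs,
      bandStrand_add_one]
  have hout : (∀ n : ℤ, 2 / 3 ≤ |24 * t - 2 - 8 * n|) →
      (insertedX t = insertedX (t + 1 / 3) ↔ ∃ m : ℤ, t = m / 2 - 1 / 6) := by
    intro h
    rw [insertedX_of_notBand h, insertedX_of_notBand (t := t + 1 / 3), baseX_eq_iff]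
    intro n
    convert h (n - 1) using 2
    push_cast
    ring
  constructor
  · intro heq
    by_cases h : ∀ n : ℤ, 2 / 3 ≤ |24 * t - 2 - 8 * n|
    · exact Or.inl ((hout h).1 heq)
    · push Not at h
      obtain ⟨n, hn⟩ := h
      have h1 : |24 * t - 2 - 8 * n| < 1 := by linarith
      exact Or.inr ⟨n, 24 * t - 2 - 8 * n, h1, by ring, (hband n _ h1 (by ring)).1 heq⟩
  · rintro (⟨m, hm⟩ | ⟨n, s, hs, h, heq⟩)
    · refine (hout fun n => ?_).2 ⟨m, hm⟩
      have := two_le_abs_sub m n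
      rw [show 24 * t - 2 - 8 * n = 12 * m - 4 - 2 - 8 * n by rw [hm]; ring]
      linarith
    · exact (hband n s hs h).2 heq

/-! ### The crossings of the closed braid with `σ₁² σ₂⁻²` inserted -/

/-- The parameters, in units of `1/24`, at which the closed braid `insertedX` runs through a
crossing in the period `[0,1)`. -/
def crossingPos (r : ℤ) : ℝ :=
  if r = 0 then 2 + (1 + quarterTime) / 3 else if r = 1 then 2 + (2 - quarterTime) / 3 else
  if r = 2 then 4 else if r = 3 then 8 else
  if r = 4 then 10 + (quarterTime - 2) / 3 else if r = 5 then 10 - (1 + quarterTime) / 3 else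
  if r = 6 then 16 else
  if r = 7 then 18 + (quarterTime - 2) / 3 else if r = 8 then 18 - (1 + quarterTime) / 3 else
  if r = 9 then 18 + (1 + quarterTime) / 3 else if r = 10 then 18 + (2 - quarterTime) / 3 else 20

/-- The parameters at which the closed braid `insertedX` runs through a crossing, in their order. -/
def crossingParam (j : ℤ) : ℝ := (j / 12 : ℤ) + crossingPos (j % 12) / 24

theorem crossingParam_mul_add (m : ℤ) {r : ℤ} (h0 : 0 ≤ r) (h1 : r < 12) :
    crossingParam (12 * m + r) = m + crossingPos r / 24 := by
  rw [crossingParam, show (12 * m + r) / 12 = m by omega, show (12 * m + r) % 12 = r by omega]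

theorem exists_eq_mul_add (j : ℤ) : ∃ m r : ℤ, 0 ≤ r ∧ r < 12 ∧ j = 12 * m + r :=
  ⟨j / 12, j % 12, by omega, by omega, by omega⟩

theorem crossingParam_add_twelve (j : ℤ) : crossingParam (j + 12) = crossingParam j + 1 := by
  rw [crossingParam, crossingParam, show (j + 12) / 12 = j / 12 + 1 by omega,
    show (j + 12) % 12 = j % 12 by omega]
  push_cast
  ring

theorem strictMono_crossingParam : StrictMono crossingParam := by
  refine strictMono_int_of_lt_succ fun j => ?_
  obtain ⟨m, r, h0, h1, rfl⟩ := exists_eq_mul_add j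
  have q0 := quarterTime_pos
  have q1 := quarterTime_lt
  by_cases h : r = 11
  · subst h
    rw [show 12 * m + 11 + 1 = 12 * (m + 1) + 0 by ring, crossingParam_mul_add _ h0 h1,
      crossingParam_mul_add _ le_rfl (by norm_num)]
    norm_num [crossingPos]
    linarith
  · rw [add_assoc, crossingParam_mul_add _ h0 h1, crossingParam_mul_add _ (by omega) (by omega)]
    have h2 : r < 11 := by omega
    have h3 : crossingPos r < crossingPos (r + 1) := by
      clear h h1
      interval_cases r <;> norm_num [crossingPos] <;> linarith
    linarith

/-- The second half of each half period is the first one, moved by `1/3`. -/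
theorem crossingParam_add_three {j : ℤ} (hj : 3 ≤ j % 6) :
    crossingParam (j + 3) = crossingParam j + 1 / 3 := by
  obtain ⟨m, r, h0, h1, rfl⟩ := exists_eq_mul_add j
  have hr : 3 ≤ r % 6 := by omega
  by_cases h : r < 9
  · have h2 : crossingPos (r + 3) = crossingPos r + 8 := by
      have h3 : 3 ≤ r := by omega
      have h4 : r < 6 := by omega
      clear hj hr h h0 h1
      interval_cases r <;> norm_num [crossingPos] <;> ring
    rw [add_assoc, crossingParam_mul_add _ h0 h1, crossingParam_mul_add _ (by omega) (by omega), h2]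
    ring
  · have h2 : crossingPos (r - 9) + 24 = crossingPos r + 8 := by
      have h3 : 9 ≤ r := by omega
      clear hj hr h h0
      interval_cases r <;> norm_num [crossingPos] <;> ring
    rw [show 12 * m + r + 3 = 12 * (m + 1) + (r - 9) by ring, crossingParam_mul_add _ h0 h1,
      crossingParam_mul_add _ (by omega) (by omega)]
    push_cast
    linarith

theorem insertedX_eq_iff_exists_crossingParam {t : ℝ} :
    insertedX t = insertedX (t + 1 / 3) ↔ ∃ j : ℤ, 3 ≤ j % 6 ∧ t = crossingParam j := by
  have hval : ∀ (m : ℤ) {r : ℤ} {x : ℝ}, 0 ≤ r → r < 12 → crossingPos r = x → 24 * t = 24 * m + x →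
      t = crossingParam (12 * m + r) := by
    intro m r x h0 h1 hx h
    rw [crossingParam_mul_add m h0 h1, hx]
    linarith
  rw [insertedX_eq_iff]
  constructor
  · rintro (⟨m, hm⟩ | ⟨n, s, -, h, heq⟩)
    · rcases Int.even_or_odd' m with ⟨k, rfl | rfl⟩
      · refine ⟨12 * (k - 1) + 11, by omega, hval _ (x := 20) (by norm_num) (by norm_num)
          (by norm_num [crossingPos]) ?_⟩
        push_cast at hm ⊢
        linarith
      · refine ⟨12 * k + 3, by omega, hval _ (x := 8) (by norm_num) (by norm_num)
          (by norm_num [crossingPos]) ?_⟩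
        push_cast at hm ⊢
        linarith
    · obtain ⟨m, ⟨hn, hb⟩ | ⟨hn, hb⟩ | ⟨hn, hb⟩⟩ := exists_bandStrand n <;> rw [hb] at heq
      · exact absurd heq (twistedStrand_two_ne_zero s)
      · rcases twistedStrand_zero_eq_one_iff.1 heq with hs | hs
        · refine ⟨12 * m + 4, by omega, hval _ (x := 10 + (quarterTime - 2) / 3) (by norm_num)
            (by norm_num) (by norm_num [crossingPos]) ?_⟩
          rw [h, hn, hs]; push_cast; ring
        · refine ⟨12 * m + 5, by omega, hval _ (x := 10 - (1 + quarterTime) / 3) (by norm_num)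
            (by norm_num) (by norm_num [crossingPos]) ?_⟩
          rw [h, hn, hs]; push_cast; ring
      · rcases twistedStrand_one_eq_two_iff.1 heq with hs | hs
        · refine ⟨12 * m + 9, by omega, hval _ (x := 18 + (1 + quarterTime) / 3) (by norm_num)
            (by norm_num) (by norm_num [crossingPos]) ?_⟩
          rw [h, hn, hs]; push_cast; ring
        · refine ⟨12 * m + 10, by omega, hval _ (x := 18 + (2 - quarterTime) / 3) (by norm_num)
            (by norm_num) (by norm_num [crossingPos]) ?_⟩
          rw [h, hn, hs]; push_cast; ring
  · rintro ⟨j, hj, rfl⟩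
    obtain ⟨m, r, h0, h1, rfl⟩ := exists_eq_mul_add j
    have q0 := quarterTime_pos
    have q1 := quarterTime_lt
    have hr : r = 3 ∨ r = 4 ∨ r = 5 ∨ r = 9 ∨ r = 10 ∨ r = 11 := by omega
    have b0 : bandStrand (3 * m + 1) = 0 := by
      have : (3 * m + 1) % 3 = 1 := by omega
      simp [bandStrand, this]
    have b1 : bandStrand (3 * m + 2) = 1 := by
      have : (3 * m + 2) % 3 = 2 := by omega
      simp [bandStrand, this]
    rw [crossingParam_mul_add m h0 h1]
    rcases hr with rfl | rfl | rfl | rfl | rfl | rfl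
    · refine Or.inl ⟨2 * m + 1, ?_⟩
      norm_num [crossingPos]; ring
    · refine Or.inr ⟨3 * m + 1, (quarterTime - 2) / 3, abs_lt.2 ⟨by linarith, by linarith⟩, ?_, ?_⟩
      · norm_num [crossingPos]; ring
      · rw [b0]; exact twistedStrand_zero_eq_one_iff.2 (Or.inl rfl)
    · refine Or.inr ⟨3 * m + 1, -(1 + quarterTime) / 3, abs_lt.2 ⟨by linarith, by linarith⟩, ?_, ?_⟩
      · norm_num [crossingPos]; ring
      · rw [b0]; exact twistedStrand_zero_eq_one_iff.2 (Or.inr rfl)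
    · refine Or.inr ⟨3 * m + 2, (1 + quarterTime) / 3, abs_lt.2 ⟨by linarith, by linarith⟩, ?_, ?_⟩
      · norm_num [crossingPos]; ring
      · rw [b1]; exact twistedStrand_one_eq_two_iff.2 (Or.inl rfl)
    · refine Or.inr ⟨3 * m + 2, (2 - quarterTime) / 3, abs_lt.2 ⟨by linarith, by linarith⟩, ?_, ?_⟩
      · norm_num [crossingPos]; ring
      · rw [b1]; exact twistedStrand_one_eq_two_iff.2 (Or.inr rfl)
    · refine Or.inl ⟨2 * m + 2, ?_⟩
      norm_num [crossingPos]; ring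

/-- Overpasses are the crossing parameters with odd number. -/
def insertedOver (t : ℝ) : Prop := ∃ j : ℤ, Odd j ∧ t = crossingParam j

theorem insertedOver_crossingParam {j : ℤ} : insertedOver (crossingParam j) ↔ Odd j :=
  ⟨fun ⟨_, hi, h⟩ => strictMono_crossingParam.injective h ▸ hi, fun h => ⟨j, h, rfl⟩⟩

theorem hasDerivAt_twistAngle₁ (s : ℝ) : HasDerivAt twistAngle₁
    (2 * Real.pi * (deriv Real.smoothTransition (3 * s + 2) * 3)) s := by
  have h1 : HasDerivAt (fun s : ℝ => 3 * s + 2) 3 s := by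
    simpa using ((hasDerivAt_id s).const_mul 3).add_const 2
  have h2 := ((Real.smoothTransition.contDiff (n := 1)).differentiable
    (by norm_num)).differentiableAt.hasDerivAt (x := 3 * s + 2)
  exact (h2.comp s h1).const_mul (2 * Real.pi)

theorem hasDerivAt_twistAngle₂ (s : ℝ) : HasDerivAt twistAngle₂
    (2 * Real.pi * (deriv Real.smoothTransition (3 * s - 1) * 3)) s := by
  have h1 : HasDerivAt (fun s : ℝ => 3 * s - 1) 3 s := by
    simpa using ((hasDerivAt_id s).const_mul 3).sub_const 1
  have h2 := ((Real.smoothTransition.contDiff (n := 1)).differentiable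
    (by norm_num)).differentiableAt.hasDerivAt (x := 3 * s - 1)
  exact (h2.comp s h1).const_mul (2 * Real.pi)

theorem sin_ne_zero_of_cos_eq_zero {x : ℝ} (h : Real.cos x = 0) : Real.sin x ≠ 0 := by
  intro h0
  have := Real.sin_sq_add_cos_sq x
  rw [h, h0] at this
  norm_num at this

/-- Neighbouring strands of `σ₁² σ₂⁻²` cross transversely. -/
theorem deriv_twistedStrand_ne {i : Fin 3} {s : ℝ}
    (h : twistedStrand i s = twistedStrand (i + 1) s) :
    deriv (twistedStrand i) s ≠ deriv (twistedStrand (i + 1)) s := by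
  have hA := (hasDerivAt_twistAngle₁ s).cos
  have hB := (hasDerivAt_twistAngle₂ s).cos
  have e0 : HasDerivAt (twistedStrand 0) _ s := (hA.div_const 4).const_sub (-1 / 4)
  have e1 : HasDerivAt (twistedStrand 1) _ s := (hA.sub hB).div_const 4
  have e2 : HasDerivAt (twistedStrand 2) _ s := (hB.div_const 4).const_add (1 / 4)
  have q0 := quarterTime_pos
  have q1 := quarterTime_lt
  have hpi := Real.pi_pos
  have hi : i = 0 ∨ i = 1 ∨ i = 2 := by omega
  rcases hi with rfl | rfl | rfl
  · have h' : twistedStrand 0 s = twistedStrand 1 s := h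
    show deriv (twistedStrand 0) s ≠ deriv (twistedStrand 1) s
    have hs := twistedStrand_zero_eq_one_iff.1 h'
    have hc := sin_ne_zero_of_cos_eq_zero (cos_twistAngle₁_eq_zero_iff.2 hs)
    have hb : twistAngle₂ s = 0 := twistAngle₂_of_le (by rcases hs with h | h <;> linarith)
    have hd : 0 < deriv Real.smoothTransition (3 * s + 2) := deriv_smoothTransition_pos
      (by rcases hs with h | h <;> constructor <;> linarith)
    rw [e0.deriv, e1.deriv, hb, Real.sin_zero]
    intro h0
    have : Real.sin (twistAngle₁ s) * (Real.pi * deriv Real.smoothTransition (3 * s + 2)) = 0 := by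
      linear_combination h0 / 3
    exact (mul_ne_zero hc (mul_pos hpi hd).ne') this
  · have h' : twistedStrand 1 s = twistedStrand 2 s := h
    show deriv (twistedStrand 1) s ≠ deriv (twistedStrand 2) s
    have hs := twistedStrand_one_eq_two_iff.1 h'
    have hc := sin_ne_zero_of_cos_eq_zero (cos_twistAngle₂_eq_zero_iff.2 hs)
    have ha : twistAngle₁ s = 2 * Real.pi :=
      twistAngle₁_of_ge (by rcases hs with h | h <;> linarith)
    have hd : 0 < deriv Real.smoothTransition (3 * s - 1) := deriv_smoothTransition_pos
      (by rcases hs with h | h <;> constructor <;> linarith)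
    rw [e1.deriv, e2.deriv, ha, Real.sin_two_pi]
    intro h0
    have : Real.sin (twistAngle₂ s) * (Real.pi * deriv Real.smoothTransition (3 * s - 1)) = 0 := by
      linear_combination h0 / 3
    exact (mul_ne_zero hc (mul_pos hpi hd).ne') this
  · exact absurd h (twistedStrand_two_ne_zero s)

theorem deriv_insertedX_of_band {t s : ℝ} {n : ℤ} (h : 24 * t = 2 + 8 * n + s) (hs : |s| < 1) :
    deriv insertedX t = deriv (twistedStrand (bandStrand n)) s * 24 := by
  have hopen : ∀ᶠ t' : ℝ in nhds t, |24 * t' - 2 - 8 * n| < 1 := by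
    refine (isOpen_lt (f := fun t' : ℝ => |24 * t' - 2 - 8 * n|) (by fun_prop)
      continuous_const).mem_nhds ?_
    rw [Set.mem_ofPred_eq, show 24 * t - 2 - 8 * n = s by linarith]
    exact hs
  have hev : insertedX =ᶠ[nhds t] fun t' => twistedStrand (bandStrand n) (24 * t' - 2 - 8 * n) :=
    hopen.mono fun t' ht' => insertedX_of_band (by ring) ht'
  have h1 : HasDerivAt (fun t' : ℝ => 24 * t' - 2 - 8 * n) 24 t := by
    simpa using (((hasDerivAt_id t).const_mul 24).sub_const 2).sub_const (8 * (n : ℝ))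
  have h2 := ((contDiff_twistedStrand (bandStrand n)).differentiable
    (by norm_num)).differentiableAt.hasDerivAt (x := 24 * t - 2 - 8 * n)
  have h3 := h2.comp t h1
  rw [show 24 * t - 2 - 8 * n = s by linarith] at h3
  exact hev.deriv_eq.trans h3.deriv

theorem deriv_insertedX_of_notBand {t : ℝ} (h : ∀ n : ℤ, 2 ≤ |24 * t - 2 - 8 * n|) :
    deriv insertedX t = deriv baseX t := by
  have hopen : ∀ᶠ t' in nhds t, |t' - t| < 1 / 24 := by
    refine (isOpen_lt (f := fun t' : ℝ => |t' - t|) (by fun_prop) continuous_const).mem_nhds ?_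
    simp
  refine Filter.EventuallyEq.deriv_eq (hopen.mono fun t' ht' => insertedX_of_notBand fun n => ?_)
  have h1 := h n
  have h2 := abs_lt.1 ht'
  rcases le_abs.1 h1 with h3 | h3
  · exact le_abs.2 (Or.inl (by linarith))
  · exact le_abs.2 (Or.inr (by linarith))

/-- The closed braid `σ₁ σ₂⁻¹ σ₁² σ₂⁻²`, up to conjugation, with an alternating diagram with six
crossings. -/
def insertedBraid : ClosedBraid where
  X := insertedX
  isOver := insertedOver
  smooth := contDiff_insertedX
  periodic := insertedX_add_one
  abs_lt := abs_insertedX_lt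
  transverse t h := by
    rcases insertedX_eq_iff.1 h with ⟨m, rfl⟩ | ⟨n, s, hs, hn, heq⟩
    · rw [deriv_insertedX_of_notBand fun n => ?_, deriv_insertedX_of_notBand fun n => ?_]
      · exact deriv_baseX_ne (baseX_eq_iff.2 ⟨m, rfl⟩)
      · convert two_le_abs_sub m (n - 1) using 2; push_cast; ring
      · convert two_le_abs_sub m n using 2; ring
    · rw [deriv_insertedX_of_band hn hs,
        deriv_insertedX_of_band (n := n + 1) (s := s) (by push_cast; linarith) hs,
        bandStrand_add_one]
      intro h0
      exact deriv_twistedStrand_ne heq (by linarith)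
  no_triple t h1 h2 := by
    obtain ⟨i, hi, rfl⟩ := insertedX_eq_iff_exists_crossingParam.1 h1
    obtain ⟨j, hj, h⟩ := (insertedX_eq_iff_exists_crossingParam (t := crossingParam i + 1 / 3)).1
      (by rw [← h1, h2]; ring_nf)
    rw [← crossingParam_add_three hi] at h
    have := strictMono_crossingParam.injective h
    omega
  over_periodic t := by
    constructor
    · rintro ⟨j, hj, h⟩
      refine ⟨j - 12, hj.sub_even (by decide), ?_⟩
      have := crossingParam_add_twelve (j - 12)
      rw [sub_add_cancel] at this
      linarith
    · rintro ⟨j, hj, h⟩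
      exact ⟨j + 12, hj.add_even (by decide), by rw [crossingParam_add_twelve, h]⟩
  over_iff t h := by
    obtain ⟨j, hj, rfl⟩ := insertedX_eq_iff_exists_crossingParam.1 h
    rw [← crossingParam_add_three hj, insertedOver_crossingParam, insertedOver_crossingParam,
      Int.odd_add]
    have : ¬ Even (3 : ℤ) := by decide
    tauto

theorem isCrossingParam_insertedBraid {k : Fin 1} {t : ℝ} :
    insertedBraid.toDiagram.IsCrossingParam k t ↔ ∃ j : ℤ, t = crossingParam j := by
  rw [insertedBraid.isCrossingParam_iff]
  have h := insertedX_eq_iff_exists_crossingParam (t := t - 1 / 3)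
  rw [sub_add_cancel] at h
  rw [show insertedBraid.X = insertedX from rfl, h, insertedX_eq_iff_exists_crossingParam]
  constructor
  · rintro (⟨j, -, hj⟩ | ⟨j, hj, h⟩)
    · exact ⟨j, hj⟩
    · exact ⟨j + 3, by rw [crossingParam_add_three hj]; linarith⟩
  · rintro ⟨j, rfl⟩
    by_cases hj : 3 ≤ j % 6
    · exact Or.inl ⟨j, hj, rfl⟩
    · have h3 : 3 ≤ (j - 3) % 6 := by omega
      refine Or.inr ⟨j - 3, h3, ?_⟩
      have := crossingParam_add_three h3
      rw [sub_add_cancel] at this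
      linarith

theorem isAlternating_insertedBraid : insertedBraid.toDiagram.IsAlternating := by
  intro k t u htu ht hu hno
  obtain ⟨i, rfl⟩ := isCrossingParam_insertedBraid.1 ht
  obtain ⟨j, rfl⟩ := isCrossingParam_insertedBraid.1 hu
  have hij := strictMono_crossingParam.lt_iff_lt.1 htu
  have hj : j = i + 1 := by
    by_contra hne
    exact hno (crossingParam (i + 1)) ⟨strictMono_crossingParam (by omega),
      strictMono_crossingParam (by omega)⟩ (isCrossingParam_insertedBraid.2 ⟨i + 1, rfl⟩)
  show insertedOver (crossingParam i) ↔ ¬ insertedOver (crossingParam j)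
  rw [insertedOver_crossingParam, insertedOver_crossingParam, hj, Int.odd_add]
  have : ¬ Even (1 : ℤ) := by decide
  tauto

theorem crossings_ssubset :
    baseBraid.toDiagram.crossings ⊂ insertedBraid.toDiagram.crossings := by
  rw [Set.ssubset_iff_of_subset]
  · have hq0 := quarterTime_pos
    have hq1 := quarterTime_lt
    refine ⟨insertedBraid.curve (crossingParam 9), insertedBraid.mem_crossings_iff.2
      ⟨_, insertedX_eq_iff_exists_crossingParam.2 ⟨9, by norm_num, rfl⟩, rfl⟩, ?_⟩
    intro hmem
    obtain ⟨t, ht, h⟩ := baseBraid.mem_crossings_iff.1 hmem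
    obtain ⟨m, rfl⟩ := baseX_eq_iff.1 ht
    obtain ⟨n, hn⟩ := ClosedBraid.exp_eq_exp_iff.1 (congrArg Prod.fst h)
    have h9 : crossingParam 9 = (18 + (1 + quarterTime) / 3) / 24 := by
      norm_num [crossingParam, crossingPos]
    rw [h9] at hn
    have e : 12 * m + 8 * n - 22 = (1 + quarterTime) / 3 := by linarith
    have e1 : (0 : ℝ) < 12 * m + 8 * n - 22 := by rw [e]; linarith
    have e2 : (12 * m + 8 * n - 22 : ℝ) < 1 := by rw [e]; linarith
    have e1' : 0 < 12 * m + 8 * n - 22 := by exact_mod_cast e1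
    have e2' : 12 * m + 8 * n - 22 < 1 := by exact_mod_cast e2
    omega
  · intro z hz
    obtain ⟨t, ht, rfl⟩ := baseBraid.mem_crossings_iff.1 hz
    obtain ⟨m, hm⟩ := baseX_eq_iff.1 ht
    refine insertedBraid.mem_crossings_iff.2 ⟨t, insertedX_eq_iff.2 (Or.inl ⟨m, hm⟩), ?_⟩
    refine Prod.ext rfl (insertedX_of_notBand fun n => ?_)
    have := two_le_abs_sub m n
    rw [show 24 * t - 2 - 8 * n = 12 * (m : ℝ) - 4 - 2 - 8 * n by rw [hm]; ring]
    linarith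

theorem numCrossings_lt :
    baseBraid.toDiagram.numCrossings < insertedBraid.toDiagram.numCrossings :=
  Set.ncard_lt_ncard crossings_ssubset insertedBraid.toDiagram.finite_double

/-! ### The two closed braids differ by the band move -/

/-- The quarter of the annulus into which the braid is inserted. -/
def quarterBand (p : ℝ × ℝ) : Cyl := (Circle.exp (6 * Real.pi * ((2 + p.1) / 24)), p.2)

theorem isBand_quarterBand : IsBand quarterBand := by
  have hg : ∀ s : ℝ, HasDerivAt (fun s : ℝ => (Circle.exp (6 * Real.pi * ((2 + s) / 24)) : ℂ))
      (Complex.exp ((6 * Real.pi * ((2 + s) / 24) : ℝ) * Complex.I) *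
        ((Real.pi / 4 : ℝ) * Complex.I)) s := by
    intro s
    have h1 : HasDerivAt (fun s : ℝ => 6 * Real.pi * ((2 + s) / 24)) (Real.pi / 4) s := by
      have := (((hasDerivAt_id s).const_add 2).div_const 24).const_mul (6 * Real.pi)
      exact this.congr_deriv (by ring)
    simp only [Circle.coe_exp]
    exact (h1.ofReal_comp.mul_const Complex.I).cexp
  have hF : ∀ p : ℝ × ℝ, HasFDerivAt (fun q => (quarterBand q).coe)
      ((ContinuousLinearMap.toSpanSingleton ℝ
        (Complex.exp ((6 * Real.pi * ((2 + p.1) / 24) : ℝ) * Complex.I) *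
        ((Real.pi / 4 : ℝ) * Complex.I))).prodMap (.id ℝ ℝ)) p := fun p =>
    (hg p.1).hasFDerivAt.prodMap p (hasFDerivAt_id p.2)
  refine ⟨?_, fun p hp => ?_, ?_, fun p hp => abs_le.2 hp.2, fun p _ => Iff.rfl⟩
  · have e : (fun p => (quarterBand p).coe) = fun p : ℝ × ℝ =>
        (Complex.exp ((6 * Real.pi * ((2 + p.1) / 24) : ℝ) * Complex.I), p.2) := by
      funext p
      simp only [quarterBand, Cyl.coe, Circle.coe_exp]
    rw [e]
    exact (ContDiff.prodMk (ContDiff.cexp (ContDiff.mul (Complex.ofRealCLM.contDiff.comp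
      (contDiff_const.mul ((contDiff_const.add contDiff_fst).div_const 24))) contDiff_const))
      contDiff_snd).contDiffOn
  · rw [((hF p).hasFDerivWithinAt).fderivWithin (uniqueDiffOn_strip p hp)]
    rw [injective_iff_map_eq_zero]
    rintro ⟨a, b⟩ hab
    have h1 := congrArg Prod.fst hab
    have h2 : b = 0 := congrArg Prod.snd hab
    have h3 : a = 0 := by simpa [Real.pi_ne_zero] using h1
    rw [h2, h3]
    rfl
  · rintro ⟨s, x⟩ ⟨hs, -⟩ ⟨s', x'⟩ ⟨hs', -⟩ heq
    have h2 : x = x' := congrArg Prod.snd heq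
    obtain ⟨m, hm⟩ := ClosedBraid.exp_eq_exp_iff.1 (congrArg Prod.fst heq)
    simp only at hm hs hs'
    have h8 : s' - s = 8 * m := by linarith
    have e1 : (-1 : ℝ) < m := by linarith [hs.2, hs'.1]
    have e2 : (m : ℝ) < 1 := by linarith [hs.1, hs'.2]
    have e1' : -1 < m := by exact_mod_cast e1
    have e2' : m < 1 := by exact_mod_cast e2
    obtain rfl : m = 0 := by omega
    push_cast at h8
    rw [h2, show s = s' by linarith]

theorem curve_eq_quarterBand_iff (B : ClosedBraid) {t s x : ℝ} :
    B.curve t = quarterBand (s, x) ↔ (∃ n : ℤ, 24 * t = 2 + 8 * n + s) ∧ B.X t = x := by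
  have h : Circle.exp (6 * Real.pi * t) = Circle.exp (6 * Real.pi * ((2 + s) / 24)) ↔
      ∃ n : ℤ, 24 * t = 2 + 8 * n + s := by
    rw [ClosedBraid.exp_eq_exp_iff]
    constructor
    · rintro ⟨m, hm⟩
      exact ⟨-m, by push_cast; linarith⟩
    · rintro ⟨n, hn⟩
      exact ⟨-n, by push_cast; linarith⟩
  rw [← h]
  exact Prod.ext_iff

/-- At the crossings of the inserted braid, over and under are decided by the heights. -/
theorem insertedOver_iff_twistedHeight {i j : Fin 3} (hij : i ≠ j) {t s : ℝ} {n : ℤ}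
    (h : 24 * t = 2 + 8 * n + s) (hi : bandStrand n = i)
    (heq : twistedStrand i s = twistedStrand j s) :
    insertedOver t ↔ twistedHeight j s < twistedHeight i s := by
  have hval : ∀ (m : ℤ) {r : ℤ} {x : ℝ}, 0 ≤ r → r < 12 → crossingPos r = x → 24 * t = 24 * m + x →
      (insertedOver t ↔ Odd r) := by
    intro m r x h0 h1 hx h
    have ht : t = crossingParam (12 * m + r) := by
      rw [crossingParam_mul_add m h0 h1, hx]
      linarith
    rw [ht, insertedOver_crossingParam, Int.odd_add]
    have : Even (12 * m) := (by decide : Even (12 : ℤ)).mul_right m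
    rw [← Int.not_even_iff_odd, ← Int.not_even_iff_odd]
    tauto
  have hodd : ∀ {p : Prop} {r : ℤ}, (insertedOver t ↔ Odd r) → (Odd r ↔ p) → (insertedOver t ↔ p) :=
    fun h1 h2 => h1.trans h2
  have a0 : twistedHeight 0 s = -Real.sin (twistAngle₁ s) / 4 := rfl
  have a1 : twistedHeight 1 s = (Real.sin (twistAngle₁ s) + Real.sin (twistAngle₂ s)) / 4 := rfl
  have a2 : twistedHeight 2 s = -Real.sin (twistAngle₂ s) / 4 := rfl
  have q0 := quarterTime_pos
  have q1 := quarterTime_lt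
  have s1 : s = (quarterTime - 2) / 3 → Real.sin (twistAngle₁ s) = 1 ∧
      Real.sin (twistAngle₂ s) = 0 := by
    rintro rfl
    constructor
    · rw [twistAngle₁, show 3 * ((quarterTime - 2) / 3) + 2 = quarterTime by ring, sin_quarterTime]
    · rw [twistAngle₂_of_le (by linarith), Real.sin_zero]
  have s2 : s = -(1 + quarterTime) / 3 → Real.sin (twistAngle₁ s) = -1 ∧
      Real.sin (twistAngle₂ s) = 0 := by
    rintro rfl
    constructor
    · rw [twistAngle₁, show 3 * (-(1 + quarterTime) / 3) + 2 = 1 - quarterTime by ring,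
        sin_one_sub_quarterTime]
    · rw [twistAngle₂_of_le (by linarith), Real.sin_zero]
  have s3 : s = (1 + quarterTime) / 3 → Real.sin (twistAngle₁ s) = 0 ∧
      Real.sin (twistAngle₂ s) = 1 := by
    rintro rfl
    constructor
    · rw [twistAngle₁_of_ge (by linarith), Real.sin_two_pi]
    · rw [twistAngle₂, show 3 * ((1 + quarterTime) / 3) - 1 = quarterTime by ring, sin_quarterTime]
  have s4 : s = (2 - quarterTime) / 3 → Real.sin (twistAngle₁ s) = 0 ∧
      Real.sin (twistAngle₂ s) = -1 := by
    rintro rfl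
    constructor
    · rw [twistAngle₁_of_ge (by linarith), Real.sin_two_pi]
    · rw [twistAngle₂, show 3 * ((2 - quarterTime) / 3) - 1 = 1 - quarterTime by ring,
        sin_one_sub_quarterTime]
  obtain ⟨m, ⟨hn, hb⟩ | ⟨hn, hb⟩ | ⟨hn, hb⟩⟩ := exists_bandStrand n
  · obtain rfl : i = 2 := hi.symm.trans hb
    rw [hn] at h
    push_cast at h
    have hj : j = 0 ∨ j = 1 := by omega
    rcases hj with rfl | rfl
    · exact absurd heq (twistedStrand_two_ne_zero s)
    · rcases twistedStrand_one_eq_two_iff.1 heq.symm with hs | hs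
      · refine hodd (hval m (r := 0) (x := 2 + (1 + quarterTime) / 3) (by norm_num) (by norm_num)
          (by norm_num [crossingPos]) (by rw [h, hs]; ring)) (iff_of_false (by decide) ?_)
        rw [a1, a2, (s3 hs).1, (s3 hs).2]; norm_num
      · refine hodd (hval m (r := 1) (x := 2 + (2 - quarterTime) / 3) (by norm_num) (by norm_num)
          (by norm_num [crossingPos]) (by rw [h, hs]; ring)) (iff_of_true (by decide) ?_)
        rw [a1, a2, (s4 hs).1, (s4 hs).2]; norm_num
  · obtain rfl : i = 0 := hi.symm.trans hb
    rw [hn] at h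
    push_cast at h
    have hj : j = 1 ∨ j = 2 := by omega
    rcases hj with rfl | rfl
    · rcases twistedStrand_zero_eq_one_iff.1 heq with hs | hs
      · refine hodd (hval m (r := 4) (x := 10 + (quarterTime - 2) / 3) (by norm_num) (by norm_num)
          (by norm_num [crossingPos]) (by rw [h, hs]; ring)) (iff_of_false (by decide) ?_)
        rw [a0, a1, (s1 hs).1, (s1 hs).2]; norm_num
      · refine hodd (hval m (r := 5) (x := 10 - (1 + quarterTime) / 3) (by norm_num) (by norm_num)
          (by norm_num [crossingPos]) (by rw [h, hs]; ring)) (iff_of_true (by decide) ?_)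
        rw [a0, a1, (s2 hs).1, (s2 hs).2]; norm_num
    · exact absurd heq.symm (twistedStrand_two_ne_zero s)
  · obtain rfl : i = 1 := hi.symm.trans hb
    rw [hn] at h
    push_cast at h
    have hj : j = 0 ∨ j = 2 := by omega
    rcases hj with rfl | rfl
    · rcases twistedStrand_zero_eq_one_iff.1 heq.symm with hs | hs
      · refine hodd (hval m (r := 7) (x := 18 + (quarterTime - 2) / 3) (by norm_num) (by norm_num)
          (by norm_num [crossingPos]) (by rw [h, hs]; ring)) (iff_of_true (by decide) ?_)
        rw [a0, a1, (s1 hs).1, (s1 hs).2]; norm_num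
      · refine hodd (hval m (r := 8) (x := 18 - (1 + quarterTime) / 3) (by norm_num) (by norm_num)
          (by norm_num [crossingPos]) (by rw [h, hs]; ring)) (iff_of_false (by decide) ?_)
        rw [a0, a1, (s2 hs).1, (s2 hs).2]; norm_num
    · rcases twistedStrand_one_eq_two_iff.1 heq with hs | hs
      · refine hodd (hval m (r := 9) (x := 18 + (1 + quarterTime) / 3) (by norm_num) (by norm_num)
          (by norm_num [crossingPos]) (by rw [h, hs]; ring)) (iff_of_true (by decide) ?_)
        rw [a1, a2, (s3 hs).1, (s3 hs).2]; norm_num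
      · refine hodd (hval m (r := 10) (x := 18 + (2 - quarterTime) / 3) (by norm_num) (by norm_num)
          (by norm_num [crossingPos]) (by rw [h, hs]; ring)) (iff_of_false (by decide) ?_)
        rw [a1, a2, (s4 hs).1, (s4 hs).2]; norm_num

theorem insertedOver_of_baseOver {m : ℤ} : insertedOver (m / 2 - 1 / 6) := by
  rcases Int.even_or_odd' m with ⟨k, rfl | rfl⟩
  · refine ⟨12 * (k - 1) + 11, ⟨6 * (k - 1) + 5, by ring⟩, ?_⟩
    rw [crossingParam_mul_add _ (by norm_num) (by norm_num)]
    norm_num [crossingPos]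
    ring
  · refine ⟨12 * k + 3, ⟨6 * k + 1, by ring⟩, ?_⟩
    rw [crossingParam_mul_add _ (by norm_num) (by norm_num)]
    norm_num [crossingPos]
    ring

theorem not_insertedOver_of_baseUnder {m : ℤ} : ¬ insertedOver (m / 2 + 1 / 6) := by
  rcases Int.even_or_odd' m with ⟨k, rfl | rfl⟩
  · have h : (((2 * k : ℤ) : ℝ) / 2 + 1 / 6) = crossingParam (12 * k + 2) := by
      rw [crossingParam_mul_add _ (by norm_num) (by norm_num)]
      norm_num [crossingPos]
    rw [h, insertedOver_crossingParam, Int.not_odd_iff_even]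
    exact ⟨6 * k + 1, by ring⟩
  · have h : (((2 * k + 1 : ℤ) : ℝ) / 2 + 1 / 6) = crossingParam (12 * k + 6) := by
      rw [crossingParam_mul_add _ (by norm_num) (by norm_num)]
      norm_num [crossingPos]
      ring
    rw [h, insertedOver_crossingParam, Int.not_odd_iff_even]
    exact ⟨6 * k + 3, by ring⟩

theorem differByBandMove_base_inserted :
    DifferByBandMove baseBraid.toDiagram insertedBraid.toDiagram := by
  refine ⟨quarterBand, Equiv.refl (Fin 1), fun _ t => t, isBand_quarterBand, IsReparam.refl, fun k t => ?_,
    fun i s hs => ?_, fun k t _ ht => ?_, fun k t l u i j s hs hij ht hu heq => ?_⟩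
  · by_cases h : ∃ n : ℤ, |24 * t - 2 - 8 * n| < 1
    · obtain ⟨n, hn⟩ := h
      have e : 24 * t = 2 + 8 * n + (24 * t - 2 - 8 * n) := by ring
      exact Or.inr ⟨bandStrand n, 24 * t - 2 - 8 * n, abs_lt.1 hn,
        (curve_eq_quarterBand_iff baseBraid).2 ⟨⟨n, e⟩, baseX_of_band e hn⟩,
        (curve_eq_quarterBand_iff insertedBraid).2 ⟨⟨n, e⟩, insertedX_of_band e hn⟩⟩
    · push Not at h
      refine Or.inl ⟨?_, Prod.ext rfl (insertedX_of_notBand fun n => by linarith [h n])⟩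
      rintro ⟨⟨s, x⟩, ⟨hs, -⟩, heq⟩
      obtain ⟨⟨n, hn⟩, -⟩ := (curve_eq_quarterBand_iff baseBraid).1 heq.symm
      have h1 := h n
      rw [show 24 * t - 2 - 8 * n = s by linarith] at h1
      exact not_lt.2 h1 (abs_lt.2 hs)
  · have hn : ∃ n : ℤ, bandStrand n = i := by
      have hi : i = 0 ∨ i = 1 ∨ i = 2 := by omega
      rcases hi with rfl | rfl | rfl
      exacts [⟨1, rfl⟩, ⟨2, rfl⟩, ⟨0, rfl⟩]
    obtain ⟨n, rfl⟩ := hn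
    have e : 24 * ((2 + 8 * n + s) / 24) = 2 + 8 * n + s := by ring
    exact ⟨(0 : Fin 1), (2 + 8 * n + s) / 24,
      (curve_eq_quarterBand_iff baseBraid).2 ⟨⟨n, e⟩, baseX_of_band e (abs_lt.2 hs)⟩⟩
  · show insertedOver t ↔ baseBraid.isOver t
    rcases isCrossingParam_baseBraid.1 ht with ⟨m, rfl⟩ | ⟨m, rfl⟩
    · exact iff_of_true insertedOver_of_baseOver ⟨m, rfl⟩
    · refine iff_of_false not_insertedOver_of_baseUnder ?_
      rintro ⟨n, hn⟩
      have h3 : (2 : ℝ) = 3 * (n - m) := by linarith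
      have h4 : (2 : ℤ) = 3 * (n - m) := by exact_mod_cast h3
      omega
  · obtain ⟨⟨n, hn⟩, hx⟩ := (curve_eq_quarterBand_iff baseBraid).1 ht
    have hi : bandStrand n = i := strandLevel_injective
      ((baseX_of_band hn (abs_lt.2 hs)).symm.trans hx)
    exact insertedOver_iff_twistedHeight hij hn hi heq

/-! ### The winding number modulo 2 of a cycle -/

theorem faceIncl_vertex (k : ℕ) (i : Fin (k + 2)) (j : Fin (k + 1)) :
    faceIncl k i (stdSimplex.vertex j) = stdSimplex.vertex (i.succAbove j) :=
  stdSimplex.map_vertex _ _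

instance contractibleSpace_stdSimplex (k : ℕ) : ContractibleSpace (stdSimplex ℝ (Fin (k + 1))) :=
  (convex_stdSimplex ℝ (Fin (k + 1))).contractibleSpace ⟨_, single_mem_stdSimplex ℝ 0⟩

/-- A choice of an angle for every point of the circle. -/
def someAngle : Circle → ℝ := Function.surjInv Circle.exp_surjective

theorem exp_someAngle (z : Circle) : Circle.exp (someAngle z) = z :=
  Function.surjInv_eq Circle.exp_surjective z

/-- The path `f ∘ σ` in the circle makes `n` turns: the increase of its angle is `2πn` plus the
difference of the chosen angles of its ends. -/
def HasTurns (f : C(S1S2, Circle)) (σ : C(stdSimplex ℝ (Fin 2), S1S2)) (n : ℤ) : Prop :=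
  ∃ θ : C(stdSimplex ℝ (Fin 2), ℝ), (∀ x, Circle.exp (θ x) = f (σ x)) ∧
    θ (stdSimplex.vertex 1) - θ (stdSimplex.vertex 0) =
      someAngle (f (σ (stdSimplex.vertex 1))) - someAngle (f (σ (stdSimplex.vertex 0))) + n * (2 * Real.pi)

theorem exists_turns_of_angle {f : C(S1S2, Circle)} {σ : C(stdSimplex ℝ (Fin 2), S1S2)}
    (θ : C(stdSimplex ℝ (Fin 2), ℝ)) (hθ : ∀ x, Circle.exp (θ x) = f (σ x)) :
    ∃ n : ℤ, θ (stdSimplex.vertex 1) - θ (stdSimplex.vertex 0) =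
      someAngle (f (σ (stdSimplex.vertex 1))) - someAngle (f (σ (stdSimplex.vertex 0))) +
        n * (2 * Real.pi) := by
  have h : ∀ x, ∃ m : ℤ, θ x = someAngle (f (σ x)) + m * (2 * Real.pi) := fun x =>
    Circle.exp_eq_exp.1 ((hθ x).trans (exp_someAngle _).symm)
  obtain ⟨a, ha⟩ := h (stdSimplex.vertex 0)
  obtain ⟨b, hb⟩ := h (stdSimplex.vertex 1)
  exact ⟨b - a, by rw [ha, hb]; push_cast; ring⟩

theorem exists_hasTurns (f : C(S1S2, Circle)) (σ : C(stdSimplex ℝ (Fin 2), S1S2)) :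
    ∃ n, HasTurns f σ n := by
  obtain ⟨θ, hθ⟩ := exists_angle (f.comp σ)
  obtain ⟨n, hn⟩ := exists_turns_of_angle θ hθ
  exact ⟨n, θ, hθ, hn⟩

theorem HasTurns.unique {f : C(S1S2, Circle)} {σ : C(stdSimplex ℝ (Fin 2), S1S2)} {m n : ℤ}
    (hm : HasTurns f σ m) (hn : HasTurns f σ n) : m = n := by
  obtain ⟨θ, h1, h2⟩ := hm
  obtain ⟨θ', h1', h2'⟩ := hn
  have hc := Circle.isCoveringMap_exp.isSeparatedMap.const_of_comp
    Circle.isCoveringMap_exp.isLocalHomeomorph.isLocallyInjective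
    (g := ⇑(θ - θ')) (θ - θ').continuous
    (fun x y => by simp only [ContinuousMap.sub_apply, Circle.exp_sub, h1, h1', div_self'])
    (stdSimplex.vertex 0) (stdSimplex.vertex 1)
  simp only [ContinuousMap.sub_apply] at hc
  have h3 : (2 * Real.pi) * m = (2 * Real.pi) * n := by linarith
  exact_mod_cast mul_left_cancel₀ (by positivity) h3

/-- The number of turns of `f ∘ σ`. -/
def turns (f : C(S1S2, Circle)) (σ : C(stdSimplex ℝ (Fin 2), S1S2)) : ℤ :=
  (exists_hasTurns f σ).choose

theorem turns_eq {f : C(S1S2, Circle)} {σ : C(stdSimplex ℝ (Fin 2), S1S2)} {n : ℤ}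
    (h : HasTurns f σ n) : turns f σ = n :=
  (exists_hasTurns f σ).choose_spec.unique h

/-- The number of turns is a cocycle. -/
theorem turns_face (f : C(S1S2, Circle)) (τ : C(stdSimplex ℝ (Fin 3), S1S2)) :
    turns f (τ.comp (faceIncl 1 0)) - turns f (τ.comp (faceIncl 1 1)) +
      turns f (τ.comp (faceIncl 1 2)) = 0 := by
  obtain ⟨θ, hθ⟩ := exists_angle (f.comp τ)
  have h : ∀ i, ∃ n : ℤ, turns f (τ.comp (faceIncl 1 i)) = n ∧
      θ (stdSimplex.vertex (i.succAbove 1)) - θ (stdSimplex.vertex (i.succAbove 0)) =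
        someAngle (f (τ (stdSimplex.vertex (i.succAbove 1)))) -
          someAngle (f (τ (stdSimplex.vertex (i.succAbove 0)))) + n * (2 * Real.pi) := by
    intro i
    have h1 : ∀ x, Circle.exp (θ.comp (faceIncl 1 i) x) = f (τ.comp (faceIncl 1 i) x) :=
      fun x => hθ _
    obtain ⟨n, hn⟩ := exists_turns_of_angle (θ.comp (faceIncl 1 i)) h1
    refine ⟨n, turns_eq ⟨_, h1, hn⟩, ?_⟩
    simpa only [ContinuousMap.comp_apply, faceIncl_vertex] using hn
  obtain ⟨a, ha, ha'⟩ := h 0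
  obtain ⟨b, hb, hb'⟩ := h 1
  obtain ⟨c, hc, hc'⟩ := h 2
  rw [ha, hb, hc]
  have e00 : (0 : Fin 3).succAbove 0 = 1 := rfl
  have e01 : (0 : Fin 3).succAbove 1 = 2 := rfl
  have e10 : (1 : Fin 3).succAbove 0 = 0 := rfl
  have e11 : (1 : Fin 3).succAbove 1 = 2 := rfl
  have e20 : (2 : Fin 3).succAbove 0 = 0 := rfl
  have e21 : (2 : Fin 3).succAbove 1 = 1 := rfl
  rw [e00, e01] at ha'
  rw [e10, e11] at hb'
  rw [e20, e21] at hc'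
  have h3 : (2 * Real.pi) * ((a - b + c : ℤ) : ℝ) = (2 * Real.pi) * 0 := by
    push_cast
    linarith
  exact_mod_cast mul_left_cancel₀ (by positivity) h3

/-- The number of turns modulo 2, on chains. -/
def turnsMod (f : C(S1S2, Circle)) : SingChain 1 →ₗ[ZMod 2] ZMod 2 :=
  Finsupp.linearCombination (ZMod 2) fun σ => (turns f σ : ZMod 2)

theorem turnsMod_single (f : C(S1S2, Circle)) (σ : C(stdSimplex ℝ (Fin 2), S1S2)) (a : ZMod 2) :
    turnsMod f (Finsupp.single σ a) = a * turns f σ := by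
  rw [turnsMod, Finsupp.linearCombination_single, smul_eq_mul]

theorem turnsMod_boundary (f : C(S1S2, Circle)) (c : SingChain 2) :
    turnsMod f (singBoundary 1 c) = 0 := by
  have h : (turnsMod f).comp (singBoundary 1) = 0 := by
    refine Finsupp.lhom_ext fun τ a => ?_
    have h1 := congrArg (Int.cast (R := ZMod 2)) (turns_face f τ)
    push_cast at h1
    rw [LinearMap.comp_apply, singBoundary, Finsupp.linearCombination_single, map_smul, map_sum,
      Fin.sum_univ_three]
    simp only [turnsMod_single, LinearMap.zero_apply, smul_eq_mul]
    rw [show ((-1 : ZMod 2) ^ ((0 : Fin 3) : ℕ)) = 1 from rfl,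
      show ((-1 : ZMod 2) ^ ((1 : Fin 3) : ℕ)) = -1 from rfl,
      show ((-1 : ZMod 2) ^ ((2 : Fin 3) : ℕ)) = 1 from rfl]
    linear_combination a * h1
  exact congrArg (fun L => L c) h

/-- A link on which some map to the circle has odd total degree is not trivial modulo 2. -/
theorem SmoothLink.not_isZ2Trivial {K : SmoothLink} (f : C(S1S2, Circle)) (d : Fin K.n → ℤ)
    (hd : ∀ k t, f (K.toFun k t) = Circle.exp (2 * Real.pi * d k * t)) (hodd : Odd (∑ k, d k)) :
    ¬ K.IsZ2Trivial := by
  rintro ⟨c, hc⟩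
  have h := turnsMod_boundary f c
  have hturns : ∀ k, turns f (K.loop k) = d k := by
    intro k
    have h0 : K.loop k (stdSimplex.vertex 0) = K.toFun k 0 := by
      show K.toFun k _ = _
      simp
    have h1 : K.loop k (stdSimplex.vertex 1) = K.toFun k 0 := by
      show K.toFun k _ = _
      rw [← K.isSmoothLink.periodic k 0]
      simp
    refine turns_eq ⟨⟨fun x => 2 * Real.pi * d k * x.1 1, continuous_const.mul
      ((continuous_apply 1).comp continuous_subtype_val)⟩, fun x => (hd k _).symm, ?_⟩
    rw [h0, h1]
    simp
    ring
  rw [hc, map_sum] at h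
  simp only [turnsMod_single, one_mul, hturns] at h
  rw [← Int.cast_sum, ZMod.intCast_zmod_eq_zero_iff_dvd] at h
  rw [← Int.not_even_iff_odd, even_iff_two_dvd] at hodd
  exact hodd (by exact_mod_cast h)

/-- The knots that are represented by closed 3-braids with one component are not trivial modulo 2,
since they run three times along `S¹`. -/
theorem ClosedBraid.not_isZ2Trivial (B : ClosedBraid) (H : B.toDiagram.Height)
    (ι : AnnulusEmbedding) : ¬ (B.toDiagram.toLink H ι).IsZ2Trivial := by
  refine SmoothLink.not_isZ2Trivial ⟨fun p => (ι.symm p).1, continuous_fst.comp ι.symm.continuous⟩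
    (fun _ => 3) (fun k t => ?_) ?_
  · have h : ι.symm (ι (B.toDiagram.lift H k t)) = B.toDiagram.lift H k t := ι.symm_apply_apply _
    show (ι.symm (ι (B.toDiagram.lift H k t))).1 = _
    rw [h]
    show Circle.exp (6 * Real.pi * t) = _
    congr 1
    push_cast
    ring
  · show Odd (∑ _k : Fin 1, (3 : ℤ))
    decide

end

theorem mainTheorem5 (ι : AnnulusEmbedding) :
    (∀ D D' : AnnularDiagram, DifferByBandMove D D' → RepresentSameLink ι D D') ∧
    (∃ (K : SmoothLink) (D D' : AnnularDiagram),
      K.IsKnot ∧ ¬ K.IsZ2Trivial ∧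
      D.Represents ι K ∧ D'.Represents ι K ∧
      D.IsAlternating ∧ D'.IsAlternating ∧ D.IsSimple ∧ D'.IsSimple ∧
      D.numCrossings < D'.numCrossings ∧ crossingNumber K < D'.numCrossings) := by
  refine ⟨fun _ _ hd => hd.representSameLink ι, ?_⟩
  obtain ⟨H, -⟩ := baseBraid.toDiagram.exists_height (Z := fun _ => ∅) (fun _ _ => Iff.rfl)
    (fun _ => isClosed_empty) (fun _ _ h => h.elim)
  have hD := baseBraid.toDiagram.represents_toLink H ι
  have hn : crossingNumber (baseBraid.toDiagram.toLink H ι) ≤ baseBraid.toDiagram.numCrossings :=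
    Nat.sInf_le ⟨ι, _, hD, rfl⟩
  exact ⟨baseBraid.toDiagram.toLink H ι, baseBraid.toDiagram, insertedBraid.toDiagram, rfl,
    baseBraid.not_isZ2Trivial H ι, hD, ((differByBandMove_base_inserted.representSameLink ι).2 _).1 hD,
    isAlternating_baseBraid, isAlternating_insertedBraid, baseBraid.isSimple_toDiagram,
    insertedBraid.isSimple_toDiagram, numCrossings_lt,
    hn.trans_lt numCrossings_lt⟩
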